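/- Let $R$ be an excellent regular local ring with maximal ideal $M$ and residue field $K$, let $J\subset R$ be a non-zero ideal, and let $(u,y)=(u_1,\dots,u_e;y_1,\dots,y_r)$ be a regular system of parameters of $R$ such that $(y)$ yields the directrix of $J'=J\cdot R'$, $R'=R/\langle u\rangle$ (that is, $r$ is the least number of linear forms $Z_1,\dots,Z_s$ of $\mathrm{gr}_{M'}(R')=K[Y]$, $M'=MR'$, such that the ideal of initial forms $\mathrm{In}_{M'}(J')$ is generated by elements of $K[Z_1,\dots,Z_s]$). Notation. Every $g\in R$ has a finite expansion $g=\sum C_{A,B}u^Ay^B$ with $C_{A,B}\in R^\times\cup\{0\}$, over the unique set of exponents $(A,B)$ with $C_{A,B}\ne0$ that is an antichain for the componentwise order; put $\overline{C}=C \bmod M$. For $g\notin\langle u\rangle$ let $n_{(u)}(g)$ be the order of $g\bmod\langle u\rangle$ with respect to $\langle y\rangle\bmod \langle u\rangle$, and $in_0(g)=\sum_{|B|=n_{(u)}(g)}\overline{C_{0,B}}\,Y^B\in K[Y]$. An $F$-subset of $\mathbb R^e_{\ge0}$ is a closed convex subset $\Delta$ with $\Delta+\mathbb R^e_{\ge0}\subset\Delta$.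 A positive linear form is $L(v)=\sum a_iv_i$ with all $a_i\in\mathbb Q_{>0}$; a vertex of $\Delta$ is a point $v$ such that, for some positive linear form $L$, $L\ge1$ on $\Delta$ and $\{w\in\Delta\mid L(w)=1\}=\{v\}$. For a system $(f)=(f_1,\dots,f_m)$ with $f_i\notin\langle u\rangle$ and expansions $f_i=\sum C_{A,B,i}u^Ay^B$, $n_i=n_{(u)}(f_i)$, let $\Delta(f;u;y)$ be the smallest $F$-subset containing all points $A/(n_i-|B|)$ with $C_{A,B,i}\neq0$, $|B|<n_i$. For a positive linear form $L$, $in_L(g)\in K[U,Y]=\mathrm{gr}_M(R)$ is the sum of the terms $\overline{C_{A,B}}U^AY^B$ of the expansion of $g$ for which $L(A)+|B|$ is minimal. Non-zero elements $f_1,\dots,f_m\in J$ form a $(u)$-standard basis of $J$ (with respect to $(y)$) if for some positive linear form $L$: $in_L(f_i)=in_0(f_i)$ for all $i$; $\langle in_L(g)\mid g\in J\rangle=\langle in_0(f_1),\dots,in_0(f_m)\rangle$; $n_1\le\dots\le n_m$; and $in_0(f_i)\notin\langle in_0(f_1),\dots,in_0(f_{i-1})\rangle$ for all $i$. Let $\Delta(J;u;y)$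 be the intersection of the $\Delta(f;u;y)$ over all $(u)$-standard bases $(f)$ of $J$ with respect to $(y)$. The exponent $\exp(P)$ of $P\in K[U,Y]\setminus\langle U\rangle$ (or, with its expansion, of an element of $R\setminus\langle u\rangle$) is the least $B$, for the lexicographic order $<$ of $(|B|,B_1,\dots,B_r)$, such that $Y^B$ occurs in it with non-zero coefficient (and with no factor $U_i$). For an ideal $I$ of $K[U,Y]$, $\exp(I)$ is the set of exponents of the elements of $I\setminus\langle U\rangle$. A system $(G_1,\dots,G_m)$ in $K[U,Y]$, together with integers $n_1,\dots,n_m$, is normalized if no monomial $U^AY^B$ with $B\in\exp(\langle G_1,\dots,G_{i-1}\rangle)$ and $|B|\le n_i$ occurs in $G_i$, for every $i$. The system $(f)$ is $0$-normalized if $(in_0(f_1),\dots,in_0(f_m))$ is normalized; it is normalized at $v$ if $(in_v(f_1),\dots,in_v(f_m))$ is, where $in_v(f_i)=in_0(f_i)+\sum\overline{C_{A,B,i}}U^AY^B$, the sum over $|B|<n_i$ with $A/(n_i-|B|)=v$ (in both cases with $n_i=n_{(u)}(f_i)$). It is vertex-normalized if it is $0$-normalized, is normalized at every vertex of $\Delta(f;u;y)$,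 and, in case $\Delta(f;u;y)=\emptyset$, satisfies $C_{A,B,i}=0$ whenever $B\in\exp(\langle in_0(f_1),\dots,in_0(f_{i-1})\rangle)$ and $|B|\le n_i$. Statement. Let $(f_1,\dots,f_m)$ be a $(u)$-standard basis of $J$ with respect to $(y)$ with $f_i\notin\langle u\rangle$ for all $i$. Then there exist $h_{ij}\in R$ such that $(g)=(g_1,\dots,g_m)$, with $g_i=f_i-\sum_{j<i}h_{ij}f_j$ (so $g_1=f_1$), is a vertex-normalized $(u)$-standard basis of $J$ with respect to $(y)$ and $$\Delta(g;u;y)=\Delta(J;u;y).$$ Moreover $(g)$ can be chosen such that, if $(f)$ is $0$-normalized and $\exp(f_1)<\dots<\exp(f_m)$, then also $\exp(g_1)<\dots<\exp(g_m)$. -/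

import Mathlib

open scoped TensorProduct

universe uR

noncomputable section

namespace CharPoly

/-! ### Excellent rings -/

/-- A (Noetherian) ring is catenary if any two saturated chains of primes with the same end points
have the same length. -/
def IsCatenary (A : Type uR) [CommRing A] : Prop :=
  ∀ s t : RelSeries {x : PrimeSpectrum A × PrimeSpectrum A | x.1 ⋖ x.2},
    s.head = t.head → s.last = t.last → s.length = t.length

/-- Every algebra of finite type is catenary. -/
def IsUniversallyCatenary (A : Type uR) [CommRing A] : Prop :=
  ∀ (S : Type uR) [CommRing S] [Algebra A S], Algebra.FiniteType A S → IsCatenary S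

/-- The formal fibres of a local ring `A` are geometrically regular: for every prime `q` of `A`
and every finite field extension `k` of the residue field `κ(q)` the ring
`k ⊗[A] Â = k ⊗[κ(q)] (κ(q) ⊗[A] Â)` is regular. -/
def HasGeometricallyRegularFormalFibres (A : Type uR) [CommRing A] [IsLocalRing A] : Prop :=
  ∀ (q : Ideal A) [q.IsPrime] (k : Type uR) [Field k] [Algebra q.ResidueField k] [Algebra A k]
    [IsScalarTower A q.ResidueField k], Module.Finite q.ResidueField k →
      IsRegularRing (k ⊗[A] AdicCompletion (IsLocalRing.maximalIdeal A) A)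

/-- Grothendieck rings. -/
def IsGRing (A : Type uR) [CommRing A] : Prop :=
  ∀ (p : Ideal A) [p.IsPrime], HasGeometricallyRegularFormalFibres (Localization.AtPrime p)

/-- Every algebra of finite type has an open regular locus. -/
def IsJ2Ring (A : Type uR) [CommRing A] : Prop :=
  ∀ (S : Type uR) [CommRing S] [Algebra A S], Algebra.FiniteType A S →
    IsOpen {p : PrimeSpectrum S | IsRegularLocalRing (Localization.AtPrime p.asIdeal)}

/-- Excellent rings. -/
structure IsExcellentRing (A : Type uR) [CommRing A] : Prop where
  noetherian : IsNoetherianRing A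
  universallyCatenary : IsUniversallyCatenary A
  gRing : IsGRing A
  j2 : IsJ2Ring A

/-! ### Linear forms and polyhedra in `ℝ^e` -/

section Polyhedra

variable {e : ℕ}

/-- The linear form on `ℝ^e` with rational coefficients `a`. -/
def linForm (a : Fin e → ℚ) (v : Fin e → ℝ) : ℝ := ∑ i, (a i : ℝ) * v i

/-- Positive (rational) linear forms. -/
def IsPositive (a : Fin e → ℚ) : Prop := ∀ i, 0 < a i

/-- `F`-subsets of the non-negative orthant. -/
structure IsFSubset (D : Set (Fin e → ℝ)) : Prop where
  nonneg : ∀ v ∈ D, ∀ i, 0 ≤ v i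
  closed : IsClosed D
  convex : Convex ℝ D
  add_mem : ∀ v ∈ D, ∀ w : Fin e → ℝ, (∀ i, 0 ≤ w i) → v + w ∈ D

/-- The smallest `F`-subset that contains a set `S` of points of the orthant. -/
def fHull (S : Set (Fin e → ℝ)) : Set (Fin e → ℝ) := ⋂₀ {D | IsFSubset D ∧ S ⊆ D}

/-- `v` is a vertex of `D`: some positive linear form is `≥ 1` on `D` and takes the value `1`
on `D` exactly at `v`. -/
def IsVertex (D : Set (Fin e → ℝ)) (v : Fin e → ℝ) : Prop :=
  ∃ a : Fin e → ℚ, IsPositive a ∧ (∀ w ∈ D, 1 ≤ linForm a w) ∧ {w ∈ D | linForm a w = 1} = {v}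

end Polyhedra

/-! ### Exponents `(A, B)` of monomials `U^A Y^B` -/

section Exponents

variable {e r : ℕ}

/-- The `U`-part `A` of an exponent `(A, B)`. -/
def uPart (d : (Fin e ⊕ Fin r) →₀ ℕ) : Fin e →₀ ℕ := (Finsupp.sumFinsuppEquivProdFinsupp d).1

/-- The `Y`-part `B` of an exponent `(A, B)`. -/
def yPart (d : (Fin e ⊕ Fin r) →₀ ℕ) : Fin r →₀ ℕ := (Finsupp.sumFinsuppEquivProdFinsupp d).2

/-- `|B|` for an exponent `(A, B)`. -/
def yDeg (d : (Fin e ⊕ Fin r) →₀ ℕ) : ℕ := (yPart d).degree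

/-- `A` as a point of `ℝ^e`. -/
def uVec (d : (Fin e ⊕ Fin r) →₀ ℕ) : Fin e → ℝ := fun i => (uPart d i : ℝ)

/-- The point `A / (n - |B|)`; used for `|B| < n` only. -/
def slopePoint (n : ℕ) (d : (Fin e ⊕ Fin r) →₀ ℕ) : Fin e → ℝ :=
  fun i => uVec d i / ((n : ℝ) - (yDeg d : ℝ))

/-- The weight `L(A) + |B|`. -/
def weight (a : Fin e → ℚ) (d : (Fin e ⊕ Fin r) →₀ ℕ) : ℝ := linForm a (uVec d) + (yDeg d : ℝ)

/-- `B` is the exponent of a polynomial in `(U, Y)`: the least `B`, with respect to the order of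
the vectors `(|B|, B_1, …, B_r)`, such that `Y^B` (without `U`) occurs in it. There is none if the
polynomial lies in the ideal `⟨U⟩`. -/
def IsExponent {S : Type*} [CommSemiring S] (P : MvPolynomial (Fin e ⊕ Fin r) S)
    (B : Fin r →₀ ℕ) : Prop :=
  IsLeast {b : DegLex (Fin r →₀ ℕ) |
    ∃ d, P.coeff d ≠ 0 ∧ uPart d = 0 ∧ toDegLex (yPart d) = b} (toDegLex B)

/-- The exponents of the elements of an ideal of `K[U, Y]`. -/
def exponents {K : Type*} [Field K] (I : Ideal (MvPolynomial (Fin e ⊕ Fin r) K)) :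
    Set (Fin r →₀ ℕ) :=
  {B | ∃ P ∈ I, IsExponent P B}

end Exponents

/-! ### Expansions and initial forms -/

section Expansions

variable {R : Type uR} [CommRing R] {e r : ℕ} (u : Fin e → R) (y : Fin r → R)

/-- `(u, y)` is a regular system of parameters of the regular local ring `R`. -/
def IsRSP [IsLocalRing R] : Prop :=
  Ideal.span (Set.range u ∪ Set.range y) = IsLocalRing.maximalIdeal R ∧
    ((e + r : ℕ) : WithBot ℕ∞) = ringKrullDim R

/-- The finite expansion `g = ∑ C_{A,B} u^A y^B` with unit coefficients over the (unique) minimal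
set of exponents `(A, B)`, i.e. the exponents form an antichain. It is recorded
as the polynomial `∑ C_{A,B} U^A Y^B`. -/
structure IsExpansion (g : R) (P : MvPolynomial (Fin e ⊕ Fin r) R) : Prop where
  isUnit_coeff : ∀ d, P.coeff d ≠ 0 → IsUnit (P.coeff d)
  antichain : IsAntichain (· ≤ ·) (P.support : Set ((Fin e ⊕ Fin r) →₀ ℕ))
  eval_eq : MvPolynomial.eval (Sum.elim u y) P = g

open Classical in
/-- The expansion of `g`. In a regular local ring with r.s.p. `(u, y)` it exists, and its
exponents and the residue classes of its coefficients do not depend on the choice. -/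
def expansion (g : R) : MvPolynomial (Fin e ⊕ Fin r) R :=
  if h : ∃ P, IsExpansion u y g P then h.choose else 0

/-- `n_{(u)}(g)`, the order of `g mod ⟨u⟩` with respect to the ideal `⟨y⟩ mod ⟨u⟩`
(used for `g ∉ ⟨u⟩` only). -/
def ord (g : R) : ℕ :=
  sSup {n : ℕ | Ideal.Quotient.mk (Ideal.span (Set.range u)) g ∈
    ((Ideal.span (Set.range y)).map (Ideal.Quotient.mk (Ideal.span (Set.range u)))) ^ n}

/-- The polyhedron `Δ(g; u; y)` of an element. -/
def polyhedronElt (g : R) : Set (Fin e → ℝ) :=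
  fHull {v | ∃ d ∈ (expansion u y g).support,
    yDeg d < ord u y g ∧ v = slopePoint (ord u y g) d}

/-- The polyhedron `Δ(f; u; y)` of a system of elements. -/
def polyhedron {m : ℕ} (f : Fin m → R) : Set (Fin e → ℝ) :=
  fHull (⋃ i, polyhedronElt u y (f i))

variable [IsLocalRing R]

/-- The `0`-initial form `in_0(g) ∈ K[Y]`. -/
def initZero (g : R) : MvPolynomial (Fin r) (IsLocalRing.ResidueField R) :=
  open Classical in
  ∑ d ∈ (expansion u y g).support with uPart d = 0 ∧ yDeg d = ord u y g,
    MvPolynomial.monomial (yPart d) (IsLocalRing.residue R ((expansion u y g).coeff d))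

/-- The `0`-initial form as an element of `K[U, Y]`. -/
def initZeroUY (g : R) : MvPolynomial (Fin e ⊕ Fin r) (IsLocalRing.ResidueField R) :=
  MvPolynomial.rename Sum.inr (initZero u y g)

/-- The initial form `in_L(g) ∈ K[U, Y] = gr_M(R)`: the terms of minimal weight `L(A) + |B|`. -/
def initL (a : Fin e → ℚ) (g : R) :
    MvPolynomial (Fin e ⊕ Fin r) (IsLocalRing.ResidueField R) :=
  open Classical in
  ∑ d ∈ (expansion u y g).support with
      ∀ d' ∈ (expansion u y g).support, weight a d ≤ weight a d',
    MvPolynomial.monomial d (IsLocalRing.residue R ((expansion u y g).coeff d))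

/-- The `v`-initial form `in_v(g) ∈ K[U, Y]`. -/
def initVertex (v : Fin e → ℝ) (g : R) :
    MvPolynomial (Fin e ⊕ Fin r) (IsLocalRing.ResidueField R) :=
  open Classical in
  initZeroUY u y g +
    ∑ d ∈ (expansion u y g).support with
        yDeg d < ord u y g ∧ slopePoint (ord u y g) d = v,
      MvPolynomial.monomial d (IsLocalRing.residue R ((expansion u y g).coeff d))

/-! ### Directrix and `(u)`-standard bases -/

/-- The ideal `In_{M'}(J')` of initial forms of `J' = J R'`, `R' = R / ⟨u⟩`, in
`gr_{M'}(R') = K[Y]`. -/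
def initialIdeal (J : Ideal R) : Ideal (MvPolynomial (Fin r) (IsLocalRing.ResidueField R)) :=
  Ideal.span {F | ∃ g ∈ J, g ∉ Ideal.span (Set.range u) ∧ F = initZero u y g}

/-- `(y)` yields the directrix of `J'`, for a r.s.p. `(u, y)`: the number `r` is the least number
of linear forms `Z_1, …, Z_s` of `gr_{M'}(R') = K[Y_1, …, Y_r]` such that `In_{M'}(J')` is
generated by elements of `K[Z_1, …, Z_s]` (for `s = r` and `Z = Y` this is always the case). -/
def YieldsDirectrix (J : Ideal R) : Prop :=
  ∀ (s : ℕ) (Z : Fin s → MvPolynomial (Fin r) (IsLocalRing.ResidueField R)),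
    (∀ i, (Z i).IsHomogeneous 1) →
    (∃ T : Set (MvPolynomial (Fin r) (IsLocalRing.ResidueField R)),
      T ⊆ (Algebra.adjoin (IsLocalRing.ResidueField R) (Set.range Z) : Set _) ∧
        Ideal.span T = initialIdeal u y J) →
    r ≤ s

/-- `(f)` is a `(u)`-standard basis of `J` with reference datum `(y, L)`, where `L` is the linear
form with coefficients `a`. -/
structure IsReferenceDatum (J : Ideal R) {m : ℕ} (f : Fin m → R) (a : Fin e → ℚ) : Prop where
  positive : IsPositive a
  mem : ∀ i, f i ∈ J
  ne_zero : ∀ i, f i ≠ 0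
  effective : ∀ i, initL u y a (f i) = initZeroUY u y (f i)
  span_eq : Ideal.span {F | ∃ g ∈ J, F = initL u y a g} =
    Ideal.span (Set.range fun i => initZeroUY u y (f i))
  ord_mono : ∀ i j, i ≤ j → ord u y (f i) ≤ ord u y (f j)
  notMem : ∀ i, initZero u y (f i) ∉ Ideal.span {F | ∃ j < i, F = initZero u y (f j)}

/-- `(f)` is a `(u)`-standard basis of `J` (with respect to the fixed system `(y)`). -/
def IsStandardBasis (J : Ideal R) {m : ℕ} (f : Fin m → R) : Prop :=
  ∃ a : Fin e → ℚ, IsReferenceDatum u y J f a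

/-- The polyhedron `Δ(J; u; y)`: the intersection of the polyhedra of all `(u)`-standard bases. -/
def polyhedronIdeal (J : Ideal R) : Set (Fin e → ℝ) :=
  ⋂₀ {D | ∃ (m : ℕ) (f : Fin m → R), IsStandardBasis u y J f ∧ D = polyhedron u y f}

/-! ### Normalization -/

/-- A system `(G)` in `K[U, Y]`, with prescribed bounds `n_i`, is normalized: no `U^A Y^B` with
`B ∈ exp(⟨G_1, …, G_{i-1}⟩)` and `|B| ≤ n_i` occurs in `G_i`. -/
def NormalizedPoly {K : Type*} [Field K] {m : ℕ} (n : Fin m → ℕ)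
    (G : Fin m → MvPolynomial (Fin e ⊕ Fin r) K) : Prop :=
  ∀ i d, yPart d ∈ exponents (Ideal.span {F | ∃ j < i, F = G j}) → yDeg d ≤ n i →
    (G i).coeff d = 0

/-- `(f)` is `0`-normalized. -/
def ZeroNormalized {m : ℕ} (f : Fin m → R) : Prop :=
  NormalizedPoly (fun i => ord u y (f i)) (fun i => initZeroUY u y (f i))

/-- `(f)` is normalized at `v`. -/
def NormalizedAt (v : Fin e → ℝ) {m : ℕ} (f : Fin m → R) : Prop :=
  NormalizedPoly (fun i => ord u y (f i)) (fun i => initVertex u y v (f i))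

/-- `(f)` is normalized: no `u^A y^B` with `|B| ≤ n_i` and with `B` an exponent of the ideal
`⟨in_0(f_1), …, in_0(f_{i-1})⟩` occurs in the expansion of `f_i`. -/
def Normalized {m : ℕ} (f : Fin m → R) : Prop :=
  ∀ i d, yPart d ∈ exponents (Ideal.span {F | ∃ j < i, F = initZeroUY u y (f j)}) →
    yDeg d ≤ ord u y (f i) → (expansion u y (f i)).coeff d = 0

/-- `(f)` is vertex-normalized: it is `0`-normalized, normalized at every vertex of `Δ(f; u; y)`,
and if the polyhedron is empty then it is normalized. (The first property follows from the second
one if there is a vertex.) -/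
structure VertexNormalized {m : ℕ} (f : Fin m → R) : Prop where
  zero : ZeroNormalized u y f
  vertex : ∀ v, IsVertex (polyhedron u y f) v → NormalizedAt u y v f
  empty : polyhedron u y f = ∅ → Normalized u y f

/-- `exp(f_1) < exp(f_2) < … < exp(f_m)`. -/
def IncreasingExponents {m : ℕ} (f : Fin m → R) : Prop :=
  ∀ i j, i < j → ∀ B B', IsExponent (expansion u y (f i)) B → IsExponent (expansion u y (f j)) B' →
    toDegLex B < toDegLex B'

end Expansions

end CharPoly

end

/-!
The proof works in `R` itself, without passing to a completion. Let `x = (u, y)` and write `n_i`,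
`G_i` for the order and the `0`-initial form of `f_i`.

*Expansions.* The parameters are analytically independent (`analyticallyIndependentOn`). Hence every
`g` lies in a smallest monomial ideal, whose minimal monomials are those of the expansion of `g`,
and `g` belongs to the ideal generated by the monomials with exponents in an upper set `E` if and
only if the expansion of `g` has its exponents in `E` (`mem_monoIdeal_iff_expansion`). So all the
conditions on expansions are conditions of membership in monomial ideals, and the initial form for a
positive linear form is the symbol in a weighted filtration (`isInit_iff_coeff`).

*Division.* Elements of `R` can be divided by the `f_j`, `j < i`, up to any given weight. The
remainder has only normalized monomials, i.e. monomials `u^A y^B` where `B` is not an exponent of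
`⟨G_1, …, G_{i-1}⟩` (`HasInitialForms.exists_division`). Division also shows that if the `G_j`
generate the initial forms of `J` for one positive linear form, then they do so for every positive
linear form for which they are the initial forms of the `f_j` (`HasInitialForms.initialFormsMem`).

*Comparison of standard bases.* Let `f'` be another standard basis of `J`, and let `b` be a positive
linear form which is larger than `1` on its polyhedron. Let `g` be a system in `J`, for example one
obtained from `f` by division, such that the weights of the expansion of `g_i` for the linear form
of `f` are at least `n_i`. Suppose that some points of `g` lie in `b ≤ 1`, and that the monomials
belonging to such points are normalized. Scale `b` so that its minimum on the points of `g` is `1`.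
Then some initial form of a `g_i` has a term `U^A Y^B` with `|B| < n_i`, while it lies in the ideal
generated by the `G_j`; the least exponent of its coefficient of `U^A` is an exponent of this ideal
of degree less than `n_i`, hence an exponent of `⟨G_1, …, G_{i-1}⟩`, a contradiction
(`IsReferenceDatum.lt_weight_of_normalized`). Since points outside of an `F`-subset are separated
from it by positive rational linear forms (`IsFSubset.exists_linForm_lt`), the points outside of
`Δ(J; u; y)` disappear one after the other if the `f_i` are divided by their predecessors up to
increasing weights.

*Limit.* Let `E_i` be the upper set generated by the exponents which are normalized and have their
point in `Δ(J; u; y)`. The divisions show that `f_i` belongs to the sum of the ideal of the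
admissible combinations of the `f_j`, `j < i`, of the monomial ideal of `E_i`, and of any power of
the maximal ideal. By Krull's intersection theorem the last summand can be omitted, which yields
`g_i` in the monomial ideal of `E_i` (`IsReferenceDatum.exists_normalized`). The polyhedron of `g`
is therefore contained in `Δ(J; u; y)`. The passage to the upper set destroys normalization in
general, but not at vertices, and not at the monomials of `Y`-degree `n_i` without `U`
(`yPart_notMem_of_isVertex`, `yPart_notMem_of_uPart_eq_zero`): this is why the result is
vertex-normalized. The `0`-initial forms change by a unitriangular transformation only, so that `g`
is a standard basis; they do not change at all if `f` is `0`-normalized.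
-/

noncomputable section

namespace CharPoly

/-! ### Regular systems of parameters: prime ideals generated by parameters -/

section PrimeParameters

open IsLocalRing

theorem mk_mem_maximalIdeal {A : Type*} [CommRing A] [IsLocalRing A] {I : Ideal A}
    [IsLocalRing (A ⧸ I)] {x : A} (hx : x ∈ maximalIdeal A) :
    Ideal.Quotient.mk I x ∈ maximalIdeal (A ⧸ I) := by
  have := IsLocalHom.of_surjective (Ideal.Quotient.mk I) Ideal.Quotient.mk_surjective
  rw [IsLocalRing.mem_maximalIdeal, mem_nonunits_iff]
  intro hu
  exact (IsLocalRing.mem_maximalIdeal _).1 hx (isUnit_of_map_unit (Ideal.Quotient.mk I) x hu)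

theorem ringKrullDim_quotient_le_quotient_quotient {A : Type*} [CommRing A] [IsNoetherianRing A]
    [IsLocalRing A] {I : Ideal A} [Nontrivial (A ⧸ I)] {x : A} (hx : x ∈ maximalIdeal A) :
    ringKrullDim (A ⧸ I) ≤ ringKrullDim ((A ⧸ I) ⧸ Ideal.span {Ideal.Quotient.mk I x}) + 1 := by
  have := IsLocalRing.of_surjective' (Ideal.Quotient.mk I) Ideal.Quotient.mk_surjective
  have h := ringKrullDim_le_ringKrullDim_quotient_add_encard (R := A ⧸ I)
    {Ideal.Quotient.mk I x} (by
      rw [Set.singleton_subset_iff, SetLike.mem_coe, IsLocalRing.ringJacobson_eq_maximalIdeal]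
      exact mk_mem_maximalIdeal hx)
  simpa using h

/-- If `x` generates a prime ideal and `dim (A / x)` is smaller than `dim A`, then `A` is a domain:
the bottom `P` of a chain of maximal length satisfies `P ⊆ (x)` for dimension reasons, so `P = x P`
because `x ∉ P`, and `P = 0` by Nakayama. -/
theorem isPrime_bot_of_span_singleton {A : Type*} [CommRing A] [IsNoetherianRing A] [IsLocalRing A]
    {x : A} (hx : x ∈ maximalIdeal A) (hp : (Ideal.span {x}).IsPrime) {c : ℕ}
    (hd : ((c + 1 : ℕ) : WithBot ℕ∞) ≤ ringKrullDim A)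
    (hq : ringKrullDim (A ⧸ Ideal.span {x}) ≤ (c : WithBot ℕ∞)) : (⊥ : Ideal A).IsPrime := by
  obtain ⟨l, hl⟩ := Order.le_krullDim_iff.1 hd
  set P : Ideal A := l.head.asIdeal with hP
  have hPp : P.IsPrime := l.head.isPrime
  have hPd : ((c + 1 : ℕ) : WithBot ℕ∞) ≤ ringKrullDim (A ⧸ P) := by
    rw [ringKrullDim_quotient]
    refine Order.le_krullDim_iff.2 ⟨⟨l.length, fun i => ⟨l i, ?_⟩, fun i => ?_⟩, hl⟩
    · exact (LTSeries.head_le l i : l.head ≤ l i)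
    · exact l.step i
  have hcc : ¬ ((c + 1 : ℕ) : WithBot ℕ∞) ≤ (c : WithBot ℕ∞) := by
    intro h
    have : c + 1 ≤ c := by exact_mod_cast h
    omega
  -- some `p ∈ P` outside of `(x)` would give `dim A/P ≤ dim A/(x, p) + 1 ≤ dim A/(x)`
  have hle : P ≤ Ideal.span {x} := by
    intro p hpP
    by_contra hpx
    have : Nontrivial (A ⧸ P) := Ideal.Quotient.nontrivial_iff.2 hPp.ne_top
    have h1 : ringKrullDim (A ⧸ P) ≤
        ringKrullDim ((A ⧸ P) ⧸ Ideal.span {Ideal.Quotient.mk P x}) + 1 :=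
      ringKrullDim_quotient_le_quotient_quotient hx
    have h2 : ringKrullDim ((A ⧸ P) ⧸ Ideal.span {Ideal.Quotient.mk P x}) ≤
        ringKrullDim ((A ⧸ Ideal.span {x}) ⧸
          Ideal.span {Ideal.Quotient.mk (Ideal.span {x}) p}) := by
      refine ringKrullDim_le_of_surjective (Ideal.Quotient.lift _ (Ideal.Quotient.lift _
        ((Ideal.Quotient.mk (Ideal.span {Ideal.Quotient.mk P x})).comp (Ideal.Quotient.mk P)) ?_)
          ?_) ?_
      · intro a ha
        obtain ⟨b, rfl⟩ := Ideal.mem_span_singleton'.1 ha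
        simp only [map_mul, RingHom.comp_apply]
        rw [Ideal.Quotient.eq_zero_iff_mem.2 (Ideal.mem_span_singleton_self _), mul_zero]
      · intro a ha
        obtain ⟨b, rfl⟩ := Ideal.mem_span_singleton'.1 ha
        rw [map_mul, Ideal.Quotient.lift_mk, RingHom.comp_apply,
          Ideal.Quotient.eq_zero_iff_mem.2 hpP, map_zero, mul_zero]
      · refine Ideal.Quotient.lift_surjective_of_surjective _ _
          (Ideal.Quotient.lift_surjective_of_surjective _ _ ?_)
        exact Ideal.Quotient.mk_surjective.comp Ideal.Quotient.mk_surjective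
    have hdom : IsDomain (A ⧸ Ideal.span {x}) := Ideal.Quotient.isDomain _
    have h3 := ringKrullDim_quotient_succ_le_of_nonZeroDivisor
      (r := Ideal.Quotient.mk (Ideal.span {x}) p)
      (mem_nonZeroDivisors_of_ne_zero (fun h => hpx (Ideal.Quotient.eq_zero_iff_mem.1 h)))
    exact hcc (hPd.trans (h1.trans ((add_le_add_left h2 1).trans (h3.trans hq))))
  have hxP : x ∉ P := by
    intro h
    have : P = Ideal.span {x} := le_antisymm hle ((Ideal.span_singleton_le_iff_mem _).2 h)
    rw [this] at hPd
    exact hcc (hPd.trans hq)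
  have hbot : P = ⊥ := by
    refine Submodule.eq_bot_of_le_smul_of_le_jacobson_bot (Ideal.span {x}) P
      (IsNoetherian.noetherian P) ?_ ?_
    · intro p hpP
      obtain ⟨a, rfl⟩ := Ideal.mem_span_singleton'.1 (hle hpP)
      rw [mul_comm]
      exact Ideal.mul_mem_mul (Ideal.mem_span_singleton_self x)
        ((hPp.mem_or_mem hpP).resolve_right hxP)
    · rw [IsLocalRing.jacobson_eq_maximalIdeal ⊥ bot_ne_top]
      exact (Ideal.span_singleton_le_iff_mem _).2 hx
  exact hbot ▸ hPp

theorem span_image_insert {R : Type*} [CommRing R] {σ : Type*} [DecidableEq σ] (x : σ → R)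
    (t : Finset σ) (i : σ) :
    Ideal.span (x '' ↑(insert i t)) = Ideal.span (x '' ↑t) ⊔ Ideal.span {x i} := by
  rw [Finset.coe_insert, Set.image_insert_eq, Ideal.span_insert, sup_comm]

variable {R : Type*} [CommRing R] [IsNoetherianRing R] [IsLocalRing R] {σ : Type*} [DecidableEq σ]
  {x : σ → R}

theorem ringKrullDim_quotient_insert (hM : Ideal.span (Set.range x) = maximalIdeal R)
    (t : Finset σ) (i : σ) :
    ringKrullDim (R ⧸ Ideal.span (x '' (t : Set σ))) ≤
      ringKrullDim (R ⧸ Ideal.span (x '' ↑(insert i t))) + 1 := by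
  set I := Ideal.span (x '' (t : Set σ)) with hI
  have hxM : ∀ j, x j ∈ maximalIdeal R := fun j => hM ▸ Ideal.subset_span ⟨j, rfl⟩
  have hIM : I ≤ maximalIdeal R := Ideal.span_le.2 (by rintro _ ⟨j, -, rfl⟩; exact hxM j)
  have : Nontrivial (R ⧸ I) := Ideal.Quotient.nontrivial_iff.2 fun h =>
    (maximalIdeal.isMaximal R).ne_top (top_le_iff.1 (h ▸ hIM))
  refine (ringKrullDim_quotient_le_quotient_quotient (hxM i)).trans (add_le_add_left ?_ 1)
  refine ringKrullDim_le_of_surjective (Ideal.Quotient.lift _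
    ((Ideal.Quotient.mk (Ideal.span {Ideal.Quotient.mk I (x i)})).comp (Ideal.Quotient.mk I)) ?_) ?_
  · intro a ha
    have : Ideal.span (x '' ↑(insert i t)) ≤ RingHom.ker
        ((Ideal.Quotient.mk (Ideal.span {Ideal.Quotient.mk I (x i)})).comp
          (Ideal.Quotient.mk I)) := by
      rw [span_image_insert, sup_le_iff, Ideal.span_singleton_le_iff_mem]
      refine ⟨fun b hb => ?_, ?_⟩
      · rw [RingHom.mem_ker, RingHom.comp_apply, Ideal.Quotient.eq_zero_iff_mem.2 hb, map_zero]
      · rw [RingHom.mem_ker, RingHom.comp_apply, Ideal.Quotient.eq_zero_iff_mem]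
        exact Ideal.mem_span_singleton_self _
    exact RingHom.mem_ker.1 (this ha)
  · exact Ideal.Quotient.lift_surjective_of_surjective _ _
      (Ideal.Quotient.mk_surjective.comp Ideal.Quotient.mk_surjective)

variable [Fintype σ]

theorem ringKrullDim_quotient_parameters_le (hM : Ideal.span (Set.range x) = maximalIdeal R) :
    ∀ (k : ℕ) (t : Finset σ), tᶜ.card = k →
      ringKrullDim (R ⧸ Ideal.span (x '' (t : Set σ))) ≤ (k : WithBot ℕ∞) := by
  intro k
  induction k with
  | zero =>
    intro t ht
    have : t = Finset.univ := by
      rwa [Finset.card_eq_zero, Finset.compl_eq_empty_iff] at ht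
    subst this
    rw [Finset.coe_univ, Set.image_univ, hM]
    let := Ideal.Quotient.field (maximalIdeal R)
    rw [ringKrullDim_eq_zero_of_field]
    exact le_rfl
  | succ k ih =>
    intro t ht
    obtain ⟨i, hi⟩ : tᶜ.Nonempty := Finset.card_pos.1 (by omega)
    have hk : (insert i t)ᶜ.card = k := by
      rw [Finset.compl_insert, Finset.card_erase_of_mem hi]; omega
    refine (ringKrullDim_quotient_insert hM t i).trans ?_
    push_cast
    exact add_le_add_left (ih _ hk) 1

theorem le_ringKrullDim_quotient_parameters (hM : Ideal.span (Set.range x) = maximalIdeal R)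
    (hdim : (Fintype.card σ : WithBot ℕ∞) = ringKrullDim R) (t : Finset σ) :
    (tᶜ.card : WithBot ℕ∞) ≤ ringKrullDim (R ⧸ Ideal.span (x '' (t : Set σ))) := by
  have hxM : ∀ j, x j ∈ maximalIdeal R := fun j => hM ▸ Ideal.subset_span ⟨j, rfl⟩
  classical
  have h := ringKrullDim_le_ringKrullDim_quotient_add_card (R := R) (t.image x) (by
    rw [IsLocalRing.ringJacobson_eq_maximalIdeal, Finset.coe_image]
    rintro _ ⟨j, -, rfl⟩
    exact hxM j)
  rw [Finset.coe_image, ← hdim] at h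
  have h1 : (Fintype.card σ : WithBot ℕ∞) ≤
      ringKrullDim (R ⧸ Ideal.span (x '' (t : Set σ))) + (t.card : WithBot ℕ∞) :=
    h.trans (add_le_add_right (by exact_mod_cast Finset.card_image_le) _)
  rw [← Finset.card_compl_add_card t, Nat.cast_add] at h1
  have hne : ((t.card : ℕ) : WithBot ℕ∞) ≠ ⊥ := WithBot.natCast_ne_bot _
  generalize ringKrullDim (R ⧸ Ideal.span (x '' (t : Set σ))) = D at h1 ⊢
  induction D with
  | bot =>
    exfalso
    rw [WithBot.bot_add, le_bot_iff] at h1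
    exact absurd h1 (by exact_mod_cast WithBot.natCast_ne_bot _)
  | coe D =>
    have h2 : ((tᶜ.card : ℕ∞) + t.card : ℕ∞) ≤ D + t.card := by exact_mod_cast h1
    have h3 := (ENat.add_le_add_iff_right (ENat.natCast_ne_top t.card)).1 h2
    exact_mod_cast h3

/-- In a local ring whose maximal ideal is generated by `dim R` elements, every subset of these
generators generates a prime ideal. This is proved by adding one generator at a time, starting from
the full set: the quotient by a smaller set is a domain by `isPrime_bot_of_span_singleton`. -/
theorem isPrime_span_parameters (hM : Ideal.span (Set.range x) = maximalIdeal R)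
    (hdim : (Fintype.card σ : WithBot ℕ∞) = ringKrullDim R) :
    ∀ (k : ℕ) (t : Finset σ), tᶜ.card = k → (Ideal.span (x '' (t : Set σ))).IsPrime := by
  intro k
  induction k with
  | zero =>
    intro t ht
    have : t = Finset.univ := by
      rwa [Finset.card_eq_zero, Finset.compl_eq_empty_iff] at ht
    subst this
    rw [Finset.coe_univ, Set.image_univ, hM]
    infer_instance
  | succ k ih =>
    intro t ht
    obtain ⟨i, hi⟩ : tᶜ.Nonempty := Finset.card_pos.1 (by omega)
    have hk : (insert i t)ᶜ.card = k := by
      rw [Finset.compl_insert, Finset.card_erase_of_mem hi]; omega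
    have hprime := ih _ hk
    have hxM : ∀ j, x j ∈ maximalIdeal R := fun j => hM ▸ Ideal.subset_span ⟨j, rfl⟩
    set I := Ideal.span (x '' (t : Set σ)) with hI
    have hmap : (Ideal.span (x '' ↑(insert i t))).map (Ideal.Quotient.mk I) =
        Ideal.span {Ideal.Quotient.mk I (x i)} := by
      rw [span_image_insert, Ideal.map_sup, ← hI, Ideal.map_quotient_self, bot_sup_eq,
        Ideal.map_span, Set.image_singleton]
    have hIM : I ≤ maximalIdeal R := Ideal.span_le.2 (by rintro _ ⟨j, -, rfl⟩; exact hxM j)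
    have : Nontrivial (R ⧸ I) := Ideal.Quotient.nontrivial_iff.2 fun h =>
      (maximalIdeal.isMaximal R).ne_top (top_le_iff.1 (h ▸ hIM))
    have := IsLocalRing.of_surjective' (Ideal.Quotient.mk I) Ideal.Quotient.mk_surjective
    have hbot : (⊥ : Ideal (R ⧸ I)).IsPrime := by
      refine isPrime_bot_of_span_singleton (x := Ideal.Quotient.mk I (x i)) (c := k) ?_ ?_ ?_ ?_
      · exact mk_mem_maximalIdeal (hxM i)
      · rw [← hmap]
        refine Ideal.map_isPrime_of_surjective Ideal.Quotient.mk_surjective ?_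
        rw [Ideal.mk_ker, span_image_insert]
        exact le_sup_left
      · have := le_ringKrullDim_quotient_parameters hM hdim t
        rwa [ht] at this
      · refine le_trans ?_ (ringKrullDim_quotient_parameters_le hM k (insert i t) hk)
        refine ringKrullDim_le_of_surjective (Ideal.Quotient.lift _
          ((Ideal.Quotient.mk (Ideal.span {Ideal.Quotient.mk I (x i)})).comp (Ideal.Quotient.mk I))
            ?_) ?_
        · intro a ha
          rw [RingHom.comp_apply, Ideal.Quotient.eq_zero_iff_mem, ← hmap]
          exact Ideal.mem_map_of_mem _ ha
        · exact Ideal.Quotient.lift_surjective_of_surjective _ _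
            (Ideal.Quotient.mk_surjective.comp Ideal.Quotient.mk_surjective)
    rw [← Ideal.mk_ker (I := I), RingHom.ker_eq_comap_bot]
    exact hbot.comap _

/-- The generators form a regular sequence in any order: `x i` is a non-zero-divisor modulo the
ideal generated by any set of the other ones. -/
theorem mem_span_parameters_of_mul_mem (hM : Ideal.span (Set.range x) = maximalIdeal R)
    (hdim : (Fintype.card σ : WithBot ℕ∞) = ringKrullDim R) (t : Finset σ) (i : σ) (hi : i ∉ t)
    {a : R} (ha : x i * a ∈ Ideal.span (x '' (t : Set σ))) : a ∈ Ideal.span (x '' (t : Set σ)) := by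
  refine ((isPrime_span_parameters hM hdim _ t rfl).mem_or_mem ha).resolve_left fun h => ?_
  -- if `x i` were redundant, the dimension of the quotient would be too small
  have h1 := le_ringKrullDim_quotient_parameters hM hdim t
  have h2 := ringKrullDim_quotient_parameters_le hM _ (insert i t) rfl
  rw [span_image_insert, sup_eq_left.2 ((Ideal.span_singleton_le_iff_mem _).2 h)] at h2
  have h3 : tᶜ.card ≤ (insert i t)ᶜ.card := by exact_mod_cast h1.trans h2
  rw [Finset.compl_insert, Finset.card_erase_of_mem (Finset.mem_compl.2 hi)] at h3
  have : 0 < tᶜ.card := Finset.card_pos.2 ⟨i, Finset.mem_compl.2 hi⟩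
  omega

end PrimeParameters

/-! ### Analytic independence of the parameters -/

section AnalyticIndependence

open IsLocalRing MvPolynomial

/-- Krull's intersection theorem modulo an ideal. -/
theorem mem_of_forall_mem_sup_pow {R : Type*} [CommRing R] [IsNoetherianRing R] [IsLocalRing R]
    (N : Ideal R) {a : R} (h : ∀ t, a ∈ N ⊔ maximalIdeal R ^ t) : a ∈ N := by
  have h1 : (Ideal.Quotient.mk N a : R ⧸ N) ∈
      (⨅ t : ℕ, maximalIdeal R ^ t • (⊤ : Submodule R (R ⧸ N))) := by
    refine (Submodule.mem_iInf _).2 fun t => ?_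
    obtain ⟨n, hn, b, hb, rfl⟩ := Submodule.mem_sup.1 (h t)
    rw [map_add, Ideal.Quotient.eq_zero_iff_mem.2 hn, zero_add]
    have : (Ideal.Quotient.mk N b : R ⧸ N) = b • (1 : R ⧸ N) := by
      rw [Algebra.smul_def, mul_one]; rfl
    rw [this]
    exact Submodule.smul_mem_smul hb Submodule.mem_top
  rw [Ideal.iInf_pow_smul_eq_bot_of_isLocalRing _ (maximalIdeal.isMaximal R).ne_top,
    Submodule.mem_bot] at h1
  exact Ideal.Quotient.eq_zero_iff_mem.1 h1

variable {R : Type*} [CommRing R] [IsNoetherianRing R] [IsLocalRing R] {σ : Type*} [Fintype σ]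
  [DecidableEq σ] {x : σ → R}

theorem weight_one_eq_degree {σ : Type*} (d : σ →₀ ℕ) : Finsupp.weight (1 : σ → ℕ) d = d.degree :=
  (DFunLike.congr_fun Finsupp.degree_eq_weight_one d).symm

theorem eval_monomial_mem_pow {R : Type*} [CommRing R] {σ : Type*} {x : σ → R} (s : Set σ)
    (d : σ →₀ ℕ) (hd : ∀ i, d i ≠ 0 → i ∈ s) :
    eval x (monomial d 1) ∈ Ideal.span (x '' s) ^ d.degree := by
  rw [eval_monomial, one_mul, Finsupp.degree_apply, Finsupp.prod, ← Finset.prod_pow_eq_pow_sum]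
  refine Ideal.prod_mem_prod fun i hi => Ideal.pow_mem_pow ?_ _
  exact Ideal.subset_span ⟨i, hd i (Finsupp.mem_support_iff.1 hi), rfl⟩

theorem pow_succ_le_sup {R : Type*} [CommRing R] {M I X I' : Ideal R} (hM : M ≤ I ⊔ X ⊔ I')
    (hI : I ≤ M) (t : ℕ) : M ^ (t + 1) ≤ I ^ (t + 1) ⊔ X * M ^ t ⊔ I' := by
  induction t with
  | zero => simpa using hM
  | succ t ih =>
    have h1 : M ^ (t + 1 + 1) ≤ (I ⊔ X ⊔ I') * M ^ (t + 1) := by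
      rw [pow_succ' M (t + 1)]; exact Ideal.mul_mono_left hM
    have h2 : I * M ^ (t + 1) ≤ I ^ (t + 1 + 1) ⊔ X * M ^ (t + 1) ⊔ I' := by
      refine (Ideal.mul_mono_right ih).trans ?_
      rw [Ideal.mul_sup, Ideal.mul_sup, ← pow_succ', mul_left_comm]
      refine sup_le_sup (sup_le_sup le_rfl ?_) Ideal.mul_le_right
      rw [pow_succ' M t]
      exact Ideal.mul_mono_right (Ideal.mul_mono_left hI)
    refine h1.trans ?_
    rw [Ideal.sup_mul, Ideal.sup_mul]
    refine sup_le (sup_le h2 ?_) ?_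
    · exact le_sup_of_le_left le_sup_right
    · exact le_sup_of_le_right Ideal.mul_le_left

/-- Analytic independence restricted to the monomials in a set `s` of parameters, modulo the
remaining parameters. The step from `s` to `insert i s` amounts to `x i` being a non-zero-divisor
on the associated graded ring, see `mem_sup_pow_of_mul_mem`. -/
def AnalyticallyIndependentOn (x : σ → R) (s : Finset σ) : Prop :=
  ∀ (k : ℕ) (F : MvPolynomial σ R), F.IsHomogeneous k →
    eval x F ∈ Ideal.span (x '' ↑(sᶜ)) ⊔ maximalIdeal R ^ (k + 1) →
      ∀ d : σ →₀ ℕ, (∀ i, d i ≠ 0 → i ∈ s) → coeff d F ∈ maximalIdeal R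

/-- Multiplication by `x i` raises the order by exactly one modulo the parameters outside of `insert
i s`. Writing `x i * a` as an element of `⟨x j ∣ j ∉ insert i s⟩ + x i M ^ k` plus a form in the `x
j`, `j ∈ s`, analytic independence on `s` shows that this form has coefficients in `M`, so that its
degree can be raised. In the limit the form disappears, and `x i` can be cancelled. -/
theorem mem_sup_pow_of_mul_mem (hM : Ideal.span (Set.range x) = maximalIdeal R)
    (hdim : (Fintype.card σ : WithBot ℕ∞) = ringKrullDim R) {s : Finset σ} {i : σ} (hi : i ∉ s)
    (hs : AnalyticallyIndependentOn x s) (k : ℕ) {a : R}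
    (ha : x i * a ∈ Ideal.span (x '' ↑((insert i s)ᶜ)) ⊔ maximalIdeal R ^ (k + 1)) :
    a ∈ Ideal.span (x '' ↑((insert i s)ᶜ)) ⊔ maximalIdeal R ^ k := by
  have hxM : ∀ j, x j ∈ maximalIdeal R := fun j => hM ▸ Ideal.subset_span ⟨j, rfl⟩
  set I' := Ideal.span (x '' ↑((insert i s)ᶜ)) with hI'
  set I := Ideal.span (x '' (s : Set σ)) with hI
  have hIM : I ≤ maximalIdeal R := Ideal.span_le.2 (by rintro _ ⟨j, -, rfl⟩; exact hxM j)
  have hsc : Ideal.span (x '' ↑(sᶜ)) = I' ⊔ Ideal.span {x i} := by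
    rw [hI', ← span_image_insert, Finset.compl_insert, Finset.insert_erase (Finset.mem_compl.2 hi)]
  have hMle : maximalIdeal R ≤ I ⊔ Ideal.span {x i} ⊔ I' := by
    rw [sup_assoc, sup_comm (Ideal.span {x i}), ← hsc, hI, ← Ideal.span_union, ← Set.image_union,
      ← Finset.coe_union, Finset.union_compl, Finset.coe_univ, Set.image_univ, hM]
  set N := I' ⊔ Ideal.span {x i} * maximalIdeal R ^ k with hN
  have hNsc : N ≤ Ideal.span (x '' ↑(sᶜ)) :=
    hsc ▸ sup_le_sup_left Ideal.mul_le_left _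
  have key : ∀ t, x i * a ∈ N ⊔ I ^ (k + 1 + t) := by
    intro t
    induction t with
    | zero =>
      refine (sup_le ?_ ?_ : I' ⊔ maximalIdeal R ^ (k + 1) ≤ _) ha
      · exact le_sup_left.trans le_sup_left
      · refine (pow_succ_le_sup hMle hIM k).trans (sup_le (sup_le le_sup_right ?_) ?_)
        · exact le_sup_right.trans le_sup_left
        · exact le_sup_left.trans le_sup_left
    | succ t ih =>
      obtain ⟨n, hn, b, hb, hab⟩ := Submodule.mem_sup.1 ih
      have hbsc : b ∈ Ideal.span (x '' ↑(sᶜ)) := by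
        rw [← eq_sub_iff_add_eq'] at hab
        rw [hab]
        refine Ideal.sub_mem _ ?_ (hNsc hn)
        rw [hsc]
        exact Ideal.mem_sup_right (Ideal.mul_mem_right _ _ (Ideal.mem_span_singleton_self _))
      rw [hI, Set.image_eq_range] at hb
      obtain ⟨p, hp, rfl⟩ := (Ideal.mem_span_pow_iff_exists_isHomogeneous _ _).1 hb
      have hpe : eval (fun j : (s : Set σ) => x j) p = eval x (rename Subtype.val p) := by
        rw [eval_rename]; rfl
      -- the form `p` has a value in `⟨x j ∣ j ∉ s⟩`, so its coefficients are in `M`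
      have hcoeff : ∀ d, coeff d p ∈ maximalIdeal R := by
        intro d
        have := hs _ (rename Subtype.val p) hp.rename_isHomogeneous
          (Ideal.mem_sup_left (hpe ▸ hbsc)) (d.mapDomain Subtype.val) (by
            intro j hj
            have := Finsupp.mapDomain_support (Finsupp.mem_support_iff.2 hj)
            obtain ⟨j', -, rfl⟩ := Finset.mem_image.1 this
            exact j'.2)
        rwa [coeff_rename_mapDomain _ Subtype.val_injective] at this
      have hb2 : eval (fun j : (s : Set σ) => x j) p ∈ maximalIdeal R * I ^ (k + 1 + t) := by
        rw [p.as_sum, map_sum]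
        refine Ideal.sum_mem _ fun d hd => ?_
        rw [← mul_one (coeff d p), ← C_mul_monomial, map_mul, eval_C]
        refine Ideal.mul_mem_mul (hcoeff d) ?_
        have h1 : d.degree = k + 1 + t := by
          have := hp (mem_support_iff.1 hd)
          rwa [Finsupp.degree_eq_weight_one]
        have h2 := eval_monomial_mem_pow (x := fun j : (s : Set σ) => x j) Set.univ d
          (fun _ _ => Set.mem_univ _)
        rwa [Set.image_univ, h1, ← Set.image_eq_range] at h2
      rw [← hab]
      refine Ideal.add_mem _ (Ideal.mem_sup_left hn) ?_
      refine (?_ : maximalIdeal R * I ^ (k + 1 + t) ≤ _) hb2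
      refine (Ideal.mul_mono_left hMle).trans ?_
      rw [Ideal.sup_mul, Ideal.sup_mul]
      refine sup_le (sup_le ?_ ?_) ?_
      · rw [← pow_succ']; exact le_sup_right
      · refine le_sup_of_le_left (le_sup_of_le_right (Ideal.mul_mono_right ?_))
        exact (Ideal.pow_right_mono hIM _).trans (Ideal.pow_le_pow_right (by omega))
      · exact le_sup_of_le_left (le_sup_of_le_left Ideal.mul_le_left)
  have hmem : x i * a ∈ N := by
    refine mem_of_forall_mem_sup_pow N fun t => ?_
    refine (sup_le_sup_left ?_ N) (key t)
    exact (Ideal.pow_le_pow_right (by omega)).trans (Ideal.pow_right_mono hIM t)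
  obtain ⟨n, hn, b, hb, hab⟩ := Submodule.mem_sup.1 hmem
  obtain ⟨m, hm, rfl⟩ := Ideal.mem_span_singleton_mul.1 hb
  have : a - m ∈ I' := by
    refine mem_span_parameters_of_mul_mem hM hdim _ i (by simp) ?_
    rw [mul_sub, ← hab, add_sub_cancel_right]
    exact hn
  rw [← sub_add_cancel a m]
  exact Ideal.add_mem _ (Ideal.mem_sup_left this) (Ideal.mem_sup_right hm)

/-- Induction on `s` and on the degree: for `insert i s` write `F = X i * F₁ + F₂` where `F₂` does
not involve `X i`. The coefficients of `F` on `s` are treated by the independence on `s`, so that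
`F₂` can be neglected, and those of `F₁` by induction on the degree. -/
theorem analyticallyIndependentOn (hM : Ideal.span (Set.range x) = maximalIdeal R)
    (hdim : (Fintype.card σ : WithBot ℕ∞) = ringKrullDim R) (s : Finset σ) :
    AnalyticallyIndependentOn x s := by
  have hxM : ∀ j, x j ∈ maximalIdeal R := fun j => hM ▸ Ideal.subset_span ⟨j, rfl⟩
  have hzero : ∀ s : Finset σ, ∀ F : MvPolynomial σ R, F.IsHomogeneous 0 →
      eval x F ∈ Ideal.span (x '' ↑(sᶜ)) ⊔ maximalIdeal R ^ (0 + 1) →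
        ∀ d, coeff d F ∈ maximalIdeal R := by
    intro s F hF hmem d
    have hle : Ideal.span (x '' ↑(sᶜ)) ⊔ maximalIdeal R ^ (0 + 1) ≤ maximalIdeal R := by
      rw [zero_add, pow_one]
      exact sup_le (Ideal.span_le.2 (by rintro _ ⟨j, -, rfl⟩; exact hxM j)) le_rfl
    have hC : F = C (coeff 0 F) :=
      totalDegree_eq_zero_iff_eq_C.1 (Nat.le_zero.1 hF.totalDegree_le)
    rw [hC, eval_C] at hmem
    rw [hC, coeff_C]
    split_ifs
    · exact hle hmem
    · exact zero_mem _
  induction s using Finset.induction_on with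
  | empty =>
    intro k F hF hmem d hd
    obtain rfl : d = 0 := by
      ext i
      by_contra h
      exact absurd (hd i h) (Finset.notMem_empty i)
    by_cases hk : k = 0
    · subst hk; exact hzero ∅ F hF hmem 0
    · rw [hF.coeff_eq_zero (by simpa using Ne.symm hk)]
      exact zero_mem _
  | insert i s hi ih =>
    intro k
    induction k with
    | zero => intro F hF hmem d _; exact hzero _ F hF hmem d
    | succ k ihk =>
      intro F hF hmem
      set I' := Ideal.span (x '' ↑((insert i s)ᶜ)) with hI'
      have hs : ∀ d : σ →₀ ℕ, (∀ j, d j ≠ 0 → j ∈ s) → coeff d F ∈ maximalIdeal R := by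
        refine ih (k + 1) F hF ((?_ : I' ⊔ maximalIdeal R ^ (k + 1 + 1) ≤ _) hmem)
        refine sup_le_sup_right (Ideal.span_mono (Set.image_mono ?_)) _
        exact Finset.coe_subset.2 (Finset.compl_subset_compl.2 (Finset.subset_insert i s))
      set F₁ := F.divMonomial (Finsupp.single i 1) with hF₁
      set F₂ := F.modMonomial (Finsupp.single i 1) with hF₂
      have hsplit : X i * F₁ + F₂ = F := divMonomial_add_modMonomial_single F i
      have hF₁h : F₁.IsHomogeneous k := by
        intro d hd
        rw [hF₁, coeff_divMonomial] at hd
        have := hF hd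
        rw [weight_one_eq_degree] at this ⊢
        rw [map_add, Finsupp.degree_single] at this
        omega
      have hF₂e : eval x F₂ ∈ I' ⊔ maximalIdeal R ^ (k + 2) := by
        rw [F₂.as_sum, map_sum]
        refine Ideal.sum_mem _ fun d hd => ?_
        have hdc := mem_support_iff.1 hd
        have hnle : ¬ Finsupp.single i 1 ≤ d := fun h =>
          hdc (coeff_modMonomial_of_le _ h)
        have hdF : coeff d F₂ = coeff d F := coeff_modMonomial_of_not_le _ hnle
        rw [hdF] at hdc ⊢
        rw [← mul_one (coeff d F), ← C_mul_monomial, map_mul, eval_C]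
        have hdi : d i = 0 := by
          by_contra h
          exact hnle (Finsupp.single_le_iff.2 (Nat.one_le_iff_ne_zero.2 h))
        by_cases hds : ∀ j, d j ≠ 0 → j ∈ s
        · refine Ideal.mem_sup_right ?_
          rw [pow_succ']
          refine Ideal.mul_mem_mul (hs d hds) ?_
          have h1 : d.degree = k + 1 := by
            have := hF hdc
            rwa [Finsupp.degree_eq_weight_one]
          have h2 := eval_monomial_mem_pow (x := x) Set.univ d (fun _ _ => Set.mem_univ _)
          rwa [Set.image_univ, hM, h1] at h2
        · push Not at hds
          obtain ⟨j, hj0, hjs⟩ := hds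
          refine Ideal.mem_sup_left (Ideal.mul_mem_left _ _ ?_)
          rw [eval_monomial, one_mul, Finsupp.prod,
            ← Finset.mul_prod_erase _ _ (Finsupp.mem_support_iff.2 hj0)]
          refine Ideal.mul_mem_right _ _ (Ideal.pow_mem_of_mem _ ?_ _ (Nat.pos_of_ne_zero hj0))
          refine Ideal.subset_span ⟨j, ?_, rfl⟩
          have : j ≠ i := fun h => hj0 (h ▸ hdi)
          simp [this, hjs]
      have hF₁e : x i * eval x F₁ ∈ I' ⊔ maximalIdeal R ^ (k + 1 + 1) := by
        have : x i * eval x F₁ = eval x F - eval x F₂ := by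
          rw [← hsplit]; simp
        rw [this]
        exact Ideal.sub_mem _ hmem hF₂e
      have hc := ihk F₁ hF₁h (mem_sup_pow_of_mul_mem hM hdim hi ih (k + 1) hF₁e)
      intro d hd
      by_cases hdi : d i = 0
      · refine hs d fun j hj => ?_
        refine (Finset.mem_insert.1 (hd j hj)).resolve_left fun h => hj (h ▸ hdi)
      · have hle : Finsupp.single i 1 ≤ d :=
          Finsupp.single_le_iff.2 (Nat.one_le_iff_ne_zero.2 hdi)
        have := hc (d - Finsupp.single i 1) (fun j hj => hd j (fun h => hj (by simp [h])))
        rwa [hF₁, coeff_divMonomial, add_tsub_cancel_of_le hle] at this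

/-- The generators `x` of the maximal ideal are analytically independent: a homogeneous polynomial
of degree `k` with a value in `M ^ (k + 1)` has all its coefficients in `M`. -/
theorem coeff_mem_of_isHomogeneous (hM : Ideal.span (Set.range x) = maximalIdeal R)
    (hdim : (Fintype.card σ : WithBot ℕ∞) = ringKrullDim R) {k : ℕ} {F : MvPolynomial σ R}
    (hF : F.IsHomogeneous k) (he : eval x F ∈ maximalIdeal R ^ (k + 1)) (d : σ →₀ ℕ) :
    coeff d F ∈ maximalIdeal R :=
  analyticallyIndependentOn hM hdim Finset.univ k F hF (Ideal.mem_sup_right he) d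
    fun i _ => Finset.mem_univ i

end AnalyticIndependence

/-! ### Monomial ideals in a system of parameters and expansions -/

section MonomialIdeals

open IsLocalRing MvPolynomial

/-- The ideal generated by the monomials `x ^ d` with `d ∈ E`. -/
def monoIdeal {R : Type*} [CommRing R] {σ : Type*} (x : σ → R) (E : Set (σ →₀ ℕ)) : Ideal R :=
  Ideal.span ((fun d => eval x (monomial d 1)) '' E)

section Basic

variable {R : Type*} [CommRing R] {σ : Type*} {x : σ → R}

theorem monoIdeal_mono {E E' : Set (σ →₀ ℕ)} (h : E ⊆ E') : monoIdeal x E ≤ monoIdeal x E' :=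
  Ideal.span_mono (Set.image_mono h)

theorem monomial_mem_monoIdeal {E : Set (σ →₀ ℕ)} {d : σ →₀ ℕ} (hd : d ∈ E) :
    eval x (monomial d 1) ∈ monoIdeal x E :=
  Ideal.subset_span ⟨d, hd, rfl⟩

theorem eval_eq_sum_monomial (P : MvPolynomial σ R) :
    eval x P = ∑ d ∈ P.support, coeff d P * eval x (monomial d 1) := by
  conv_lhs => rw [P.as_sum, map_sum]
  refine Finset.sum_congr rfl fun d _ => ?_
  rw [← mul_one (coeff d P), ← C_mul_monomial, map_mul, eval_C]
  simp

theorem eval_mem_monoIdeal {E : Set (σ →₀ ℕ)} {P : MvPolynomial σ R}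
    (hP : ∀ d, coeff d P ≠ 0 → d ∈ E) : eval x P ∈ monoIdeal x E := by
  rw [eval_eq_sum_monomial]
  exact Ideal.sum_mem _ fun d hd =>
    Ideal.mul_mem_left _ _ (monomial_mem_monoIdeal (hP d (mem_support_iff.1 hd)))

theorem mem_monoIdeal_iff {E : Set (σ →₀ ℕ)} {g : R} :
    g ∈ monoIdeal x E ↔ ∃ P : MvPolynomial σ R, (∀ d, coeff d P ≠ 0 → d ∈ E) ∧ eval x P = g := by
  classical
  refine ⟨fun hg => ?_, fun ⟨P, hP, h⟩ => h ▸ eval_mem_monoIdeal hP⟩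
  refine Submodule.span_induction ?_ ?_ ?_ ?_ hg
  · rintro _ ⟨d, hd, rfl⟩
    refine ⟨monomial d 1, fun d' hd' => ?_, rfl⟩
    rw [coeff_monomial] at hd'
    split_ifs at hd' with h
    · exact h ▸ hd
    · exact absurd rfl hd'
  · exact ⟨0, by simp, by simp⟩
  · rintro a b - - ⟨P, hP, rfl⟩ ⟨Q, hQ, rfl⟩
    refine ⟨P + Q, fun d hd => ?_, by simp⟩
    by_contra h
    refine hd ?_
    rw [coeff_add, not_not.1 (mt (hP d) h), not_not.1 (mt (hQ d) h), add_zero]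
  · rintro c a - ⟨P, hP, rfl⟩
    refine ⟨C c * P, fun d hd => hP d fun h => hd ?_, by simp⟩
    rw [coeff_C_mul, h, mul_zero]

theorem mul_mem_monoIdeal {E E' F : Set (σ →₀ ℕ)} (h : ∀ d ∈ E, ∀ d' ∈ E', d + d' ∈ F) {a b : R}
    (ha : a ∈ monoIdeal x E) (hb : b ∈ monoIdeal x E') : a * b ∈ monoIdeal x F := by
  refine (?_ : monoIdeal x E * monoIdeal x E' ≤ _) (Ideal.mul_mem_mul ha hb)
  rw [monoIdeal, monoIdeal, Ideal.span_mul_span', Ideal.span_le]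
  rintro _ ⟨_, ⟨d, hd, rfl⟩, _, ⟨d', hd', rfl⟩, rfl⟩
  have : eval x (monomial d 1) * eval x (monomial d' 1) = eval x (monomial (d + d') 1) := by
    rw [← map_mul, monomial_mul, one_mul]
  simp only [SetLike.mem_coe, this]
  exact monomial_mem_monoIdeal (h d hd d' hd')

theorem span_range_pow_eq_monoIdeal (n : ℕ) :
    Ideal.span (Set.range x) ^ n = monoIdeal x {d | n ≤ d.degree} := by
  apply le_antisymm
  · intro a ha
    obtain ⟨p, hp, rfl⟩ := (Ideal.mem_span_pow_iff_exists_isHomogeneous _ _).1 ha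
    refine eval_mem_monoIdeal fun d hd => ?_
    have := hp hd
    rw [weight_one_eq_degree] at this
    exact this.ge
  · rw [monoIdeal, Ideal.span_le]
    rintro _ ⟨d, hd, rfl⟩
    have := eval_monomial_mem_pow (x := x) Set.univ d (fun _ _ => Set.mem_univ _)
    rw [Set.image_univ] at this
    exact Ideal.pow_le_pow_right hd this

end Basic

/-- `x` is a regular system of parameters, for an arbitrary finite index type. -/
structure IsParameterSystem {R : Type*} [CommRing R] [IsLocalRing R] {σ : Type*} [Fintype σ]
    (x : σ → R) : Prop where
  span_eq : Ideal.span (Set.range x) = maximalIdeal R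
  card_eq : (Fintype.card σ : WithBot ℕ∞) = ringKrullDim R

variable {R : Type*} [CommRing R] [IsNoetherianRing R] [IsLocalRing R] {σ : Type*} [Fintype σ]
  {x : σ → R}

/-- A relation between monomials has no unit coefficient at a minimal exponent `d₀`. As long as
there are monomials of degree less than `|d₀|`, those of the lowest degree have coefficients in `M`
by analytic independence; expanding these coefficients one pushes the monomials to higher degrees
without touching `d₀`. -/
theorem coeff_mem_of_eval_eq_zero (hx : IsParameterSystem x) (d₀ : σ →₀ ℕ) :
    ∀ (n : ℕ) (P : MvPolynomial σ R), eval x P = 0 →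
      (∀ d, coeff d P ≠ 0 → d₀.degree ≤ d.degree + n) →
      (∀ d, coeff d P ≠ 0 → d ≤ d₀ → d = d₀) → coeff d₀ P ∈ maximalIdeal R := by
  classical
  have low : ∀ (k : ℕ) (P : MvPolynomial σ R), eval x P = 0 →
      (∀ d, coeff d P ≠ 0 → k ≤ d.degree) → ∀ d, d.degree = k → coeff d P ∈ maximalIdeal R := by
    intro k P hP hk d hd
    have h1 : eval x (homogeneousComponent k P) ∈ maximalIdeal R ^ (k + 1) := by
      have : eval x (homogeneousComponent k P) = - eval x (P - homogeneousComponent k P) := by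
        rw [map_sub, hP]; ring
      rw [this, neg_mem_iff, ← hx.span_eq, span_range_pow_eq_monoIdeal]
      refine eval_mem_monoIdeal fun d' hd' => ?_
      rw [coeff_sub, coeff_homogeneousComponent] at hd'
      split_ifs at hd' with h
      · exact absurd (sub_self _) hd'
      · rw [sub_zero] at hd'
        exact Nat.lt_of_le_of_ne (hk d' hd') (Ne.symm h)
    have h2 := coeff_mem_of_isHomogeneous hx.span_eq hx.card_eq
      (homogeneousComponent_isHomogeneous k P) h1 d
    rwa [coeff_homogeneousComponent, if_pos hd] at h2
  have hlin : ∀ c ∈ maximalIdeal R, ∃ p : MvPolynomial σ R, p.IsHomogeneous 1 ∧ eval x p = c := by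
    intro c hc
    rw [← hx.span_eq, ← pow_one (Ideal.span _)] at hc
    exact (Ideal.mem_span_pow_iff_exists_isHomogeneous _ _).1 hc
  choose! ℓ hℓ1 hℓ2 using hlin
  intro n
  induction n with
  | zero =>
    intro P hP hdeg _
    exact low _ P hP hdeg d₀ rfl
  | succ n ih =>
    intro P hP hdeg hmin
    by_cases hn : d₀.degree < n + 1
    · exact ih P hP (fun d _ => by omega) hmin
    obtain ⟨k, hk⟩ : ∃ k, d₀.degree = k + (n + 1) := ⟨d₀.degree - (n + 1), by omega⟩
    have hcM := low k P hP (fun d hd => by have := hdeg d hd; omega)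
    set H := homogeneousComponent k P with hH
    set S := ∑ d ∈ H.support, ℓ (coeff d H) * monomial d 1 with hS
    have hHc : ∀ d, coeff d H ≠ 0 → d.degree = k ∧ coeff d H = coeff d P := by
      intro d hd
      rw [hH, coeff_homogeneousComponent] at hd ⊢
      split_ifs at hd ⊢ with h
      · exact ⟨h, rfl⟩
      · exact absurd rfl hd
    have hSe : eval x S = eval x H := by
      rw [eval_eq_sum_monomial H, hS, map_sum]
      refine Finset.sum_congr rfl fun d hd => ?_
      have h := hHc d (mem_support_iff.1 hd)
      rw [map_mul, hℓ2]
      rw [h.2]; exact hcM d h.1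
    have hSc : ∀ d, coeff d S ≠ 0 → ∃ d', coeff d' P ≠ 0 ∧ d' ≤ d ∧ d'.degree = k ∧
        d.degree = k + 1 := by
      intro d hd
      rw [hS, coeff_sum] at hd
      obtain ⟨d', hd', hne⟩ := Finset.exists_ne_zero_of_sum_ne_zero hd
      have h := hHc d' (mem_support_iff.1 hd')
      rw [coeff_mul_monomial'] at hne
      split_ifs at hne with hle
      · refine ⟨d', h.2 ▸ mem_support_iff.1 hd', hle, h.1, ?_⟩
        have h1 := hℓ1 (coeff d' H) (h.2 ▸ hcM d' h.1) (left_ne_zero_of_mul hne)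
        rw [weight_one_eq_degree] at h1
        have h2 : (d - d').degree + d'.degree = d.degree := by
          rw [← map_add, tsub_add_cancel_of_le hle]
        omega
      · exact absurd rfl hne
    have hcoeff : ∀ d, coeff d (P - H + S) ≠ 0 →
        (coeff d P ≠ 0 ∧ k + 1 ≤ d.degree) ∨ coeff d S ≠ 0 := by
      intro d hd
      by_cases h : coeff d S = 0
      · left
        rw [coeff_add, h, add_zero, coeff_sub, hH, coeff_homogeneousComponent] at hd
        split_ifs at hd with h'
        · exact absurd (sub_self _) hd
        · rw [sub_zero] at hd
          have := hdeg d hd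
          exact ⟨hd, by omega⟩
      · exact Or.inr h
    have hS0 : coeff d₀ S = 0 := by
      by_contra h
      obtain ⟨d', h1, h2, h3, -⟩ := hSc d₀ h
      have := hmin d' h1 h2
      subst this
      omega
    have hH0 : coeff d₀ H = 0 := by
      rw [hH, coeff_homogeneousComponent, if_neg (by omega)]
    have := ih (P - H + S) (by rw [map_add, map_sub, hSe, hP]; ring) (fun d hd => by
        rcases hcoeff d hd with h | h
        · omega
        · obtain ⟨d', -, -, -, h4⟩ := hSc d h; omega) (fun d hd hle => by
        rcases hcoeff d hd with h | h
        · exact hmin d h.1 hle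
        · obtain ⟨d', h1, h2, h3, h4⟩ := hSc d h
          have := hmin d' h1 (h2.trans hle)
          subst this
          omega)
    rwa [coeff_add, coeff_sub, hS0, hH0, sub_zero, add_zero] at this

/-- If a monomial ideal contains a sum of monomials, then a minimal exponent which does not belong
to the ideal occurs with a coefficient in `M`. -/
theorem coeff_mem_of_eval_mem_monoIdeal (hx : IsParameterSystem x) {E : Set (σ →₀ ℕ)}
    (hE : IsUpperSet E) {P : MvPolynomial σ R} (hP : eval x P ∈ monoIdeal x E) {d₀ : σ →₀ ℕ}
    (hd₀ : d₀ ∉ E) (hmin : ∀ d, coeff d P ≠ 0 → d ≤ d₀ → d = d₀) :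
    coeff d₀ P ∈ maximalIdeal R := by
  obtain ⟨Q, hQ, hQe⟩ := mem_monoIdeal_iff.1 hP
  have h0 : coeff d₀ Q = 0 := not_not.1 (mt (hQ d₀) hd₀)
  have := coeff_mem_of_eval_eq_zero hx d₀ d₀.degree (P - Q) (by rw [map_sub, hQe, sub_self])
    (fun d _ => by omega) (fun d hd hle => by
      by_cases h : coeff d P = 0
      · rw [coeff_sub, h, zero_sub, neg_ne_zero] at hd
        exact absurd (hE hle (hQ d hd)) hd₀
      · exact hmin d h hle)
  rwa [coeff_sub, h0, sub_zero] at this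

/-- Intersections of monomial ideals are monomial ideals. Modulo `M ^ t`, the form of degree `t`
which remains after subtraction of an element of the right hand side has coefficients in `M` at the
monomials outside of some `E ∈ S`, whence its order is at least `t + 1`. -/
theorem mem_monoIdeal_sInter (hx : IsParameterSystem x) {S : Set (Set (σ →₀ ℕ))}
    (hS : ∀ E ∈ S, IsUpperSet E) {g : R} (hg : ∀ E ∈ S, g ∈ monoIdeal x E) :
    g ∈ monoIdeal x (⋂₀ S) := by
  refine mem_of_forall_mem_sup_pow _ fun t => ?_
  induction t with
  | zero => simp
  | succ t ih =>
    obtain ⟨a, ha, b, hb, hab⟩ := Submodule.mem_sup.1 ih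
    have hbS : ∀ E ∈ S, b ∈ monoIdeal x E := by
      intro E hE
      rw [eq_sub_of_add_eq' hab]
      exact Ideal.sub_mem _ (hg E hE) (monoIdeal_mono (Set.sInter_subset_of_mem hE) ha)
    rw [← hx.span_eq] at hb
    obtain ⟨p, hp, rfl⟩ := (Ideal.mem_span_pow_iff_exists_isHomogeneous _ _).1 hb
    have hdeg : ∀ d, coeff d p ≠ 0 → d.degree = t := fun d hd => by
      rw [← weight_one_eq_degree]; exact hp hd
    rw [← hab, eval_eq_sum_monomial p]
    refine Ideal.add_mem _ (Ideal.mem_sup_left ha) (Ideal.sum_mem _ fun d hd => ?_)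
    have hd0 := mem_support_iff.1 hd
    by_cases hdS : d ∈ ⋂₀ S
    · exact Ideal.mem_sup_left (Ideal.mul_mem_left _ _ (monomial_mem_monoIdeal hdS))
    · rw [Set.mem_sInter] at hdS
      push Not at hdS
      obtain ⟨E, hE, hdE⟩ := hdS
      refine Ideal.mem_sup_right ?_
      rw [pow_succ']
      refine Ideal.mul_mem_mul (coeff_mem_of_eval_mem_monoIdeal hx (hS E hE) (hbS E hE) hdE ?_) ?_
      · intro d' hd' hle
        refine le_antisymm hle ?_
        have h1 := hdeg d' hd'
        have h2 := hdeg d hd0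
        have h3 : (d - d').degree + d'.degree = d.degree := by
          rw [← map_add, tsub_add_cancel_of_le hle]
        have h4 : d - d' = 0 := (Finsupp.degree_eq_zero_iff _).1 (by omega)
        exact tsub_eq_zero_iff_le.1 h4
      · rw [← hx.span_eq, span_range_pow_eq_monoIdeal]
        exact monomial_mem_monoIdeal (hdeg d hd0).ge

/-- Expansions exist: the exponents are the minimal elements of the smallest upper set `E` such
that `g` lies in the monomial ideal of `E`. -/
theorem exists_expansion (hx : IsParameterSystem x) (g : R) :
    ∃ P : MvPolynomial σ R, (∀ d, coeff d P ≠ 0 → IsUnit (coeff d P)) ∧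
      IsAntichain (· ≤ ·) (P.support : Set (σ →₀ ℕ)) ∧ eval x P = g := by
  classical
  set S : Set (Set (σ →₀ ℕ)) := {E | IsUpperSet E ∧ g ∈ monoIdeal x E} with hS
  set E := ⋂₀ S with hE
  have hEu : IsUpperSet E := isUpperSet_sInter fun F hF => hF.1
  have hgE : g ∈ monoIdeal x E := mem_monoIdeal_sInter hx (fun F hF => hF.1) fun F hF => hF.2
  set D := {d | Minimal (· ∈ E) d} with hD
  have hgD : g ∈ monoIdeal x D := by
    refine (?_ : monoIdeal x E ≤ monoIdeal x D) hgE
    rw [monoIdeal, Ideal.span_le]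
    rintro _ ⟨d, hd, rfl⟩
    obtain ⟨d', hle, hd'⟩ := exists_minimal_le_of_wellFoundedLT (· ∈ E) d hd
    have : eval x (monomial d 1) = eval x (monomial (d - d') 1) * eval x (monomial d' (1 : R)) := by
      rw [← map_mul, monomial_mul, one_mul, tsub_add_cancel_of_le hle]
    simp only [SetLike.mem_coe, this]
    exact Ideal.mul_mem_left _ _ (monomial_mem_monoIdeal hd')
  obtain ⟨P, hP, hPg⟩ := mem_monoIdeal_iff.1 hgD
  refine ⟨P, fun d hd => ?_, ?_, hPg⟩
  -- a minimal exponent `d` with a coefficient in `M` could be removed from `E`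
  · by_contra hu
    have hdmin : Minimal (· ∈ E) d := hP d hd
    have hcM : coeff d P ∈ Ideal.span (Set.range x) := hx.span_eq ▸ hu
    have hup : IsUpperSet (E \ {d}) := by
      rintro a b hab ⟨haE, had⟩
      refine ⟨hEu hab haE, fun hbd => had ?_⟩
      rw [Set.mem_singleton_iff] at hbd ⊢
      exact le_antisymm (hbd ▸ hab) (hdmin.2 haE (hbd ▸ hab))
    have hmem : g ∈ monoIdeal x (E \ {d}) := by
      rw [← hPg, eval_eq_sum_monomial]
      refine Ideal.sum_mem _ fun d' hd' => ?_
      by_cases h : d' = d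
      · subst h
        rw [← pow_one (Ideal.span _), span_range_pow_eq_monoIdeal] at hcM
        refine mul_mem_monoIdeal (E' := {d'}) ?_ hcM (monomial_mem_monoIdeal rfl)
        rintro a ha _ rfl
        refine ⟨hEu le_add_self hdmin.1, fun h => ?_⟩
        rw [Set.mem_singleton_iff, add_eq_right] at h
        subst h
        simp at ha
      · exact Ideal.mul_mem_left _ _
          (monomial_mem_monoIdeal ⟨(hP d' (mem_support_iff.1 hd')).1, h⟩)
    exact (Set.sInter_subset_of_mem (show E \ {d} ∈ S from ⟨hup, hmem⟩) hdmin.1).2 rfl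
  · intro d hd d' hd' hne hle
    have h1 : Minimal (· ∈ E) d := hP d (mem_support_iff.1 hd)
    have h2 : Minimal (· ∈ E) d' := hP d' (mem_support_iff.1 hd')
    exact hne (le_antisymm hle (h2.2 h1.1 hle))

variable {R : Type*} [CommRing R] [IsLocalRing R] {e r : ℕ} {u : Fin e → R} {y : Fin r → R}

theorem isParameterSystem_of_isRSP (h : IsRSP u y) : IsParameterSystem (Sum.elim u y) where
  span_eq := by rw [Set.Sum.elim_range]; exact h.1
  card_eq := by
    rw [← h.2]
    simp

variable [IsNoetherianRing R]

theorem isExpansion_expansion (h : IsRSP u y) (g : R) : IsExpansion u y g (expansion u y g) := by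
  have hex : ∃ P, IsExpansion u y g P := by
    obtain ⟨P, h1, h2, h3⟩ := exists_expansion (isParameterSystem_of_isRSP h) g
    exact ⟨P, h1, h2, h3⟩
  rw [expansion, dif_pos hex]
  exact hex.choose_spec

/-- Membership in a monomial ideal can be read off from the exponents of the expansion. -/
theorem mem_monoIdeal_iff_expansion (h : IsRSP u y) {E : Set ((Fin e ⊕ Fin r) →₀ ℕ)}
    (hE : IsUpperSet E) {g : R} : g ∈ monoIdeal (Sum.elim u y) E ↔
      ∀ d, (expansion u y g).coeff d ≠ 0 → d ∈ E := by
  have hg := isExpansion_expansion h g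
  constructor
  · intro hgE d hd
    by_contra hdE
    rw [← hg.eval_eq] at hgE
    have := coeff_mem_of_eval_mem_monoIdeal (isParameterSystem_of_isRSP h) hE hgE hdE
      (fun d' hd' hle => hg.antichain.eq (mem_support_iff.2 hd') (mem_support_iff.2 hd) hle)
    exact (IsLocalRing.mem_maximalIdeal _).1 this (hg.isUnit_coeff d hd)
  · intro hd
    have := eval_mem_monoIdeal (x := Sum.elim u y) hd
    rwa [hg.eval_eq] at this

end MonomialIdeals

/-! ### Weighted filtrations and initial forms -/

section WeightedInitialForms

open IsLocalRing MvPolynomial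

section Weights

variable {σ : Type*} [Fintype σ] {ω : σ → ℕ}

theorem degree_le_weight (hω : ∀ i, 0 < ω i) (d : σ →₀ ℕ) : d.degree ≤ Finsupp.weight ω d := by
  rw [Finsupp.weight_eq_sum, Finsupp.degree_eq_sum]
  exact Finset.sum_le_sum fun i _ => by
    rw [smul_eq_mul]; exact Nat.le_mul_of_pos_right _ (hω i)

theorem weight_le_mul_degree (ω : σ → ℕ) (d : σ →₀ ℕ) :
    Finsupp.weight ω d ≤ (∑ i, ω i) * d.degree := by
  rw [Finsupp.weight_eq_sum, Finsupp.degree_eq_sum, Finset.mul_sum]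
  refine Finset.sum_le_sum fun i _ => ?_
  rw [smul_eq_mul, mul_comm]
  exact Nat.mul_le_mul_right _
    (Finset.single_le_sum (fun j _ => Nat.zero_le (ω j)) (Finset.mem_univ i))

theorem weight_mono {σ : Type*} (ω : σ → ℕ) : Monotone (Finsupp.weight ω : (σ →₀ ℕ) → ℕ) := by
  intro d d' h
  rw [← tsub_add_cancel_of_le h, map_add]
  exact Nat.le_add_left _ _

theorem eq_of_le_of_weight_eq (hω : ∀ i, 0 < ω i) {d d' : σ →₀ ℕ} (h : d ≤ d')
    (hw : Finsupp.weight ω d = Finsupp.weight ω d') : d = d' := by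
  have h1 := degree_le_weight hω (d' - d)
  have h2 : Finsupp.weight ω (d' - d) + Finsupp.weight ω d = Finsupp.weight ω d' := by
    rw [← map_add, tsub_add_cancel_of_le h]
  exact le_antisymm h (tsub_eq_zero_iff_le.1 ((Finsupp.degree_eq_zero_iff _).1 (by omega)))

end Weights

/-- The `n`-th step of the filtration of `R` in which `x i` has weight `ω i`. -/
def wIdeal {R : Type*} [CommRing R] {σ : Type*} (x : σ → R) (ω : σ → ℕ) (n : ℕ) : Ideal R :=
  monoIdeal x {d | n ≤ Finsupp.weight ω d}

/-- `Q` is the component of weight `n` of the initial form of an element `g` of the `n`-th step of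
the weighted filtration. It is zero if `g` lies in the next step. -/
def IsInit {R : Type*} [CommRing R] [IsLocalRing R] {σ : Type*} (x : σ → R) (ω : σ → ℕ) (n : ℕ)
    (g : R) (Q : MvPolynomial σ (ResidueField R)) : Prop :=
  ∃ P : MvPolynomial σ R, P.IsWeightedHomogeneous ω n ∧ g - eval x P ∈ wIdeal x ω (n + 1) ∧
    map (residue R) P = Q

section Filtration

variable {R : Type*} [CommRing R] {σ : Type*} {x : σ → R} {ω : σ → ℕ}

theorem wIdeal_antitone {n m : ℕ} (h : n ≤ m) : wIdeal x ω m ≤ wIdeal x ω n :=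
  monoIdeal_mono fun _ hd => h.trans hd

theorem mul_mem_wIdeal {n m : ℕ} {a b : R} (ha : a ∈ wIdeal x ω n) (hb : b ∈ wIdeal x ω m) :
    a * b ∈ wIdeal x ω (n + m) :=
  mul_mem_monoIdeal (fun d hd d' hd' => by
    rw [Set.mem_ofPred_eq, map_add]; exact add_le_add hd hd') ha hb

theorem eval_mem_wIdeal {n : ℕ} {P : MvPolynomial σ R} (hP : P.IsWeightedHomogeneous ω n) :
    eval x P ∈ wIdeal x ω n :=
  eval_mem_monoIdeal fun _ hd => (hP hd).ge

theorem isUpperSet_weight_ge [Fintype σ] (n : ℕ) :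
    IsUpperSet {d : σ →₀ ℕ | n ≤ Finsupp.weight ω d} :=
  fun _ _ h hd => le_trans hd (weight_mono ω h)

theorem wIdeal_le_pow [Fintype σ] {n k : ℕ} (h : (∑ i, ω i + 1) * k ≤ n) :
    wIdeal x ω n ≤ Ideal.span (Set.range x) ^ k := by
  rw [span_range_pow_eq_monoIdeal]
  refine monoIdeal_mono fun d hd => ?_
  have h1 : n ≤ (∑ i, ω i) * d.degree := le_trans hd (weight_le_mul_degree ω d)
  by_contra hlt
  rw [Set.mem_ofPred_eq, not_le] at hlt
  have h2 : (∑ i, ω i) * d.degree ≤ (∑ i, ω i) * k := Nat.mul_le_mul_left _ hlt.le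
  have h3 : (∑ i, ω i + 1) * k = (∑ i, ω i) * k + k := by ring
  omega

theorem pow_le_wIdeal [Fintype σ] (hω : ∀ i, 0 < ω i) (k : ℕ) :
    Ideal.span (Set.range x) ^ k ≤ wIdeal x ω k := by
  rw [span_range_pow_eq_monoIdeal]
  exact monoIdeal_mono fun d hd => le_trans hd (degree_le_weight hω d)

end Filtration

section Init

variable {R : Type*} [CommRing R] [IsLocalRing R] {σ : Type*} {x : σ → R} {ω : σ → ℕ} {n m : ℕ}
  {g g' : R} {Q Q' : MvPolynomial σ (ResidueField R)}

theorem IsInit.mem (h : IsInit x ω n g Q) : g ∈ wIdeal x ω n := by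
  obtain ⟨P, hP, hg, -⟩ := h
  rw [← sub_add_cancel g (eval x P)]
  exact Ideal.add_mem _ (wIdeal_antitone (Nat.le_succ n) hg) (eval_mem_wIdeal hP)

theorem IsInit.isWeightedHomogeneous (h : IsInit x ω n g Q) : Q.IsWeightedHomogeneous ω n := by
  obtain ⟨P, hP, -, rfl⟩ := h
  intro d hd
  refine hP fun h => hd ?_
  rw [coeff_map, h, map_zero]

theorem isInit_zero (hg : g ∈ wIdeal x ω (n + 1)) : IsInit x ω n g 0 :=
  ⟨0, isWeightedHomogeneous_zero _ _ _, by simpa using hg, by simp⟩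

theorem exists_isInit (hg : g ∈ wIdeal x ω n) : ∃ Q, IsInit x ω n g Q := by
  obtain ⟨P, hP, rfl⟩ := mem_monoIdeal_iff.1 hg
  refine ⟨_, weightedHomogeneousComponent ω n P,
    weightedHomogeneousComponent_isWeightedHomogeneous n P, ?_, rfl⟩
  rw [← map_sub]
  refine eval_mem_monoIdeal fun d hd => ?_
  rw [coeff_sub, coeff_weightedHomogeneousComponent] at hd
  split_ifs at hd with h
  · exact absurd (sub_self _) hd
  · rw [sub_zero] at hd
    exact Nat.lt_of_le_of_ne (hP d hd) (Ne.symm h)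

theorem IsInit.add (h : IsInit x ω n g Q) (h' : IsInit x ω n g' Q') :
    IsInit x ω n (g + g') (Q + Q') := by
  obtain ⟨P, hP, hg, rfl⟩ := h
  obtain ⟨P', hP', hg', rfl⟩ := h'
  refine ⟨P + P', hP.add hP', ?_, by simp⟩
  have : g + g' - eval x (P + P') = (g - eval x P) + (g' - eval x P') := by rw [map_add]; ring
  rw [this]
  exact Ideal.add_mem _ hg hg'

theorem IsInit.neg (h : IsInit x ω n g Q) : IsInit x ω n (-g) (-Q) := by
  obtain ⟨P, hP, hg, rfl⟩ := h
  refine ⟨-P, (weightedHomogeneousSubmodule R ω n).neg_mem hP, ?_, by simp⟩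
  have : -g - eval x (-P) = -(g - eval x P) := by rw [map_neg]; ring
  rw [this]
  exact neg_mem hg

theorem IsInit.sub (h : IsInit x ω n g Q) (h' : IsInit x ω n g' Q') :
    IsInit x ω n (g - g') (Q - Q') := by
  rw [sub_eq_add_neg, sub_eq_add_neg]
  exact h.add h'.neg

theorem IsInit.sum {ι : Type*} (s : Finset ι) {g : ι → R}
    {Q : ι → MvPolynomial σ (ResidueField R)} (h : ∀ i ∈ s, IsInit x ω n (g i) (Q i)) :
    IsInit x ω n (∑ i ∈ s, g i) (∑ i ∈ s, Q i) := by
  classical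
  induction s using Finset.induction_on with
  | empty => exact isInit_zero (zero_mem _)
  | insert i s hi ih =>
    rw [Finset.sum_insert hi, Finset.sum_insert hi]
    exact (h i (Finset.mem_insert_self i s)).add (ih fun j hj => h j (Finset.mem_insert_of_mem hj))

theorem IsInit.mul (h : IsInit x ω n g Q) (h' : IsInit x ω m g' Q') :
    IsInit x ω (n + m) (g * g') (Q * Q') := by
  have hg'm := h'.mem
  obtain ⟨P, hP, hg, rfl⟩ := h
  obtain ⟨P', hP', hg', rfl⟩ := h'
  refine ⟨P * P', hP.mul hP', ?_, by simp⟩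
  have : g * g' - eval x (P * P') = (g - eval x P) * g' + eval x P * (g' - eval x P') := by
    rw [map_mul]; ring
  rw [this]
  refine Ideal.add_mem _ ?_ ?_
  · have := mul_mem_wIdeal hg hg'm
    rwa [add_right_comm] at this
  · have := mul_mem_wIdeal (eval_mem_wIdeal (x := x) hP) hg'
    rwa [← add_assoc] at this

/-- Homogeneous polynomials over the residue field lift to initial forms. The lift is a polynomial
with unit coefficients. -/
theorem exists_lift (x : σ → R) (hQ : Q.IsWeightedHomogeneous ω n) : ∃ P : MvPolynomial σ R,
    (∀ d, coeff d P ≠ 0 → IsUnit (coeff d P) ∧ coeff d Q ≠ 0) ∧ IsInit x ω n (eval x P) Q := by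
  classical
  choose s hs using residue_surjective (R := R)
  have hc : ∀ d, coeff d (∑ d ∈ Q.support, monomial d (s (coeff d Q))) =
      if coeff d Q = 0 then 0 else s (coeff d Q) := by
    intro d
    simp only [coeff_sum, coeff_monomial, Finset.sum_ite_eq', mem_support_iff, ite_not]
  have hc' : ∀ d, coeff d (∑ d ∈ Q.support, monomial d (s (coeff d Q))) ≠ 0 → coeff d Q ≠ 0 := by
    intro d hd h
    rw [hc, if_pos h] at hd
    exact hd rfl
  refine ⟨∑ d ∈ Q.support, monomial d (s (coeff d Q)), fun d hd => ?_, _,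
    fun d hd => hQ (hc' d hd), ?_, ?_⟩
  · have h := hc' d hd
    refine ⟨?_, h⟩
    rw [hc, if_neg h]
    by_contra hu
    refine h ?_
    rw [← hs (coeff d Q), residue_eq_zero_iff]
    exact hu
  · rw [sub_self]
    exact zero_mem _
  · ext d
    rw [coeff_map, hc]
    split_ifs with h
    · rw [map_zero, h]
    · rw [hs]

variable [Fintype σ]

/-- A coefficient in `M` is a combination of the parameters and raises the weight. -/
theorem IsInit.mem_succ (hx : IsParameterSystem x) (hω : ∀ i, 0 < ω i) (h : IsInit x ω n g 0) :
    g ∈ wIdeal x ω (n + 1) := by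
  obtain ⟨P, hP, hg, hP0⟩ := h
  rw [← sub_add_cancel g (eval x P)]
  refine Ideal.add_mem _ hg ?_
  rw [eval_eq_sum_monomial]
  refine Ideal.sum_mem _ fun d hd => ?_
  rw [add_comm]
  refine mul_mem_wIdeal ?_ (monomial_mem_monoIdeal (hP (mem_support_iff.1 hd)).ge)
  refine pow_le_wIdeal hω 1 ?_
  rw [pow_one, hx.span_eq, ← residue_eq_zero_iff, ← coeff_map, hP0, coeff_zero]

variable [IsNoetherianRing R]

theorem IsInit.unique (hx : IsParameterSystem x) (hω : ∀ i, 0 < ω i) (h : IsInit x ω n g Q)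
    (h' : IsInit x ω n g Q') : Q = Q' := by
  obtain ⟨P, hP, hg, rfl⟩ := h
  obtain ⟨P', hP', hg', rfl⟩ := h'
  have hh : (P - P').IsWeightedHomogeneous ω n :=
    (weightedHomogeneousSubmodule R ω n).sub_mem hP hP'
  have he : eval x (P - P') ∈ wIdeal x ω (n + 1) := by
    have : eval x (P - P') = (g - eval x P') - (g - eval x P) := by rw [map_sub]; ring
    rw [this]
    exact Ideal.sub_mem _ hg' hg
  ext d
  rw [coeff_map, coeff_map, ← sub_eq_zero, ← map_sub, residue_eq_zero_iff, ← coeff_sub]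
  by_cases hd : coeff d (P - P') = 0
  · rw [hd]; exact zero_mem _
  refine coeff_mem_of_eval_mem_monoIdeal hx (isUpperSet_weight_ge _) he ?_ fun d' hd' hle =>
    eq_of_le_of_weight_eq hω hle ((hh hd').trans (hh hd).symm)
  rw [Set.mem_ofPred_eq, hh hd]
  omega

end Init

section Expansion

variable {R : Type*} [CommRing R] [IsLocalRing R] [IsNoetherianRing R] {e r : ℕ} {u : Fin e → R}
  {y : Fin r → R} {ω : Fin e ⊕ Fin r → ℕ} {n : ℕ} {g : R}

/-- The initial form is the part of minimal weight of the expansion. -/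
theorem isInit_iff_coeff (h : IsRSP u y) (hω : ∀ i, 0 < ω i)
    {Q : MvPolynomial (Fin e ⊕ Fin r) (ResidueField R)} :
    IsInit (Sum.elim u y) ω n g Q ↔
      (∀ d, (expansion u y g).coeff d ≠ 0 → n ≤ Finsupp.weight ω d) ∧
      ∀ d, coeff d Q =
        if Finsupp.weight ω d = n then residue R ((expansion u y g).coeff d) else 0 := by
  have hx := isParameterSystem_of_isRSP h
  have key : (∀ d, (expansion u y g).coeff d ≠ 0 → n ≤ Finsupp.weight ω d) →
      IsInit (Sum.elim u y) ω n g
        (map (residue R) (weightedHomogeneousComponent ω n (expansion u y g))) := by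
    intro hge
    refine ⟨_, weightedHomogeneousComponent_isWeightedHomogeneous n _, ?_, rfl⟩
    have hE : g - eval (Sum.elim u y) (weightedHomogeneousComponent ω n (expansion u y g)) =
        eval (Sum.elim u y)
          (expansion u y g - weightedHomogeneousComponent ω n (expansion u y g)) := by
      rw [map_sub, (isExpansion_expansion h g).eval_eq]
    rw [hE]
    refine eval_mem_monoIdeal fun d hd => ?_
    rw [coeff_sub, coeff_weightedHomogeneousComponent] at hd
    split_ifs at hd with h
    · exact absurd (sub_self _) hd
    · rw [sub_zero] at hd
      exact Nat.lt_of_le_of_ne (hge d hd) (Ne.symm h)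
  have hcoeff : ∀ d,
      coeff d (map (residue R) (weightedHomogeneousComponent ω n (expansion u y g))) =
      if Finsupp.weight ω d = n then residue R ((expansion u y g).coeff d) else 0 := by
    intro d
    rw [coeff_map, coeff_weightedHomogeneousComponent]
    split_ifs
    · rfl
    · exact map_zero _
  constructor
  · intro hQ
    have hge := (mem_monoIdeal_iff_expansion h (isUpperSet_weight_ge n)).1 hQ.mem
    refine ⟨hge, fun d => ?_⟩
    rw [hQ.unique hx hω (key hge), hcoeff]
  · rintro ⟨hge, hQ⟩
    have : Q = _ := MvPolynomial.ext _ _ fun d => (hQ d).trans (hcoeff d).symm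
    rw [this]
    exact key hge

theorem residue_coeff_expansion_ne_zero (h : IsRSP u y) {d : (Fin e ⊕ Fin r) →₀ ℕ}
    (hd : (expansion u y g).coeff d ≠ 0) : residue R ((expansion u y g).coeff d) ≠ 0 :=
  (residue_ne_zero_iff_isUnit _).2 ((isExpansion_expansion h g).isUnit_coeff d hd)

end Expansion

end WeightedInitialForms

/-! ### Exponents of homogeneous ideals and reduction -/

section Reduction

open IsLocalRing MvPolynomial

section Exponents

variable {e r : ℕ}

theorem uPart_apply (d : (Fin e ⊕ Fin r) →₀ ℕ) (i : Fin e) : uPart d i = d (Sum.inl i) := rfl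

/-- The exponent `(A, B)`. -/
def pairExp (A : Fin e →₀ ℕ) (B : Fin r →₀ ℕ) : (Fin e ⊕ Fin r) →₀ ℕ :=
  Finsupp.sumFinsuppEquivProdFinsupp.symm (A, B)

@[simp] theorem uPart_pairExp (A : Fin e →₀ ℕ) (B : Fin r →₀ ℕ) : uPart (pairExp A B) = A := by
  simp [uPart, pairExp]

@[simp] theorem yPart_pairExp (A : Fin e →₀ ℕ) (B : Fin r →₀ ℕ) : yPart (pairExp A B) = B := by
  simp [yPart, pairExp]

@[simp] theorem pairExp_parts (d : (Fin e ⊕ Fin r) →₀ ℕ) : pairExp (uPart d) (yPart d) = d := by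
  simp [uPart, yPart, pairExp]

theorem pairExp_inj {A A' : Fin e →₀ ℕ} {B B' : Fin r →₀ ℕ} :
    pairExp A B = pairExp A' B' ↔ A = A' ∧ B = B' := by
  rw [pairExp, pairExp, Equiv.apply_eq_iff_eq, Prod.mk.injEq]

theorem pairExp_add (A A' : Fin e →₀ ℕ) (B B' : Fin r →₀ ℕ) :
    pairExp A B + pairExp A' B' = pairExp (A + A') (B + B') := by
  ext i
  rcases i with i | j <;> simp [pairExp]

theorem mapDomain_inr (B : Fin r →₀ ℕ) :
    B.mapDomain (Sum.inr : Fin r → Fin e ⊕ Fin r) = pairExp 0 B := by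
  ext i
  rcases i with i | j
  · rw [Finsupp.mapDomain_of_notMem_range _ _ (by simp)]
    rfl
  · rw [Finsupp.mapDomain_apply Sum.inr_injective]
    rfl

variable {K : Type*} [CommSemiring K]

/-- The coefficient of `U ^ A`, a polynomial in `Y`. -/
def uCoeff (A : Fin e →₀ ℕ) (Q : MvPolynomial (Fin e ⊕ Fin r) K) : MvPolynomial (Fin r) K :=
  coeff A (sumAlgEquiv K (Fin e) (Fin r) Q)

theorem uCoeff_mul_rename (A : Fin e →₀ ℕ) (Q : MvPolynomial (Fin e ⊕ Fin r) K)
    (G : MvPolynomial (Fin r) K) : uCoeff A (Q * rename Sum.inr G) = uCoeff A Q * G := by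
  have : sumAlgEquiv K (Fin e) (Fin r) (rename Sum.inr G) = C G :=
    DFunLike.congr_fun (sumAlgEquiv_comp_rename_inr (R := K) (S₁ := Fin e) (S₂ := Fin r)) G
  rw [uCoeff, map_mul, this, mul_comm, coeff_C_mul, mul_comm, uCoeff]

theorem monomial_pairExp (A : Fin e →₀ ℕ) (B : Fin r →₀ ℕ) (c : K) :
    (monomial (pairExp A B) c : MvPolynomial (Fin e ⊕ Fin r) K) =
      rename Sum.inl (monomial A 1) * rename Sum.inr (monomial B c) := by
  rw [rename_monomial, rename_monomial, monomial_mul, one_mul, mapDomain_inr]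
  refine congrArg (fun d => monomial d c) (Finsupp.ext fun i => ?_)
  rcases i with i | j
  · rw [Finsupp.add_apply, Finsupp.mapDomain_apply Sum.inl_injective]
    simp [pairExp]
  · rw [Finsupp.add_apply, Finsupp.mapDomain_of_notMem_range _ _ (by simp)]
    simp [pairExp]

theorem coeff_uCoeff (A : Fin e →₀ ℕ) (B : Fin r →₀ ℕ) (Q : MvPolynomial (Fin e ⊕ Fin r) K) :
    coeff B (uCoeff A Q) = coeff (pairExp A B) Q := by
  classical
  induction Q using MvPolynomial.induction_on' with
  | add p q hp hq => rw [uCoeff, map_add, coeff_add, coeff_add, coeff_add, ← hp, ← hq]; rfl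
  | monomial d c =>
    have h1 : sumAlgEquiv K (Fin e) (Fin r) (rename Sum.inl (monomial (uPart d) 1)) =
        monomial (uPart d) 1 := by
      have := DFunLike.congr_fun (sumAlgEquiv_comp_rename_inl (R := K) (S₁ := Fin e) (S₂ := Fin r))
        (monomial (uPart d) 1)
      refine this.trans ?_
      rw [mapAlgHom_apply]
      simp
    have h2 : uCoeff A (monomial d c) =
        coeff A (monomial (uPart d) (1 : MvPolynomial (Fin r) K)) * monomial (yPart d) c := by
      conv_lhs => rw [← pairExp_parts d, monomial_pairExp, uCoeff_mul_rename, uCoeff, h1]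
    have h3 : d = pairExp A B ↔ uPart d = A ∧ yPart d = B := by
      conv_lhs => rw [← pairExp_parts d]
      exact pairExp_inj
    rw [h2, coeff_monomial, coeff_monomial]
    by_cases h : uPart d = A
    · by_cases h' : yPart d = B
      · rw [if_pos h, if_pos (h3.2 ⟨h, h'⟩), one_mul, h', coeff_monomial, if_pos rfl]
      · rw [if_pos h, if_neg (fun hh => h' (h3.1 hh).2), one_mul, coeff_monomial, if_neg h']
    · rw [if_neg h, if_neg (fun hh => h (h3.1 hh).1), zero_mul, coeff_zero]

theorem uCoeff_sum {ι : Type*} (s : Finset ι) (A : Fin e →₀ ℕ)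
    (Q : ι → MvPolynomial (Fin e ⊕ Fin r) K) :
    uCoeff A (∑ i ∈ s, Q i) = ∑ i ∈ s, uCoeff A (Q i) := by
  rw [uCoeff, map_sum, coeff_sum]; rfl

end Exponents

variable {e r m : ℕ} {K : Type*} [Field K]

/-- The ideal of `K[U, Y]` generated by the polynomials `G j ∈ K[Y]` with `j ∈ s`. -/
def yIdeal (e : ℕ) (G : Fin m → MvPolynomial (Fin r) K) (s : Set (Fin m)) :
    Ideal (MvPolynomial (Fin e ⊕ Fin r) K) :=
  Ideal.span ((fun j => rename Sum.inr (G j)) '' s)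

variable {G : Fin m → MvPolynomial (Fin r) K} {s : Set (Fin m)} {n : Fin m → ℕ}

theorem mem_span_image_iff {A : Type*} [CommRing A] {v : Fin m → A} {a : A} :
    a ∈ Ideal.span (v '' s) ↔ ∃ c : Fin m → A, (∀ j ∉ s, c j = 0) ∧ ∑ j, c j * v j = a := by
  classical
  constructor
  · intro h
    refine Submodule.span_induction ?_ ?_ ?_ ?_ h
    · rintro _ ⟨j, hj, rfl⟩
      refine ⟨Pi.single j 1, fun i hi => Pi.single_eq_of_ne (by rintro rfl; exact hi hj) _, ?_⟩
      simp [Pi.single_apply]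
    · exact ⟨0, by simp, by simp⟩
    · rintro _ _ - - ⟨c, hc, rfl⟩ ⟨c', hc', rfl⟩
      refine ⟨c + c', fun j hj => by simp [hc j hj, hc' j hj], ?_⟩
      simp [add_mul, Finset.sum_add_distrib]
    · rintro b _ - ⟨c, hc, rfl⟩
      refine ⟨fun j => b * c j, fun j hj => by simp [hc j hj], ?_⟩
      simp [Finset.mul_sum, mul_assoc]
  · rintro ⟨c, hc, rfl⟩
    refine Ideal.sum_mem _ fun j _ => ?_
    by_cases hj : j ∈ s
    · exact Ideal.mul_mem_left _ _ (Ideal.subset_span ⟨j, hj, rfl⟩)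
    · simp [hc j hj]

theorem uCoeff_mem_of_mem_yIdeal {Q : MvPolynomial (Fin e ⊕ Fin r) K} (hQ : Q ∈ yIdeal e G s)
    (A : Fin e →₀ ℕ) : uCoeff A Q ∈ Ideal.span (G '' s) := by
  obtain ⟨c, hc, rfl⟩ := mem_span_image_iff.1 hQ
  rw [uCoeff_sum]
  refine mem_span_image_iff.2 ⟨fun j => uCoeff A (c j), fun j hj => ?_, ?_⟩
  · simp [hc j hj, uCoeff]
  · exact Finset.sum_congr rfl fun j _ => (uCoeff_mul_rename A (c j) (G j)).symm

theorem rename_mem_yIdeal_of_mem {p : MvPolynomial (Fin r) K} (hp : p ∈ Ideal.span (G '' s)) :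
    rename Sum.inr p ∈ yIdeal e G s := by
  obtain ⟨c, hc, rfl⟩ := mem_span_image_iff.1 hp
  rw [map_sum]
  refine mem_span_image_iff.2 ⟨fun j => rename Sum.inr (c j), fun j hj => ?_, ?_⟩
  · simp [hc j hj]
  · simp

theorem coeff_rename_pairExp (p : MvPolynomial (Fin r) K) (B : Fin r →₀ ℕ) :
    coeff (pairExp 0 B : (Fin e ⊕ Fin r) →₀ ℕ) (rename Sum.inr p) = coeff B p := by
  rw [← mapDomain_inr, coeff_rename_mapDomain _ Sum.inr_injective]

theorem coeff_rename_ne_zero {p : MvPolynomial (Fin r) K} {d : (Fin e ⊕ Fin r) →₀ ℕ}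
    (hd : coeff d (rename Sum.inr p) ≠ 0) : uPart d = 0 ∧ coeff (yPart d) p ≠ 0 := by
  obtain ⟨B, rfl, hB⟩ := MvPolynomial.coeff_rename_ne_zero _ _ _ hd
  rw [mapDomain_inr, uPart_pairExp, yPart_pairExp]
  exact ⟨rfl, hB⟩

/-- A non-zero element of `⟨G_j ∣ j ∈ s⟩` in `K[Y]` involves a monomial whose exponent is an
exponent of the ideal, namely its least one. -/
theorem exists_mem_exponents {p : MvPolynomial (Fin r) K} (hp : p ∈ Ideal.span (G '' s))
    (h0 : p ≠ 0) : ∃ B, coeff B p ≠ 0 ∧ B ∈ exponents (yIdeal e G s) := by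
  obtain ⟨B, hB, hmin⟩ := Finset.exists_min_image p.support toDegLex (support_nonempty.2 h0)
  refine ⟨B, mem_support_iff.1 hB, rename Sum.inr p, rename_mem_yIdeal_of_mem hp, ⟨?_, ?_⟩⟩
  · exact ⟨pairExp 0 B, by rw [coeff_rename_pairExp]; exact mem_support_iff.1 hB, by simp, by simp⟩
  · rintro _ ⟨d, hd, -, rfl⟩
    exact hmin _ (mem_support_iff.2 (CharPoly.coeff_rename_ne_zero hd).2)

/-- The components of a multiple of a homogeneous polynomial are multiples of it. -/
theorem homogeneousComponent_mul_of_isHomogeneous {k : ℕ} {q g : MvPolynomial (Fin r) K}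
    (hg : g.IsHomogeneous k) (D : ℕ) : homogeneousComponent D (q * g) =
      (if k ≤ D then homogeneousComponent (D - k) q else 0) * g := by
  classical
  ext d
  have hk : ∀ b, coeff b g ≠ 0 → b.degree = k := fun b hb => by
    rw [← weight_one_eq_degree]; exact hg hb
  have hd : ∀ x ∈ Finset.HasAntidiagonal.antidiagonal d,
      d.degree = x.1.degree + x.2.degree := fun x hx => by
    rw [← Finset.HasAntidiagonal.mem_antidiagonal.1 hx, map_add]
  rw [coeff_homogeneousComponent, coeff_mul, coeff_mul]
  split_ifs with h1 h2 h2
  · refine Finset.sum_congr rfl fun x hx => ?_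
    by_cases h : coeff x.2 g = 0
    · rw [h, mul_zero, mul_zero]
    · rw [coeff_homogeneousComponent, if_pos]
      have := hd x hx; have := hk _ h; omega
  · refine Finset.sum_congr rfl fun x hx => ?_
    by_cases h : coeff x.2 g = 0
    · rw [h, mul_zero, mul_zero]
    · have := hd x hx; have := hk _ h; omega
  · refine (Finset.sum_eq_zero fun x hx => ?_).symm
    by_cases h : coeff x.2 g = 0
    · rw [h, mul_zero]
    · rw [coeff_homogeneousComponent, if_neg, zero_mul]
      have := hd x hx; have := hk _ h; omega
  · simp

/-- An exponent of the ideal is the least exponent of a homogeneous element of `K[Y]`. -/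
theorem exists_of_mem_exponents (hG : ∀ j, (G j).IsHomogeneous (n j)) {B : Fin r →₀ ℕ}
    (hB : B ∈ exponents (yIdeal e G s)) : ∃ c : Fin m → MvPolynomial (Fin r) K,
      (∀ j ∉ s, c j = 0) ∧ (∀ j d, coeff d (c j) ≠ 0 → d.degree + n j = B.degree) ∧
      coeff B (∑ j, c j * G j) = 1 ∧ ∀ B', coeff B' (∑ j, c j * G j) ≠ 0 →
        B'.degree = B.degree ∧ toDegLex B ≤ toDegLex B' := by
  classical
  obtain ⟨P, hP, ⟨⟨d, hd, hd0, hdB⟩, hmin⟩⟩ := hB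
  have hdB : yPart d = B := hdB
  obtain ⟨q, hq, hqP⟩ := mem_span_image_iff.1 (uCoeff_mem_of_mem_yIdeal hP 0)
  have hd' : pairExp 0 B = d := by rw [← hdB, ← hd0, pairExp_parts]
  have hBP : coeff B (uCoeff 0 P) ≠ 0 := by rwa [coeff_uCoeff, hd']
  set a := coeff B (uCoeff 0 P) with ha
  set q' : Fin m → MvPolynomial (Fin r) K := fun j =>
    if n j ≤ B.degree then homogeneousComponent (B.degree - n j) (q j) else 0 with hq'
  have hsum : ∑ j, (C a⁻¹ * q' j) * G j = C a⁻¹ * homogeneousComponent B.degree (uCoeff 0 P) := by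
    rw [← hqP, map_sum, Finset.mul_sum]
    refine Finset.sum_congr rfl fun j _ => ?_
    rw [homogeneousComponent_mul_of_isHomogeneous (hG j), mul_assoc]
  refine ⟨fun j => C a⁻¹ * q' j, fun j hj => ?_, fun j d' hd' => ?_, ?_, fun B' hB' => ?_⟩
  · simp [hq', hq j hj]
  · rw [coeff_C_mul, hq'] at hd'
    have := right_ne_zero_of_mul hd'
    dsimp only at this
    split_ifs at this with h
    · rw [coeff_homogeneousComponent] at this
      split_ifs at this with h'
      · omega
      · exact absurd rfl this
    · exact absurd (coeff_zero _) this
  · rw [hsum, coeff_C_mul, coeff_homogeneousComponent, if_pos rfl]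
    exact inv_mul_cancel₀ hBP
  · rw [hsum, coeff_C_mul, coeff_homogeneousComponent] at hB'
    have := right_ne_zero_of_mul hB'
    split_ifs at this with h
    · refine ⟨h, hmin ⟨pairExp 0 B', ?_, by simp, by simp⟩⟩
      rwa [← coeff_uCoeff]
    · exact absurd rfl this

/-- Reduction of a monomial of `K[Y]`. Since the exponent of an element is its least one, this
increases the monomials within their degree and terminates. -/
theorem exists_reduction_monomial (hG : ∀ j, (G j).IsHomogeneous (n j)) :
    ∀ (k : ℕ) (B : Fin r →₀ ℕ),
      {B' : Fin r →₀ ℕ | B'.degree = B.degree ∧ toDegLex B < toDegLex B'}.ncard ≤ k →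
      ∃ c : Fin m → MvPolynomial (Fin r) K,
      (∀ j ∉ s, c j = 0) ∧ (∀ j d, coeff d (c j) ≠ 0 → d.degree + n j = B.degree) ∧
      ∀ B', coeff B' (monomial B 1 - ∑ j, c j * G j) ≠ 0 →
        B' ∉ exponents (yIdeal e G s) := by
  classical
  intro k
  induction k using Nat.strong_induction_on with
  | _ k ih =>
  intro B hk
  by_cases hB : B ∈ exponents (yIdeal e G s)
  swap
  · refine ⟨0, by simp, by simp, fun B' hB' => ?_⟩
    simp only [Pi.zero_apply, zero_mul, Finset.sum_const_zero, sub_zero, coeff_monomial] at hB'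
    split_ifs at hB' with h
    · exact h ▸ hB
    · exact absurd rfl hB'
  obtain ⟨c, hcs, hcd, hcB, hcm⟩ := exists_of_mem_exponents hG hB
  set p := monomial B 1 - ∑ j, c j * G j with hp
  have hfin : ∀ B : Fin r →₀ ℕ,
      {B' : Fin r →₀ ℕ | B'.degree = B.degree ∧ toDegLex B < toDegLex B'}.Finite := fun B =>
    (Finsupp.finite_of_degree_le B.degree).subset fun B' hB' => hB'.1.le
  have hpB : ∀ B', coeff B' p ≠ 0 → B'.degree = B.degree ∧ toDegLex B < toDegLex B' := by
    intro B' hB'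
    rw [hp, coeff_sub, coeff_monomial] at hB'
    by_cases h : B = B'
    · rw [if_pos h, ← h, hcB, sub_self] at hB'
      exact absurd rfl hB'
    · rw [if_neg h, zero_sub, neg_ne_zero] at hB'
      have := hcm B' hB'
      exact ⟨this.1, lt_of_le_of_ne this.2 fun hh => h (toDegLex_injective hh)⟩
  have hred : ∀ B', coeff B' p ≠ 0 → ∃ c : Fin m → MvPolynomial (Fin r) K,
      (∀ j ∉ s, c j = 0) ∧ (∀ j d, coeff d (c j) ≠ 0 → d.degree + n j = B'.degree) ∧
      ∀ B'', coeff B'' (monomial B' 1 - ∑ j, c j * G j) ≠ 0 →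
        B'' ∉ exponents (yIdeal e G s) := by
    intro B' hB'
    obtain ⟨h1, h2⟩ := hpB B' hB'
    refine ih _ ?_ B' le_rfl
    refine lt_of_lt_of_le (Set.ncard_lt_ncard ?_ (hfin B)) hk
    refine ⟨fun B'' h => ⟨h.1.trans h1, h2.trans h.2⟩, fun h => ?_⟩
    exact lt_irrefl _ (h ⟨h1, h2⟩).2
  choose! c' hc's hc'd hc'm using hred
  refine ⟨fun j => c j + ∑ B' ∈ p.support, C (coeff B' p) * c' B' j, fun j hj => ?_,
    fun j d hd => ?_, fun B'' hB'' => ?_⟩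
  · dsimp only
    rw [hcs j hj, zero_add]
    exact Finset.sum_eq_zero fun B' hB' => by rw [hc's B' (mem_support_iff.1 hB') j hj, mul_zero]
  · by_cases h : coeff d (c j) = 0
    · rw [coeff_add, h, zero_add, coeff_sum] at hd
      obtain ⟨B', hB', hne⟩ := Finset.exists_ne_zero_of_sum_ne_zero hd
      rw [coeff_C_mul] at hne
      rw [hc'd B' (mem_support_iff.1 hB') j d (right_ne_zero_of_mul hne)]
      exact (hpB B' (mem_support_iff.1 hB')).1
    · exact hcd j d h
  · have : monomial B 1 - ∑ j, (c j + ∑ B' ∈ p.support, C (coeff B' p) * c' B' j) * G j =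
        ∑ B' ∈ p.support, C (coeff B' p) * (monomial B' 1 - ∑ j, c' B' j * G j) := by
      have h1 : ∑ B' ∈ p.support, C (coeff B' p) * monomial B' 1 = p := by
        conv_rhs => rw [p.as_sum]
        exact Finset.sum_congr rfl fun B' _ => by rw [C_mul_monomial, mul_one]
      simp only [mul_sub, add_mul, Finset.sum_sub_distrib, Finset.sum_add_distrib, h1,
        Finset.sum_mul, Finset.mul_sum]
      rw [hp, Finset.sum_comm, sub_sub]
      simp only [mul_assoc]
    rw [this, coeff_sum] at hB''
    obtain ⟨B', hB', hne⟩ := Finset.exists_ne_zero_of_sum_ne_zero hB''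
    rw [coeff_C_mul] at hne
    exact hc'm B' (mem_support_iff.1 hB') B'' (right_ne_zero_of_mul hne)

variable {ω : Fin e ⊕ Fin r → ℕ} {N w : ℕ}

theorem weight_pairExp (hN : ∀ j, ω (Sum.inr j) = N) (A : Fin e →₀ ℕ) (B : Fin r →₀ ℕ) :
    Finsupp.weight ω (pairExp A B) = Finsupp.weight ω (pairExp A 0) + N * B.degree := by
  have h : (pairExp A B) = pairExp A 0 + pairExp 0 B := by
    rw [pairExp_add, add_zero, zero_add]
  rw [h, map_add, Finsupp.weight_eq_sum ω (pairExp 0 B), Finsupp.degree_eq_sum, Finset.mul_sum,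
    Fintype.sum_sum_type]
  simp [pairExp, hN, mul_comm]

/-- Reduction modulo the homogeneous ideal `⟨G_j ∣ j ∈ s⟩`: a weighted homogeneous polynomial is
congruent to one without monomials `U^A Y^B`, `B` an exponent of the ideal. -/
theorem exists_reduction (hG : ∀ j, (G j).IsHomogeneous (n j)) (hN : ∀ j, ω (Sum.inr j) = N)
    {Q : MvPolynomial (Fin e ⊕ Fin r) K} (hQ : Q.IsWeightedHomogeneous ω w) (s : Set (Fin m)) :
    ∃ c : Fin m → MvPolynomial (Fin e ⊕ Fin r) K,
      (∀ j ∉ s, c j = 0) ∧ (∀ j d, coeff d (c j) ≠ 0 → Finsupp.weight ω d + N * n j = w) ∧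
      ∀ d, coeff d (Q - ∑ j, c j * rename Sum.inr (G j)) ≠ 0 →
        yPart d ∉ exponents (yIdeal e G s) := by
  classical
  have hred : ∀ B : Fin r →₀ ℕ, ∃ c : Fin m → MvPolynomial (Fin r) K,
      (∀ j ∉ s, c j = 0) ∧ (∀ j d, coeff d (c j) ≠ 0 → d.degree + n j = B.degree) ∧
      ∀ B', coeff B' (monomial B 1 - ∑ j, c j * G j) ≠ 0 →
        B' ∉ exponents (yIdeal e G s) := fun B => exists_reduction_monomial hG _ B le_rfl
  choose c hcs hcd hcm using hred
  have hren : ∀ (A : Fin e →₀ ℕ) (a : K) (p : MvPolynomial (Fin r) K) (d : (Fin e ⊕ Fin r) →₀ ℕ),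
      coeff d (monomial (pairExp A 0) a * rename Sum.inr p) ≠ 0 →
        uPart d = A ∧ coeff (yPart d) p ≠ 0 := by
    intro A a p d hd
    rw [← pairExp_parts d, ← coeff_uCoeff, uCoeff_mul_rename] at hd
    have h1 : uCoeff (r := r) (uPart d) (monomial (pairExp A 0) a) =
        if A = uPart d then C a else 0 := by
      ext B
      simp only [coeff_uCoeff, coeff_monomial, pairExp_inj]
      by_cases h : A = uPart d
      · simp [h, coeff_C]
      · simp [h]
    rw [h1] at hd
    split_ifs at hd with h
    · rw [coeff_C_mul] at hd
      exact ⟨h.symm, right_ne_zero_of_mul hd⟩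
    · simp at hd
  refine ⟨fun j => ∑ d ∈ Q.support, monomial (pairExp (uPart d) 0) (coeff d Q) *
    rename Sum.inr (c (yPart d) j), fun j hj => ?_, fun j d hd => ?_, fun d hd => ?_⟩
  · exact Finset.sum_eq_zero fun d _ => by rw [hcs _ j hj, map_zero, mul_zero]
  · rw [coeff_sum] at hd
    obtain ⟨d', hd', hne⟩ := Finset.exists_ne_zero_of_sum_ne_zero hd
    obtain ⟨h1, h2⟩ := hren _ _ _ _ hne
    rw [← hQ (mem_support_iff.1 hd'), ← pairExp_parts d, ← pairExp_parts d', weight_pairExp hN,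
      weight_pairExp hN (uPart d'), h1, ← hcd _ j _ h2]
    ring
  · have : Q - ∑ j, (∑ d ∈ Q.support, monomial (pairExp (uPart d) 0) (coeff d Q) *
        rename Sum.inr (c (yPart d) j)) * rename Sum.inr (G j) =
        ∑ d ∈ Q.support, monomial (pairExp (uPart d) 0) (coeff d Q) *
          rename Sum.inr (monomial (yPart d) 1 - ∑ j, c (yPart d) j * G j) := by
      have h1 : ∑ d ∈ Q.support, monomial (pairExp (uPart d) 0) (coeff d Q) *
          rename Sum.inr (monomial (yPart d) 1) = Q := by
        conv_rhs => rw [Q.as_sum]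
        refine Finset.sum_congr rfl fun d _ => ?_
        rw [rename_monomial, monomial_mul, mul_one, mapDomain_inr, pairExp_add]
        rw [add_zero, zero_add, pairExp_parts]
      simp only [map_sub, map_sum, map_mul, mul_sub, Finset.sum_sub_distrib, h1, Finset.sum_mul,
        Finset.mul_sum]
      rw [Finset.sum_comm]
      simp only [mul_assoc]
    rw [this, coeff_sum] at hd
    obtain ⟨d', hd', hne⟩ := Finset.exists_ne_zero_of_sum_ne_zero hd
    exact hcm _ _ (hren _ _ _ _ hne).2

/-- Exponents of low degree only depend on the generators of lower degree. -/
theorem mem_exponents_of_degree_lt (hG : ∀ j, (G j).IsHomogeneous (n j))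
    (hn : Monotone n) {i : Fin m} {B : Fin r →₀ ℕ} (hB : B ∈ exponents (yIdeal e G Set.univ))
    (hlt : B.degree < n i) : B ∈ exponents (yIdeal e G {j | j < i}) := by
  obtain ⟨c, -, hcd, hcB, hcm⟩ := exists_of_mem_exponents hG hB
  refine ⟨rename Sum.inr (∑ j, c j * G j), rename_mem_yIdeal_of_mem
    (mem_span_image_iff.2 ⟨c, fun j hj => ?_, rfl⟩), ⟨⟨pairExp 0 B, ?_, by simp, by simp⟩, ?_⟩⟩
  · by_contra h
    obtain ⟨d, hd⟩ := exists_coeff_ne_zero h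
    have h1 := hcd j d hd
    have h2 := hn (not_lt.1 hj)
    omega
  · rw [coeff_rename_pairExp, hcB]
    exact one_ne_zero
  · rintro _ ⟨d, hd, -, rfl⟩
    exact (hcm _ (CharPoly.coeff_rename_ne_zero hd).2).2

end Reduction

/-! ### Division by a system with initial forms in `K[Y]` -/

section Division

open IsLocalRing MvPolynomial

variable {e r m : ℕ}

/-- Positive integral weights of `(U, Y)` which give the same weight `N` to all the `Y_j`. -/
structure IsWeighting (ω : Fin e ⊕ Fin r → ℕ) (N : ℕ) : Prop where
  pos : ∀ i, 0 < ω i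
  eq : ∀ j, ω (Sum.inr j) = N
  pos_eq : 0 < N

variable {R : Type*} [CommRing R] [IsLocalRing R]

/-- The initial forms of `f` for the weights `ω` are the homogeneous polynomials `G j ∈ K[Y]` of
degree `n j`. -/
structure HasInitialForms (x : Fin e ⊕ Fin r → R) (ω : Fin e ⊕ Fin r → ℕ) (N : ℕ) (f : Fin m → R)
    (n : Fin m → ℕ) (G : Fin m → MvPolynomial (Fin r) (ResidueField R)) : Prop where
  isHomogeneous : ∀ j, (G j).IsHomogeneous (n j)
  isInit : ∀ j, IsInit x ω (N * n j) (f j) (rename Sum.inr (G j))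

variable {x : Fin e ⊕ Fin r → R} {ω : Fin e ⊕ Fin r → ℕ} {N : ℕ} {f : Fin m → R} {n : Fin m → ℕ}
  {G : Fin m → MvPolynomial (Fin r) (ResidueField R)}

theorem HasInitialForms.exists_isInit_mul (h : HasInitialForms x ω N f n G) {w : ℕ} {c : R}
    (j : Fin m) (hc : c ∈ wIdeal x ω (w - N * n j)) :
    ∃ C, IsInit x ω w (c * f j) (C * rename Sum.inr (G j)) := by
  by_cases hw : N * n j ≤ w
  · obtain ⟨C, hC⟩ := exists_isInit hc
    refine ⟨C, ?_⟩
    have := hC.mul (h.isInit j)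
    rwa [tsub_add_cancel_of_le hw] at this
  · refine ⟨0, ?_⟩
    rw [zero_mul]
    exact isInit_zero (wIdeal_antitone (by omega) (Ideal.mul_mem_left _ c (h.isInit j).mem))

/-- The initial form of a combination of the `f j`, `j ∈ s`, with coefficients of the expected
weights belongs to the ideal of the initial forms. -/
theorem HasInitialForms.exists_isInit_sum (h : HasInitialForms x ω N f n G) {w : ℕ}
    {c : Fin m → R} {s : Set (Fin m)} (hs : ∀ j ∉ s, c j = 0)
    (hc : ∀ j, c j ∈ wIdeal x ω (w - N * n j)) :
    ∃ Q ∈ yIdeal e G s, IsInit x ω w (∑ j, c j * f j) Q := by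
  have : ∀ j, ∃ C, (j ∉ s → C = 0) ∧ IsInit x ω w (c j * f j) (C * rename Sum.inr (G j)) := by
    intro j
    by_cases hj : j ∈ s
    · obtain ⟨C, hC⟩ := h.exists_isInit_mul j (hc j)
      exact ⟨C, fun h => absurd hj h, hC⟩
    · refine ⟨0, fun _ => rfl, ?_⟩
      rw [hs j hj, zero_mul, zero_mul]
      exact isInit_zero (zero_mem _)
  choose C hC0 hC using this
  exact ⟨_, mem_span_image_iff.2 ⟨C, hC0, rfl⟩, IsInit.sum Finset.univ fun j _ => hC j⟩

/-- A step of the division: the initial form of `g` is reduced modulo the `G j`, `j ∈ s`, and the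
quotients and the remainder are lifted to `R`. -/
theorem HasInitialForms.exists_division_step (h : HasInitialForms x ω N f n G)
    (hx : IsParameterSystem x) (hω : IsWeighting ω N) (s : Set (Fin m)) {w : ℕ} {g : R}
    (hg : g ∈ wIdeal x ω w) : ∃ (c : Fin m → R) (P : MvPolynomial (Fin e ⊕ Fin r) R),
      (∀ j ∉ s, c j = 0) ∧ (∀ j, c j ∈ wIdeal x ω (w - N * n j)) ∧
      (∀ d, coeff d P ≠ 0 → IsUnit (coeff d P) ∧ Finsupp.weight ω d = w ∧
        yPart d ∉ exponents (yIdeal e G s)) ∧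
      g - ∑ j, c j * f j - eval x P ∈ wIdeal x ω (w + 1) := by
  obtain ⟨Q, hQ⟩ := exists_isInit hg
  obtain ⟨C, hCs, hCw, hCe⟩ := exists_reduction h.isHomogeneous hω.eq hQ.isWeightedHomogeneous s
  have hlift : ∀ j, ∃ c : R, (j ∉ s → c = 0) ∧ c ∈ wIdeal x ω (w - N * n j) ∧
      IsInit x ω w (c * f j) (C j * rename Sum.inr (G j)) := by
    intro j
    by_cases hC0 : C j = 0
    · refine ⟨0, fun _ => rfl, zero_mem _, ?_⟩
      rw [hC0, zero_mul, zero_mul]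
      exact isInit_zero (zero_mem _)
    · have hw : N * n j ≤ w := by
        obtain ⟨d, hd⟩ := exists_coeff_ne_zero hC0
        have := hCw j d hd
        omega
      have hh : (C j).IsWeightedHomogeneous ω (w - N * n j) := fun d hd => by
        have := hCw j d hd
        omega
      obtain ⟨p, -, hp⟩ := exists_lift x hh
      refine ⟨eval x p, fun hj => absurd (hCs j hj) hC0, hp.mem, ?_⟩
      have := hp.mul (h.isInit j)
      rwa [tsub_add_cancel_of_le hw] at this
  choose c hc0 hcw hcI using hlift
  have hI : IsInit x ω w (g - ∑ j, c j * f j) (Q - ∑ j, C j * rename Sum.inr (G j)) :=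
    hQ.sub (IsInit.sum Finset.univ fun j _ => hcI j)
  obtain ⟨P, hP, hPI⟩ := exists_lift x hI.isWeightedHomogeneous
  refine ⟨c, P, hc0, hcw, fun d hd => ⟨(hP d hd).1, hI.isWeightedHomogeneous (hP d hd).2,
    hCe d (hP d hd).2⟩, ?_⟩
  have := hI.sub hPI
  rw [sub_self] at this
  exact this.mem_succ hx hω.pos

/-- Division of `g` by the `f j`, `j ∈ s`, up to a given weight: the remainder has unit
coefficients and no monomials `u^A y^B` with `B` an exponent of the ideal of the initial forms. -/
theorem HasInitialForms.exists_division (h : HasInitialForms x ω N f n G)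
    (hx : IsParameterSystem x) (hω : IsWeighting ω N) (s : Set (Fin m)) {w : ℕ} {g : R}
    (hg : g ∈ wIdeal x ω w) (t : ℕ) : ∃ (c : Fin m → R) (P : MvPolynomial (Fin e ⊕ Fin r) R),
      (∀ j ∉ s, c j = 0) ∧ (∀ j, c j ∈ wIdeal x ω (w - N * n j)) ∧
      (∀ d, coeff d P ≠ 0 → IsUnit (coeff d P) ∧ w ≤ Finsupp.weight ω d ∧
        Finsupp.weight ω d < w + t ∧ yPart d ∉ exponents (yIdeal e G s)) ∧
      g - ∑ j, c j * f j - eval x P ∈ wIdeal x ω (w + t) := by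
  induction t with
  | zero => exact ⟨0, 0, by simp, by simp, by simp, by simpa using hg⟩
  | succ t ih =>
    obtain ⟨c, P, hcs, hcw, hP, hgP⟩ := ih
    obtain ⟨c', P', hcs', hcw', hP', hgP'⟩ := h.exists_division_step hx hω s hgP
    refine ⟨c + c', P + P', fun j hj => ?_, fun j => ?_, fun d hd => ?_, ?_⟩
    · rw [Pi.add_apply, hcs j hj, hcs' j hj, add_zero]
    · exact Ideal.add_mem _ (hcw j) (wIdeal_antitone (by omega) (hcw' j))
    · rw [coeff_add] at hd ⊢
      by_cases h' : coeff d P' = 0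
      · rw [h', add_zero] at hd ⊢
        have := hP d hd
        exact ⟨this.1, this.2.1, by omega, this.2.2.2⟩
      · have h1 := hP' d h'
        have h0 : coeff d P = 0 := by
          by_contra h0
          have := hP d h0
          omega
        rw [h0, zero_add]
        exact ⟨h1.1, by omega, by omega, h1.2.2⟩
    · have : g - ∑ j, (c + c') j * f j - eval x (P + P') =
          g - ∑ j, c j * f j - eval x P - ∑ j, c' j * f j - eval x P' := by
        simp only [Pi.add_apply, add_mul, Finset.sum_add_distrib, map_add]
        ring
      rw [this]
      exact hgP'

/-! ### The ideal of initial forms does not depend on the weights -/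

/-- All initial forms of elements of `J` belong to the ideal `I`. -/
def InitialFormsMem (x : Fin e ⊕ Fin r → R) (ω : Fin e ⊕ Fin r → ℕ) (J : Ideal R)
    (I : Ideal (MvPolynomial (Fin e ⊕ Fin r) (ResidueField R))) : Prop :=
  ∀ g ∈ J, ∀ w Q, IsInit x ω w g Q → Q ∈ I

variable [IsNoetherianRing R]

/-- If the `G j` generate the initial forms of `J` for one weighting, they do so for every
weighting for which they are the initial forms of `f`. Otherwise division with respect to the second
weighting produces an element of `J` with a non-zero remainder, and then the initial form of this
remainder for the first weighting contradicts the hypothesis. -/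
theorem HasInitialForms.initialFormsMem (hx : IsParameterSystem x) {J : Ideal R}
    (hJ : ∀ j, f j ∈ J) {ω' : Fin e ⊕ Fin r → ℕ} {N' : ℕ} (hω : IsWeighting ω N)
    (hω' : IsWeighting ω' N') (h' : HasInitialForms x ω' N' f n G)
    (hmem : InitialFormsMem x ω J (yIdeal e G Set.univ)) :
    InitialFormsMem x ω' J (yIdeal e G Set.univ) := by
  classical
  intro g hg w Q hQ
  set S := ∑ i, ω i with hS
  set S' := ∑ i, ω' i with hS'
  -- the error of the division has `ω'`-weight so large that its `ω`-weight exceeds `S * w`, which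
  -- bounds the `ω`-weight of the monomials of `ω'`-weight `w`
  obtain ⟨c, P, hcs, hcw, hP, hgP⟩ := h'.exists_division hx hω' Set.univ hQ.mem
    ((S' + 1) * (S * w + 1))
  set t := (S' + 1) * (S * w + 1) with ht
  have ht0 : 0 < t := by positivity
  obtain ⟨Q₁, hQ₁, hQ₁I⟩ := h'.exists_isInit_sum hcs hcw
  by_cases hPw : ∀ d, coeff d P ≠ 0 → Finsupp.weight ω' d ≠ w
  · have h1 : IsInit x ω' w (eval x P) 0 := by
      refine isInit_zero (eval_mem_monoIdeal fun d hd => ?_)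
      exact Nat.lt_of_le_of_ne (hP d hd).2.1 (Ne.symm (hPw d hd))
    have h2 : IsInit x ω' w (g - ∑ j, c j * f j - eval x P) 0 :=
      isInit_zero (wIdeal_antitone (by omega) hgP)
    have h3 := (h2.add h1).add hQ₁I
    rw [sub_add_cancel, sub_add_cancel, zero_add, zero_add] at h3
    rw [hQ.unique hx hω'.pos h3]
    exact hQ₁
  · push Not at hPw
    obtain ⟨d₀, hd₀, hd₀w⟩ := hPw
    obtain ⟨d₁, hd₁, hmin⟩ := Finset.exists_min_image P.support (Finsupp.weight ω)
      ⟨d₀, mem_support_iff.2 hd₀⟩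
    set v := Finsupp.weight ω d₁ with hv
    have hvle : v ≤ S * w := by
      refine (hmin d₀ (mem_support_iff.2 hd₀)).trans ((weight_le_mul_degree ω d₀).trans ?_)
      refine Nat.mul_le_mul_left _ ?_
      rw [← hd₀w]
      exact degree_le_weight hω'.pos d₀
    have hhJ : g - ∑ j, c j * f j ∈ J :=
      Ideal.sub_mem _ hg (Ideal.sum_mem _ fun j _ => Ideal.mul_mem_left _ _ (hJ j))
    have hrest : g - ∑ j, c j * f j - eval x P ∈ wIdeal x ω (v + 1) := by
      have h1 := wIdeal_le_pow (x := x) (ω := ω') (n := w + t) (k := S * w + 1)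
        (Nat.le_add_left _ _) hgP
      exact wIdeal_antitone (by omega) (pow_le_wIdeal hω.pos _ h1)
    have hPI : IsInit x ω v (eval x P) (map (residue R) (weightedHomogeneousComponent ω v P)) := by
      refine ⟨_, weightedHomogeneousComponent_isWeightedHomogeneous v P, ?_, rfl⟩
      rw [← map_sub]
      refine eval_mem_monoIdeal fun d hd => ?_
      rw [coeff_sub, coeff_weightedHomogeneousComponent] at hd
      split_ifs at hd with h
      · exact absurd (sub_self _) hd
      · rw [sub_zero] at hd
        exact Nat.lt_of_le_of_ne (hmin d (mem_support_iff.2 hd)) (Ne.symm h)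
    have hI := (isInit_zero hrest).add hPI
    rw [sub_add_cancel, zero_add] at hI
    -- the initial form for `ω` is the one of `P`; it belongs to the ideal without involving its
    -- exponents
    have hIm := hmem _ hhJ v _ hI
    set Q₂ := map (residue R) (weightedHomogeneousComponent ω v P) with hQ₂
    have hne : uCoeff (uPart d₁) Q₂ ≠ 0 := by
      intro h0
      have : coeff (yPart d₁) (uCoeff (uPart d₁) Q₂) = 0 := by rw [h0, coeff_zero]
      rw [coeff_uCoeff, pairExp_parts, hQ₂, coeff_map, coeff_weightedHomogeneousComponent,
        if_pos rfl] at this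
      exact (residue_ne_zero_iff_isUnit _).2 (hP d₁ (mem_support_iff.1 hd₁)).1 this
    obtain ⟨B, hB, hBe⟩ := exists_mem_exponents (e := e) (uCoeff_mem_of_mem_yIdeal hIm _) hne
    rw [coeff_uCoeff, hQ₂, coeff_map, coeff_weightedHomogeneousComponent] at hB
    have hB' : coeff (pairExp (uPart d₁) B) P ≠ 0 := by
      intro h0
      rw [h0, ite_self, map_zero] at hB
      exact hB rfl
    have := (hP _ hB').2.2.2
    rw [yPart_pairExp] at this
    exact absurd hBe this

end Division

/-! ### Linear forms, polyhedra and reference data -/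

section Weightings

open IsLocalRing MvPolynomial

variable {e r : ℕ}

theorem uVec_nonneg (d : (Fin e ⊕ Fin r) →₀ ℕ) (i : Fin e) : 0 ≤ uVec d i := Nat.cast_nonneg _

theorem linForm_nonneg {a : Fin e → ℚ} (ha : IsPositive a) {v : Fin e → ℝ} (hv : ∀ i, 0 ≤ v i) :
    0 ≤ linForm a v :=
  Finset.sum_nonneg fun i _ => mul_nonneg (by exact_mod_cast (ha i).le) (hv i)

theorem linForm_uVec_pos {a : Fin e → ℚ} (ha : IsPositive a) {d : (Fin e ⊕ Fin r) →₀ ℕ}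
    (hd : uPart d ≠ 0) : 0 < linForm a (uVec d) := by
  obtain ⟨i, hi⟩ := Finsupp.ne_iff.1 hd
  refine Finset.sum_pos' (fun i _ => mul_nonneg (by exact_mod_cast (ha i).le) (uVec_nonneg d i))
    ⟨i, Finset.mem_univ i, mul_pos (by exact_mod_cast ha i) ?_⟩
  exact Nat.cast_pos.2 (Nat.pos_of_ne_zero hi)

theorem linForm_slopePoint (a : Fin e → ℚ) (n : ℕ) (d : (Fin e ⊕ Fin r) →₀ ℕ) :
    linForm a (slopePoint n d) = linForm a (uVec d) / ((n : ℝ) - yDeg d) := by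
  simp only [linForm, slopePoint, Finset.sum_div, mul_div_assoc]

/-- The value of a linear form at a slope point compared with `1` is the weight compared with
`n`. -/
theorem lt_linForm_slopePoint_iff {a : Fin e → ℚ} {n : ℕ} {d : (Fin e ⊕ Fin r) →₀ ℕ}
    (hd : yDeg d < n) : 1 < linForm a (slopePoint n d) ↔ (n : ℝ) < weight a d := by
  have h : (0 : ℝ) < (n : ℝ) - yDeg d := sub_pos.2 (Nat.cast_lt.2 hd)
  rw [linForm_slopePoint, one_lt_div h, sub_lt_iff_lt_add, weight]

theorem linForm_slopePoint_le_iff {a : Fin e → ℚ} {n : ℕ} {d : (Fin e ⊕ Fin r) →₀ ℕ}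
    (hd : yDeg d < n) : linForm a (slopePoint n d) ≤ 1 ↔ weight a d ≤ n := by
  rw [← not_lt, lt_linForm_slopePoint_iff hd, not_lt]

theorem slopePoint_nonneg {n : ℕ} {d : (Fin e ⊕ Fin r) →₀ ℕ} (hd : yDeg d < n) (i : Fin e) :
    0 ≤ slopePoint n d i :=
  div_nonneg (uVec_nonneg d i) (sub_nonneg.2 (Nat.cast_le.2 hd.le))

theorem yDeg_eq_sum (d : (Fin e ⊕ Fin r) →₀ ℕ) : yDeg d = ∑ j, d (Sum.inr j) := by
  rw [yDeg, Finsupp.degree_eq_sum]; rfl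

/-- A positive rational linear form is a multiple of an integral weighting. -/
theorem exists_isWeighting {a : Fin e → ℚ} (ha : IsPositive a) :
    ∃ (ω : Fin e ⊕ Fin r → ℕ) (N : ℕ), IsWeighting ω N ∧
      ∀ d, (Finsupp.weight ω d : ℝ) = N * weight a d := by
  set N : ℕ := ∏ i, (a i).den with hN
  have hN0 : 0 < N := Finset.prod_pos fun i _ => (a i).den_pos
  have hb : ∀ i, ∃ b : ℕ, (b : ℚ) = N * a i := by
    intro i
    obtain ⟨k, hk⟩ : (a i).den ∣ N := Finset.dvd_prod_of_mem _ (Finset.mem_univ i)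
    refine ⟨k * (a i).num.toNat, ?_⟩
    have h1 : (((a i).num.toNat : ℕ) : ℚ) = (a i).num := by
      have : (((a i).num.toNat : ℕ) : ℤ) = (a i).num :=
        Int.toNat_of_nonneg (Rat.num_pos.2 (ha i)).le
      exact_mod_cast this
    rw [Nat.cast_mul, h1, hk, Nat.cast_mul, mul_assoc, mul_comm ((a i).den : ℚ), mul_assoc,
      Rat.mul_den_eq_num]
  choose b hb using hb
  refine ⟨Sum.elim b fun _ => N, N, ⟨?_, fun _ => rfl, hN0⟩, fun d => ?_⟩
  · rintro (i | j)
    · have : (0 : ℚ) < b i := by rw [hb]; exact mul_pos (by exact_mod_cast hN0) (ha i)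
      exact_mod_cast this
    · exact hN0
  · have hb' : ∀ i, (b i : ℝ) = N * (a i : ℝ) := fun i => by
      exact_mod_cast congrArg (Rat.cast : ℚ → ℝ) (hb i)
    rw [Finsupp.weight_eq_sum, Fintype.sum_sum_type, weight, linForm, yDeg_eq_sum]
    simp only [Sum.elim_inl, Sum.elim_inr, smul_eq_mul, uVec, uPart_apply]
    push_cast
    rw [mul_add, Finset.mul_sum, Finset.mul_sum]
    congr 1
    · exact Finset.sum_congr rfl fun i _ => by rw [hb' i]; ring
    · exact Finset.sum_congr rfl fun i _ => by ring

variable {R : Type*} [CommRing R] [IsLocalRing R] {u : Fin e → R} {y : Fin r → R} {g : R}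

theorem coeff_initZero (B : Fin r →₀ ℕ) : coeff B (initZero u y g) =
    if B.degree = ord u y g then residue R ((expansion u y g).coeff (pairExp 0 B)) else 0 := by
  classical
  rw [initZero, coeff_sum]
  simp only [coeff_monomial]
  by_cases hB : (expansion u y g).coeff (pairExp 0 B) = 0
  · rw [hB, map_zero, ite_self]
    refine Finset.sum_eq_zero fun d hd => ?_
    rw [if_neg]
    rintro rfl
    obtain ⟨h1, h2, -⟩ := Finset.mem_filter.1 hd
    rw [← h2, pairExp_parts] at hB
    exact mem_support_iff.1 h1 hB
  · split_ifs with h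
    · rw [Finset.sum_eq_single (pairExp 0 B)]
      · rw [if_pos (yPart_pairExp 0 B)]
      · intro d hd hne
        rw [if_neg]
        rintro rfl
        obtain ⟨-, h2, -⟩ := Finset.mem_filter.1 hd
        exact hne (by rw [← h2, pairExp_parts])
      · intro hn
        refine absurd (Finset.mem_filter.2 ⟨mem_support_iff.2 hB, uPart_pairExp 0 B, ?_⟩) hn
        rw [yDeg, yPart_pairExp, h]
    · refine Finset.sum_eq_zero fun d hd => if_neg ?_
      rintro rfl
      exact h (Finset.mem_filter.1 hd).2.2

theorem initZero_isHomogeneous : (initZero u y g).IsHomogeneous (ord u y g) := by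
  intro B hB
  rw [coeff_initZero] at hB
  rw [weight_one_eq_degree]
  by_contra h
  rw [if_neg h] at hB
  exact hB rfl

theorem coeff_initZeroUY (d : (Fin e ⊕ Fin r) →₀ ℕ) : coeff d (initZeroUY u y g) =
    if uPart d = 0 ∧ yDeg d = ord u y g then residue R ((expansion u y g).coeff d) else 0 := by
  by_cases h : uPart d = 0
  · have hd : d = pairExp 0 (yPart d) := by rw [← h, pairExp_parts]
    rw [initZeroUY]
    conv_lhs => rw [hd, coeff_rename_pairExp, coeff_initZero, ← hd]
    simp only [h, true_and, yDeg]
  · rw [if_neg fun hh => h hh.1]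
    by_contra hne
    exact h (CharPoly.coeff_rename_ne_zero hne).1

open Classical in
theorem coeff_initL (a : Fin e → ℚ) (d : (Fin e ⊕ Fin r) →₀ ℕ) : coeff d (initL u y a g) =
    if ∀ d' ∈ (expansion u y g).support, weight a d ≤ weight a d' then
      residue R ((expansion u y g).coeff d) else 0 := by
  rw [initL, coeff_sum]
  simp only [coeff_monomial, Finset.sum_ite_eq', Finset.mem_filter, mem_support_iff]
  by_cases h : (expansion u y g).coeff d = 0
  · simp [h]
  · simp [h]

theorem coeff_initVertex {v : Fin e → ℝ} {d : (Fin e ⊕ Fin r) →₀ ℕ}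
    (hd : coeff d (initVertex u y v g) ≠ 0) : (expansion u y g).coeff d ≠ 0 ∧
      ((uPart d = 0 ∧ yDeg d = ord u y g) ∨
        (yDeg d < ord u y g ∧ slopePoint (ord u y g) d = v)) := by
  classical
  rw [initVertex, coeff_add, coeff_initZeroUY, coeff_sum] at hd
  simp only [coeff_monomial, Finset.sum_ite_eq', Finset.mem_filter, mem_support_iff] at hd
  by_cases h : (expansion u y g).coeff d = 0
  · simp [h] at hd
  · refine ⟨h, ?_⟩
    by_contra hcon
    push Not at hcon
    rw [if_neg (fun hh => hcon.1 hh.1 hh.2), if_neg (fun hh => hcon.2 hh.2.1 hh.2.2)] at hd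
    exact hd (add_zero 0)

section

variable {ω : Fin e ⊕ Fin r → ℕ} {N : ℕ} {a : Fin e → ℚ} [IsNoetherianRing R]

theorem initL_eq_of_isInit (h : IsRSP u y) (hω : IsWeighting ω N)
    (hωa : ∀ d : (Fin e ⊕ Fin r) →₀ ℕ, (Finsupp.weight ω d : ℝ) = N * weight a d) {w : ℕ}
    {Q : MvPolynomial (Fin e ⊕ Fin r) (ResidueField R)} (hQ : IsInit (Sum.elim u y) ω w g Q)
    (h0 : Q ≠ 0) : initL u y a g = Q := by
  classical
  have hle : ∀ d d' : (Fin e ⊕ Fin r) →₀ ℕ, weight a d ≤ weight a d' ↔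
      Finsupp.weight ω d ≤ Finsupp.weight ω d' := fun d d' => by
    rw [← Nat.cast_le (α := ℝ), hωa, hωa, mul_le_mul_iff_right₀ (Nat.cast_pos.2 hω.pos_eq)]
  obtain ⟨h1, h2⟩ := (isInit_iff_coeff h hω.pos).1 hQ
  obtain ⟨d₀, hd₀⟩ := exists_coeff_ne_zero h0
  rw [h2] at hd₀
  have hw0 : Finsupp.weight ω d₀ = w := by
    by_contra hh
    rw [if_neg hh] at hd₀
    exact hd₀ rfl
  have hs0 : (expansion u y g).coeff d₀ ≠ 0 := fun hh => hd₀ (by simp [hh])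
  ext d
  rw [coeff_initL, h2]
  by_cases hd : (expansion u y g).coeff d = 0
  · simp [hd]
  · refine if_congr ⟨fun hh => ?_, fun hh d' hd' => ?_⟩ rfl rfl
    · have := (hle d d₀).1 (hh d₀ (mem_support_iff.2 hs0))
      exact le_antisymm (hw0 ▸ this) (h1 d hd)
    · rw [hle, hh]
      exact h1 d' (mem_support_iff.1 hd')

theorem exists_isInit_initL (h : IsRSP u y) (hω : IsWeighting ω N)
    (hωa : ∀ d : (Fin e ⊕ Fin r) →₀ ℕ, (Finsupp.weight ω d : ℝ) = N * weight a d) (g : R) :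
    ∃ w, IsInit (Sum.elim u y) ω w g (initL u y a g) := by
  by_cases hs : (expansion u y g).support.Nonempty
  · obtain ⟨d₀, hd₀, hmin⟩ := Finset.exists_min_image _ (Finsupp.weight ω) hs
    have hmem : g ∈ wIdeal (Sum.elim u y) ω (Finsupp.weight ω d₀) :=
      (mem_monoIdeal_iff_expansion h (isUpperSet_weight_ge _)).2
        fun d hd => hmin d (mem_support_iff.2 hd)
    obtain ⟨Q, hQ⟩ := exists_isInit hmem
    refine ⟨_, (initL_eq_of_isInit h hω hωa hQ fun h0 => ?_).symm ▸ hQ⟩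
    have := ((isInit_iff_coeff h hω.pos).1 hQ).2 d₀
    rw [h0, coeff_zero, if_pos rfl] at this
    exact residue_coeff_expansion_ne_zero h (mem_support_iff.1 hd₀) this.symm
  · rw [Finset.not_nonempty_iff_eq_empty] at hs
    have h0 : g = 0 := by
      rw [← (isExpansion_expansion h g).eval_eq, support_eq_empty.1 hs, map_zero]
    refine ⟨0, ?_⟩
    have : initL u y a g = 0 := by
      rw [initL, hs, Finset.filter_empty, Finset.sum_empty]
    rw [this]
    exact isInit_zero (h0 ▸ zero_mem _)

end

/-! ### The order modulo `⟨u⟩` -/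

theorem span_sup_pow_eq_monoIdeal {R : Type*} [CommRing R] (u : Fin e → R) (y : Fin r → R) (k : ℕ) :
    Ideal.span (Set.range u) ⊔ Ideal.span (Set.range y) ^ k =
      monoIdeal (Sum.elim u y) {d | uPart d ≠ 0 ∨ k ≤ yDeg d} := by
  classical
  have hpair : ∀ d : (Fin e ⊕ Fin r) →₀ ℕ, eval (Sum.elim u y) (monomial d 1) =
      eval u (monomial (uPart d) 1) * eval y (monomial (yPart d) 1) := by
    intro d
    conv_lhs => rw [← pairExp_parts d, monomial_pairExp]
    rw [map_mul, eval_rename, eval_rename]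
    rfl
  apply le_antisymm
  · refine sup_le ?_ ?_
    · rw [Ideal.span_le]
      rintro _ ⟨i, rfl⟩
      have := monomial_mem_monoIdeal (x := Sum.elim u y)
        (E := {d : (Fin e ⊕ Fin r) →₀ ℕ | uPart d ≠ 0 ∨ k ≤ yDeg d})
        (d := pairExp (Finsupp.single i 1) 0) (Or.inl (by simp))
      rw [hpair, uPart_pairExp, yPart_pairExp] at this
      simpa [eval_monomial] using this
    · rw [span_range_pow_eq_monoIdeal, monoIdeal, Ideal.span_le]
      rintro _ ⟨B, hB, rfl⟩
      have := monomial_mem_monoIdeal (x := Sum.elim u y)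
        (E := {d : (Fin e ⊕ Fin r) →₀ ℕ | uPart d ≠ 0 ∨ k ≤ yDeg d})
        (d := pairExp 0 B) (Or.inr (by rw [yDeg, yPart_pairExp]; exact hB))
      rw [hpair, uPart_pairExp, yPart_pairExp] at this
      simpa using this
  · rw [monoIdeal, Ideal.span_le]
    rintro _ ⟨d, hd | hd, rfl⟩
    · refine Ideal.mem_sup_left ?_
      simp only [hpair]
      refine Ideal.mul_mem_right _ _ ?_
      rw [← pow_one (Ideal.span _), span_range_pow_eq_monoIdeal]
      refine monomial_mem_monoIdeal ?_
      exact Nat.one_le_iff_ne_zero.2 fun h => hd ((Finsupp.degree_eq_zero_iff _).1 h)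
    · refine Ideal.mem_sup_right ?_
      simp only [hpair]
      refine Ideal.mul_mem_left _ _ ?_
      rw [span_range_pow_eq_monoIdeal]
      exact monomial_mem_monoIdeal hd

theorem isUpperSet_uPart_or (k : ℕ) :
    IsUpperSet {d : (Fin e ⊕ Fin r) →₀ ℕ | uPart d ≠ 0 ∨ k ≤ yDeg d} := by
  rintro d d' hle (h | h)
  · left
    intro h0
    refine h (Finsupp.ext fun i => ?_)
    have h1 : d (Sum.inl i) ≤ d' (Sum.inl i) := hle (Sum.inl i)
    have h2 : d' (Sum.inl i) = 0 := DFunLike.congr_fun h0 i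
    exact Nat.le_zero.1 (h2 ▸ h1)
  · right
    rw [yDeg_eq_sum] at h ⊢
    exact h.trans (Finset.sum_le_sum fun j _ => hle (Sum.inr j))

variable [IsNoetherianRing R] {ω : Fin e ⊕ Fin r → ℕ} {N : ℕ}

theorem weight_eq_of_uPart_eq_zero (hω : IsWeighting ω N) {d : (Fin e ⊕ Fin r) →₀ ℕ}
    (hd : uPart d = 0) : Finsupp.weight ω d = N * yDeg d := by
  rw [← pairExp_parts d, hd, weight_pairExp hω.eq, yDeg, yPart_pairExp]
  have : (pairExp 0 0 : (Fin e ⊕ Fin r) →₀ ℕ) = 0 := by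
    ext i
    rcases i with i | j <;> simp [pairExp]
  rw [this, map_zero, zero_add]

/-- If the initial form of `g` is a non-zero form in `K[Y]`, then it is the `0`-initial form of `g`
and its degree is the order of `g` modulo `⟨u⟩`. -/
theorem ord_eq_and_initZero_eq (h : IsRSP u y) (hω : IsWeighting ω N) {n : ℕ}
    {G : MvPolynomial (Fin r) (ResidueField R)} (hG0 : G ≠ 0)
    (hg : IsInit (Sum.elim u y) ω (N * n) g (rename Sum.inr G)) :
    ord u y g = n ∧ initZero u y g = G := by
  obtain ⟨h1, h2⟩ := (isInit_iff_coeff h hω.pos).1 hg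
  have hc : ∀ B : Fin r →₀ ℕ, coeff B G =
      if B.degree = n then residue R ((expansion u y g).coeff (pairExp 0 B)) else 0 := by
    intro B
    rw [← coeff_rename_pairExp (e := e), h2, weight_eq_of_uPart_eq_zero hω (uPart_pairExp 0 B),
      yDeg, yPart_pairExp]
    exact if_congr (Nat.mul_right_inj hω.pos_eq.ne') rfl rfl
  have hord : ord u y g = n := by
    have hset : {k : ℕ | Ideal.Quotient.mk (Ideal.span (Set.range u)) g ∈
        ((Ideal.span (Set.range y)).map (Ideal.Quotient.mk (Ideal.span (Set.range u)))) ^ k} =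
        Set.Iic n := by
      ext k
      rw [Set.mem_ofPred_eq, ← Ideal.map_pow, Ideal.mem_quotient_iff_mem_sup, sup_comm,
        span_sup_pow_eq_monoIdeal, mem_monoIdeal_iff_expansion h (isUpperSet_uPart_or k),
        Set.mem_Iic]
      constructor
      · intro hk
        obtain ⟨B, hB⟩ := exists_coeff_ne_zero hG0
        rw [hc] at hB
        split_ifs at hB with hBn
        · rcases hk (pairExp 0 B) (fun hh => hB (by rw [hh, map_zero])) with hh | hh
          · exact absurd (uPart_pairExp 0 B) hh
          · rwa [yDeg, yPart_pairExp, hBn] at hh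
        · exact absurd rfl hB
      · intro hk d hd
        by_cases hd0 : uPart d = 0
        · right
          have := h1 d hd
          rw [weight_eq_of_uPart_eq_zero hω hd0] at this
          exact hk.trans (Nat.le_of_mul_le_mul_left this hω.pos_eq)
        · exact Or.inl hd0
    rw [ord, hset, csSup_Iic]
  refine ⟨hord, ?_⟩
  ext B
  rw [coeff_initZero, hc, hord]

end Weightings

section ReferenceData

open IsLocalRing MvPolynomial

variable {e r : ℕ}

theorem subset_fHull (S : Set (Fin e → ℝ)) : S ⊆ fHull S := Set.subset_sInter fun _ hD => hD.2

theorem fHull_subset {S D : Set (Fin e → ℝ)} (hD : IsFSubset D) (h : S ⊆ D) : fHull S ⊆ D :=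
  Set.sInter_subset_of_mem ⟨hD, h⟩

theorem isFSubset_orthant : IsFSubset {v : Fin e → ℝ | ∀ i, 0 ≤ v i} where
  nonneg _ hv := hv
  closed := by
    simp only [Set.ofPred_forall]
    exact isClosed_iInter fun i => isClosed_le continuous_const (continuous_apply i)
  convex := by
    intro v hv w hw s t hs ht _ i
    exact add_nonneg (mul_nonneg hs (hv i)) (mul_nonneg ht (hw i))
  add_mem v hv w hw i := add_nonneg (hv i) (hw i)

theorem isFSubset_sInter {T : Set (Set (Fin e → ℝ))} (hT : T.Nonempty)
    (h : ∀ D ∈ T, IsFSubset D) : IsFSubset (⋂₀ T) where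
  nonneg v hv := by
    obtain ⟨D, hD⟩ := hT
    exact (h D hD).nonneg v (hv D hD)
  closed := isClosed_sInter fun D hD => (h D hD).closed
  convex := convex_sInter fun D hD => (h D hD).convex
  add_mem v hv w hw D hD := (h D hD).add_mem v (hv D hD) w hw

theorem linForm_add (a : Fin e → ℚ) (v w : Fin e → ℝ) :
    linForm a (v + w) = linForm a v + linForm a w := by
  simp [linForm, mul_add, Finset.sum_add_distrib]

theorem linForm_smul (a : Fin e → ℚ) (c : ℝ) (v : Fin e → ℝ) :
    linForm a (c • v) = c * linForm a v := by
  simp only [linForm, Pi.smul_apply, smul_eq_mul, Finset.mul_sum]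
  exact Finset.sum_congr rfl fun i _ => by ring

theorem continuous_linForm (a : Fin e → ℚ) : Continuous (linForm a) :=
  continuous_finsetSum _ fun i _ => continuous_const.mul (continuous_apply i)

theorem isFSubset_halfSpace {a : Fin e → ℚ} (ha : IsPositive a) (c : ℝ) :
    IsFSubset {v : Fin e → ℝ | (∀ i, 0 ≤ v i) ∧ c ≤ linForm a v} where
  nonneg _ hv := hv.1
  closed := isFSubset_orthant.closed.inter (isClosed_le continuous_const (continuous_linForm a))
  convex := by
    intro v hv w hw s t hs ht hst
    refine ⟨isFSubset_orthant.convex hv.1 hw.1 hs ht hst, ?_⟩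
    rw [linForm_add, linForm_smul, linForm_smul]
    calc c = s * c + t * c := by rw [← add_mul, hst, one_mul]
      _ ≤ _ := add_le_add (mul_le_mul_of_nonneg_left hv.2 hs) (mul_le_mul_of_nonneg_left hw.2 ht)
  add_mem v hv w hw := by
    refine ⟨isFSubset_orthant.add_mem v hv.1 w hw, ?_⟩
    rw [linForm_add]
    exact hv.2.trans (le_add_of_nonneg_right (linForm_nonneg ha hw))

variable {R : Type*} [CommRing R] {u : Fin e → R} {y : Fin r → R} {m : ℕ} {f : Fin m → R}

theorem fHull_isFSubset {S : Set (Fin e → ℝ)} (hS : ∀ v ∈ S, ∀ i, 0 ≤ v i) : IsFSubset (fHull S) :=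
  isFSubset_sInter ⟨_, isFSubset_orthant, hS⟩ fun _ hD => hD.1

theorem slopePoint_mem_polyhedron {i : Fin m} {d : (Fin e ⊕ Fin r) →₀ ℕ}
    (hd : (expansion u y (f i)).coeff d ≠ 0) (hlt : yDeg d < ord u y (f i)) :
    slopePoint (ord u y (f i)) d ∈ polyhedron u y f :=
  subset_fHull _ (Set.mem_iUnion.2 ⟨i, subset_fHull _ ⟨d, mem_support_iff.2 hd, hlt, rfl⟩⟩)

/-- The polyhedron of a system is the smallest `F`-subset containing the points of all its
elements. -/
theorem polyhedron_subset {D : Set (Fin e → ℝ)} (hD : IsFSubset D)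
    (h : ∀ i d, (expansion u y (f i)).coeff d ≠ 0 → yDeg d < ord u y (f i) →
      slopePoint (ord u y (f i)) d ∈ D) : polyhedron u y f ⊆ D := by
  refine fHull_subset hD (Set.iUnion_subset fun i => fHull_subset hD ?_)
  rintro _ ⟨d, hd, hlt, rfl⟩
  exact h i d (mem_support_iff.1 hd) hlt

theorem isFSubset_polyhedron : IsFSubset (polyhedron u y f) := by
  refine fHull_isFSubset fun v hv => ?_
  obtain ⟨i, hi⟩ := Set.mem_iUnion.1 hv
  refine (fHull_subset isFSubset_orthant ?_ hi : v ∈ {v : Fin e → ℝ | ∀ i, 0 ≤ v i})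
  rintro _ ⟨d, -, hlt, rfl⟩
  exact slopePoint_nonneg hlt

variable [IsLocalRing R] {J : Ideal R} {a : Fin e → ℚ}

theorem IsReferenceDatum.initZero_ne_zero (hf : IsReferenceDatum u y J f a) (i : Fin m) :
    initZero u y (f i) ≠ 0 := fun h => hf.notMem i (h ▸ zero_mem _)

variable [IsNoetherianRing R] {ω : Fin e ⊕ Fin r → ℕ} {N : ℕ}

theorem IsReferenceDatum.hasInitialForms (h : IsRSP u y) (hf : IsReferenceDatum u y J f a)
    (hω : IsWeighting ω N)
    (hωa : ∀ d : (Fin e ⊕ Fin r) →₀ ℕ, (Finsupp.weight ω d : ℝ) = N * weight a d) :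
    HasInitialForms (Sum.elim u y) ω N f (fun i => ord u y (f i))
      (fun i => initZero u y (f i)) := by
  refine ⟨fun i => initZero_isHomogeneous, fun i => ?_⟩
  obtain ⟨w, hw⟩ := exists_isInit_initL h hω hωa (f i)
  rw [hf.effective i] at hw
  obtain ⟨B, hB⟩ := exists_coeff_ne_zero (hf.initZero_ne_zero i)
  have h1 : Finsupp.weight ω (pairExp 0 B : (Fin e ⊕ Fin r) →₀ ℕ) = w :=
    hw.isWeightedHomogeneous (by rw [initZeroUY, coeff_rename_pairExp]; exact hB)
  have h2 : B.degree = ord u y (f i) := by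
    rw [← weight_one_eq_degree]; exact initZero_isHomogeneous hB
  rw [weight_eq_of_uPart_eq_zero hω (uPart_pairExp 0 B), yDeg, yPart_pairExp, h2] at h1
  rw [h1]
  exact hw

theorem IsReferenceDatum.initialFormsMem (h : IsRSP u y) (hf : IsReferenceDatum u y J f a)
    (hω : IsWeighting ω N)
    (hωa : ∀ d : (Fin e ⊕ Fin r) →₀ ℕ, (Finsupp.weight ω d : ℝ) = N * weight a d) :
    InitialFormsMem (Sum.elim u y) ω J (yIdeal e (fun i => initZero u y (f i)) Set.univ) := by
  intro g hg w Q hQ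
  by_cases h0 : Q = 0
  · rw [h0]; exact zero_mem _
  · have hspan := hf.span_eq
    rw [yIdeal, Set.image_univ]
    refine hspan ▸ Ideal.subset_span ⟨g, hg, (initL_eq_of_isInit h hω hωa hQ h0).symm⟩

/-- In the expansion of an element of a system with a reference datum, the weights are at least
the order, with equality only for the monomials of the `0`-initial form. -/
theorem IsReferenceDatum.lt_weight (h : IsRSP u y) (hf : IsReferenceDatum u y J f a) {i : Fin m}
    {d : (Fin e ⊕ Fin r) →₀ ℕ} (hd : (expansion u y (f i)).coeff d ≠ 0)
    (hlt : yDeg d < ord u y (f i)) : (ord u y (f i) : ℝ) < weight a d := by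
  obtain ⟨ω, N, hω, hωa⟩ := exists_isWeighting (r := r) hf.positive
  obtain ⟨h1, h2⟩ := (isInit_iff_coeff h hω.pos).1 ((hf.hasInitialForms h hω hωa).isInit i)
  have hN : (0 : ℝ) < N := Nat.cast_pos.2 hω.pos_eq
  rw [← mul_lt_mul_iff_right₀ hN, ← hωa, ← Nat.cast_mul, Nat.cast_lt]
  refine lt_of_le_of_ne (h1 d hd) fun heq => ?_
  have h3 := h2 d
  rw [if_pos heq.symm] at h3
  have h4 := (coeff_initZeroUY (u := u) (y := y) (g := f i) d).symm.trans h3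
  rw [if_neg (fun hh => hlt.ne hh.2)] at h4
  exact residue_coeff_expansion_ne_zero h hd h4.symm

theorem IsReferenceDatum.exists_bound (h : IsRSP u y) (hf : IsReferenceDatum u y J f a) :
    ∃ c : ℝ, 1 < c ∧ ∀ v ∈ polyhedron u y f, c ≤ linForm a v := by
  classical
  set T : Finset ℝ := Finset.univ.biUnion fun i => ((expansion u y (f i)).support.filter
    fun d => yDeg d < ord u y (f i)).image fun d => linForm a (slopePoint (ord u y (f i)) d) with hT
  have hT1 : ∀ t ∈ T, 1 < t := by
    intro t ht
    obtain ⟨i, -, ht⟩ := Finset.mem_biUnion.1 ht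
    obtain ⟨d, hd, rfl⟩ := Finset.mem_image.1 ht
    obtain ⟨hd1, hd2⟩ := Finset.mem_filter.1 hd
    exact (lt_linForm_slopePoint_iff hd2).2 (hf.lt_weight h (mem_support_iff.1 hd1) hd2)
  obtain ⟨c, hc1, hc⟩ : ∃ c : ℝ, 1 < c ∧ ∀ t ∈ T, c ≤ t := by
    by_cases hne : T.Nonempty
    · exact ⟨T.min' hne, hT1 _ (T.min'_mem hne), fun t ht => T.min'_le t ht⟩
    · rw [Finset.not_nonempty_iff_eq_empty] at hne
      exact ⟨2, one_lt_two, by simp [hne]⟩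
  refine ⟨c, hc1, fun v hv => (polyhedron_subset (isFSubset_halfSpace hf.positive c) ?_ hv).2⟩
  intro i d hd hlt
  refine ⟨slopePoint_nonneg hlt, hc _ ?_⟩
  exact Finset.mem_biUnion.2 ⟨i, Finset.mem_univ i, Finset.mem_image.2
    ⟨d, Finset.mem_filter.2 ⟨mem_support_iff.2 hd, hlt⟩, rfl⟩⟩

/-- A system keeps its initial forms for every linear form which is larger than `1` on its
polyhedron. -/
theorem hasInitialForms_of_lt (h : IsRSP u y)
    {b : Fin e → ℚ} (hb : IsPositive b) (hgt : ∀ v ∈ polyhedron u y f, 1 < linForm b v)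
    (hω : IsWeighting ω N)
    (hωb : ∀ d : (Fin e ⊕ Fin r) →₀ ℕ, (Finsupp.weight ω d : ℝ) = N * weight b d) :
    HasInitialForms (Sum.elim u y) ω N f (fun i => ord u y (f i))
      (fun i => initZero u y (f i)) := by
  refine ⟨fun i => initZero_isHomogeneous, fun i => (isInit_iff_coeff h hω.pos).2 ?_⟩
  have hN : (0 : ℝ) < N := Nat.cast_pos.2 hω.pos_eq
  have hlt : ∀ d, (expansion u y (f i)).coeff d ≠ 0 → ¬ (uPart d = 0 ∧ yDeg d = ord u y (f i)) →
      N * ord u y (f i) < Finsupp.weight ω d := by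
    intro d hd hne
    rw [← Nat.cast_lt (α := ℝ), hωb, Nat.cast_mul, mul_lt_mul_iff_right₀ hN]
    rcases lt_trichotomy (yDeg d) (ord u y (f i)) with hlt | heq | hgt'
    · exact (lt_linForm_slopePoint_iff hlt).1 (hgt _ (slopePoint_mem_polyhedron hd hlt))
    · have := linForm_uVec_pos hb fun h0 => hne ⟨h0, heq⟩
      rw [weight, heq]
      linarith
    · have h1 : (ord u y (f i) : ℝ) < yDeg d := Nat.cast_lt.2 hgt'
      have h2 := linForm_nonneg hb (uVec_nonneg d)
      rw [weight]
      linarith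
  refine ⟨fun d hd => ?_, fun d => ?_⟩
  · by_cases hne : uPart d = 0 ∧ yDeg d = ord u y (f i)
    · rw [weight_eq_of_uPart_eq_zero hω hne.1, hne.2]
    · exact (hlt d hd hne).le
  · refine (coeff_initZeroUY (u := u) (y := y) (g := f i) d).trans ?_
    by_cases hd : (expansion u y (f i)).coeff d = 0
    · rw [hd, map_zero, ite_self, ite_self]
    · refine if_congr ⟨fun hh => ?_, fun hh => ?_⟩ rfl rfl
      · rw [weight_eq_of_uPart_eq_zero hω hh.1, hh.2]
      · by_contra hne
        exact (hlt d hd hne).ne hh.symm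

/-- If `f` is a standard basis of `J`, then its `0`-initial forms generate the initial forms of `J`
for all linear forms which are larger than `1` on the polyhedron of `f`. -/
theorem IsReferenceDatum.initialFormsMem_of_lt (h : IsRSP u y) (hf : IsReferenceDatum u y J f a)
    {b : Fin e → ℚ} (hb : IsPositive b) (hgt : ∀ v ∈ polyhedron u y f, 1 < linForm b v)
    (hω : IsWeighting ω N)
    (hωb : ∀ d : (Fin e ⊕ Fin r) →₀ ℕ, (Finsupp.weight ω d : ℝ) = N * weight b d) :
    InitialFormsMem (Sum.elim u y) ω J (yIdeal e (fun i => initZero u y (f i)) Set.univ) := by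
  obtain ⟨ω₀, N₀, hω₀, hω₀a⟩ := exists_isWeighting (r := r) hf.positive
  exact HasInitialForms.initialFormsMem (isParameterSystem_of_isRSP h) hf.mem hω₀ hω
    (hasInitialForms_of_lt h hb hgt hω hωb) (hf.initialFormsMem h hω₀ hω₀a)

/-- The ideal of `0`-initial forms is the same for all standard bases. -/
theorem IsReferenceDatum.yIdeal_eq (h : IsRSP u y) (hf : IsReferenceDatum u y J f a) {m' : ℕ}
    {f' : Fin m' → R} {a' : Fin e → ℚ} (hf' : IsReferenceDatum u y J f' a') :
    yIdeal e (fun i => initZero u y (f i)) Set.univ =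
      yIdeal e (fun i => initZero u y (f' i)) Set.univ := by
  have hpos : IsPositive (a + a') := fun i => add_pos (hf.positive i) (hf'.positive i)
  have hlin : ∀ v : Fin e → ℝ, linForm (a + a') v = linForm a v + linForm a' v := fun v => by
    simp [linForm, add_mul, Finset.sum_add_distrib]
  obtain ⟨c, hc, hcf⟩ := hf.exists_bound h
  obtain ⟨c', hc', hcf'⟩ := hf'.exists_bound h
  have h1 : ∀ v ∈ polyhedron u y f, 1 < linForm (a + a') v := fun v hv => by
    rw [hlin]
    have h1 := hcf v hv
    have h2 := linForm_nonneg hf'.positive (isFSubset_polyhedron.nonneg v hv)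
    linarith
  have h2 : ∀ v ∈ polyhedron u y f', 1 < linForm (a + a') v := fun v hv => by
    rw [hlin]
    have h1 := hcf' v hv
    have h2 := linForm_nonneg hf.positive (isFSubset_polyhedron.nonneg v hv)
    linarith
  obtain ⟨ω, N, hω, hωa⟩ := exists_isWeighting (r := r) hpos
  apply le_antisymm
  · rw [yIdeal, Ideal.span_le]
    rintro _ ⟨j, -, rfl⟩
    exact hf'.initialFormsMem_of_lt h hpos h2 hω hωa _ (hf.mem j) _ _
      ((hasInitialForms_of_lt h hpos h1 hω hωa).isInit j)
  · rw [yIdeal, Ideal.span_le]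
    rintro _ ⟨j, -, rfl⟩
    exact hf.initialFormsMem_of_lt h hpos h1 hω hωa _ (hf'.mem j) _ _
      ((hasInitialForms_of_lt h hpos h2 hω hωa).isInit j)

/-- The comparison with an arbitrary standard basis `f'`. Let `b` be larger than `1` on the
polyhedron of `f'`, and suppose that the points of the system `g` in `J` with `b ≤ 1` come from
normalized monomials only. Then there are no such points: after scaling `b` so that its minimum on
the points of `g` is `1`, the initial form of some `g i` involves monomials of `Y`-degree less than
`ord (f i)`, and as it belongs to the ideal of the `0`-initial forms, one of them is not
normalized. -/
theorem IsReferenceDatum.lt_weight_of_normalized (h : IsRSP u y)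
    (hf : IsReferenceDatum u y J f a) {m' : ℕ} {f' : Fin m' → R} {a' : Fin e → ℚ}
    (hf' : IsReferenceDatum u y J f' a') {g : Fin m → R} (hg : ∀ i, g i ∈ J)
    (hga : ∀ i d, (expansion u y (g i)).coeff d ≠ 0 → (ord u y (f i) : ℝ) ≤ weight a d)
    {b : Fin e → ℚ} (hb : IsPositive b) (hgt : ∀ v ∈ polyhedron u y f', 1 < linForm b v)
    (hnorm : ∀ i d, (expansion u y (g i)).coeff d ≠ 0 → yDeg d < ord u y (f i) →
      weight b d ≤ ord u y (f i) →
        yPart d ∉ exponents (yIdeal e (fun i => initZero u y (f i)) {j | j < i}))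
    (i : Fin m) (d : (Fin e ⊕ Fin r) →₀ ℕ) (hd : (expansion u y (g i)).coeff d ≠ 0)
    (hlt : yDeg d < ord u y (f i)) : (ord u y (f i) : ℝ) < weight b d := by
  classical
  by_contra hcon
  rw [not_lt] at hcon
  set T : Finset (Fin m × ((Fin e ⊕ Fin r) →₀ ℕ)) := Finset.univ.biUnion fun i =>
    ((expansion u y (g i)).support.filter fun d => yDeg d < ord u y (f i)).image fun d => (i, d)
    with hT
  have hTmem : ∀ p : Fin m × ((Fin e ⊕ Fin r) →₀ ℕ), p ∈ T ↔
      (expansion u y (g p.1)).coeff p.2 ≠ 0 ∧ yDeg p.2 < ord u y (f p.1) := by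
    rintro ⟨i, d⟩
    simp [hT]
  obtain ⟨⟨i₀, d₀⟩, hp₀, hmin⟩ := Finset.exists_min_image T
    (fun p => linForm b (slopePoint (ord u y (f p.1)) p.2)) ⟨(i, d), (hTmem _).2 ⟨hd, hlt⟩⟩
  obtain ⟨hd₀, hlt₀⟩ := (hTmem _).1 hp₀
  dsimp only at hd₀ hlt₀ hmin
  -- `μ` is the minimum of `b` on the points of `g`, and `b'` is `b` scaled by it
  set μ : ℚ := (∑ k, b k * (uPart d₀ k : ℚ)) / ((ord u y (f i₀) : ℚ) - yDeg d₀) with hμ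
  have hμr : (μ : ℝ) = linForm b (slopePoint (ord u y (f i₀)) d₀) := by
    rw [linForm_slopePoint, hμ, linForm]
    push_cast
    rfl
  have hu₀ : uPart d₀ ≠ 0 := by
    intro h0
    have h1 := hga i₀ d₀ hd₀
    have h2 : linForm a (uVec d₀) = 0 := by
      simp [linForm, uVec, h0]
    rw [weight, h2, zero_add, Nat.cast_le] at h1
    omega
  have hμ0 : 0 < μ := by
    have : (0 : ℝ) < μ := by
      rw [hμr, linForm_slopePoint]
      exact div_pos (linForm_uVec_pos hb hu₀) (sub_pos.2 (Nat.cast_lt.2 hlt₀))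
    exact_mod_cast this
  have hμ1 : (μ : ℝ) ≤ 1 := by
    rw [hμr]
    exact (hmin (i, d) ((hTmem _).2 ⟨hd, hlt⟩)).trans ((linForm_slopePoint_le_iff hlt).2 hcon)
  have hμr0 : (0 : ℝ) < μ := by exact_mod_cast hμ0
  set b' : Fin e → ℚ := fun k => b k / μ with hb'
  have hb'pos : IsPositive b' := fun k => div_pos (hb k) hμ0
  have hb'lin : ∀ v, linForm b' v = linForm b v / μ := fun v => by
    simp only [linForm, hb', Finset.sum_div]
    exact Finset.sum_congr rfl fun k _ => by push_cast; ring
  have hble : ∀ v : Fin e → ℝ, (∀ k, 0 ≤ v k) → linForm b v ≤ linForm b' v := fun v hv => by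
    rw [hb'lin, le_div_iff₀ hμr0]
    exact mul_le_of_le_one_right (linForm_nonneg hb hv) hμ1
  obtain ⟨ω, N, hω, hωb⟩ := exists_isWeighting (r := r) hb'pos
  have hN : (0 : ℝ) < N := Nat.cast_pos.2 hω.pos_eq
  have hInit := hf'.initialFormsMem_of_lt h hb'pos
    (fun v hv => (hgt v hv).trans_le (hble v (isFSubset_polyhedron.nonneg v hv))) hω hωb
  rw [← hf.yIdeal_eq h hf'] at hInit
  have hge : ∀ d, (expansion u y (g i₀)).coeff d ≠ 0 → N * ord u y (f i₀) ≤ Finsupp.weight ω d := by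
    intro d hd
    rw [← Nat.cast_le (α := ℝ), hωb, Nat.cast_mul, mul_le_mul_iff_right₀ hN]
    rcases lt_or_ge (yDeg d) (ord u y (f i₀)) with hlt | hge
    · have h1 := hmin (i₀, d) ((hTmem _).2 ⟨hd, hlt⟩)
      rw [← hμr] at h1
      have h2 : (0 : ℝ) < (ord u y (f i₀) : ℝ) - yDeg d := sub_pos.2 (Nat.cast_lt.2 hlt)
      dsimp only at h1
      rw [linForm_slopePoint, le_div_iff₀ h2] at h1
      have h3 : (ord u y (f i₀) : ℝ) - yDeg d ≤ linForm b' (uVec d) := by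
        rw [hb'lin, le_div_iff₀ hμr0, mul_comm]
        exact h1
      rw [weight]
      linarith
    · have h1 : (ord u y (f i₀) : ℝ) ≤ yDeg d := Nat.cast_le.2 hge
      have h2 := linForm_nonneg hb'pos (uVec_nonneg d)
      rw [weight]
      linarith
  have heq : Finsupp.weight ω d₀ = N * ord u y (f i₀) := by
    rw [← Nat.cast_inj (R := ℝ), hωb, Nat.cast_mul]
    congr 1
    have h2 : (0 : ℝ) < (ord u y (f i₀) : ℝ) - yDeg d₀ := sub_pos.2 (Nat.cast_lt.2 hlt₀)
    have h3 : linForm b (uVec d₀) = μ * ((ord u y (f i₀) : ℝ) - yDeg d₀) := by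
      rw [hμr, linForm_slopePoint, div_mul_cancel₀ _ h2.ne']
    rw [weight, hb'lin, h3, mul_div_cancel_left₀ _ hμr0.ne']
    ring
  obtain ⟨Q, hQ⟩ := exists_isInit ((mem_monoIdeal_iff_expansion h
    (isUpperSet_weight_ge (ω := ω) (N * ord u y (f i₀)))).2 hge)
  -- the coefficient of `U ^ A`, `A = uPart d₀`, in the initial form of `g i₀` is a non-zero element
  -- of the ideal of the `0`-initial forms in `K[Y]`
  have hQmem := hInit _ (hg i₀) _ _ hQ
  have hQc := ((isInit_iff_coeff h hω.pos).1 hQ).2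
  have hne : uCoeff (uPart d₀) Q ≠ 0 := by
    intro h0
    have : coeff (yPart d₀) (uCoeff (uPart d₀) Q) = 0 := by rw [h0, coeff_zero]
    rw [coeff_uCoeff, pairExp_parts, hQc, if_pos heq] at this
    exact residue_coeff_expansion_ne_zero h hd₀ this
  obtain ⟨B, hB, hBe⟩ := exists_mem_exponents (e := e) (uCoeff_mem_of_mem_yIdeal hQmem _) hne
  rw [coeff_uCoeff, hQc] at hB
  split_ifs at hB with hw
  · have hc : (expansion u y (g i₀)).coeff (pairExp (uPart d₀) B) ≠ 0 := fun hh =>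
      hB (by rw [hh, map_zero])
    have hdeg : B.degree = yDeg d₀ := by
      have h1 : Finsupp.weight ω (pairExp (uPart d₀) B) =
          Finsupp.weight ω (pairExp (uPart d₀) (yPart d₀)) := by rw [hw, pairExp_parts, heq]
      rw [weight_pairExp hω.eq, weight_pairExp hω.eq (uPart d₀) (yPart d₀)] at h1
      exact Nat.eq_of_mul_eq_mul_left hω.pos_eq (Nat.add_left_cancel h1)
    have hyd : yDeg (pairExp (uPart d₀) B) = B.degree := by rw [yDeg, yPart_pairExp]
    refine hnorm i₀ _ hc (by rw [hyd, hdeg]; exact hlt₀) ?_ ?_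
    · have h1 : weight b' (pairExp (uPart d₀) B) = ord u y (f i₀) := by
        have := hωb (pairExp (uPart d₀) B)
        rw [hw, Nat.cast_mul] at this
        exact (mul_left_cancel₀ hN.ne' this).symm
      rw [← h1, weight, weight]
      have := hble (uVec (pairExp (uPart d₀) B)) (uVec_nonneg _)
      linarith
    · rw [yPart_pairExp]
      exact mem_exponents_of_degree_lt (fun j => initZero_isHomogeneous)
        (fun i j hij => hf.ord_mono i j hij) hBe (by rw [hdeg]; exact hlt₀)
  · exact hB rfl

end ReferenceData

/-! ### Separation of points from `F`-subsets -/

section Separation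

variable {e : ℕ}

theorem linForm_div (a : Fin e → ℚ) (c : ℚ) (v : Fin e → ℝ) :
    linForm (fun i => a i / c) v = linForm a v / c := by
  simp only [linForm, Finset.sum_div]
  exact Finset.sum_congr rfl fun i _ => by push_cast; ring

/-- A point of the orthant outside of an `F`-subset is separated from it by a positive rational
linear form. -/
theorem IsFSubset.exists_linForm_lt {D : Set (Fin e → ℝ)} (hD : IsFSubset D) {p : Fin e → ℝ}
    (hp : ∀ i, 0 ≤ p i) (hpD : p ∉ D) :
    ∃ b : Fin e → ℚ, IsPositive b ∧ linForm b p < 1 ∧ ∀ v ∈ D, 1 < linForm b v := by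
  have hsum : 0 ≤ ∑ i, p i := Finset.sum_nonneg fun i _ => hp i
  rcases D.eq_empty_or_nonempty with rfl | ⟨v₀, hv₀⟩
  · obtain ⟨k, hk⟩ := exists_nat_gt (∑ i, p i)
    have hk0 : (0 : ℝ) < k := hsum.trans_lt hk
    have hk0' : (0 : ℚ) < k := by exact_mod_cast hk0
    refine ⟨fun _ => 1 / k, fun i => by positivity, ?_, by simp⟩
    rw [linForm_div, Rat.cast_natCast, div_lt_one hk0]
    simpa [linForm] using hk
  · obtain ⟨l, c, hlp, hlD⟩ := geometric_hahn_banach_point_closed hD.convex hD.closed hpD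
    set q : Fin e → ℝ := fun i => l (Pi.single i 1) with hq
    have hl : ∀ v, l v = ∑ i, q i * v i := fun v => by
      conv_lhs => rw [← Finset.univ_sum_single v, map_sum]
      refine Finset.sum_congr rfl fun i _ => ?_
      have : (Pi.single i (v i) : Fin e → ℝ) = v i • Pi.single i 1 := by
        rw [← Pi.single_smul, smul_eq_mul, mul_one]
      rw [this, map_smul, smul_eq_mul, mul_comm]
    -- `l` has non-negative coefficients, since `D` contains `v₀ + s • e_i` for all `s ≥ 0`
    have hq0 : ∀ i, 0 ≤ q i := by
      intro i
      by_contra! hneg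
      have hs : 0 ≤ (l v₀ - c) / -q i :=
        div_nonneg (sub_nonneg.2 (hlD v₀ hv₀).le) (neg_nonneg.2 hneg.le)
      have := hlD _ (hD.add_mem v₀ hv₀ (((l v₀ - c) / -q i) • Pi.single i 1) fun j => by
        rw [Pi.smul_apply, smul_eq_mul]
        exact mul_nonneg hs ((Pi.single_nonneg.2 zero_le_one : (0 : Fin e → ℝ) ≤ Pi.single i 1) j))
      rw [map_add, map_smul, smul_eq_mul, (rfl : l (Pi.single i 1) = q i),
        div_neg, neg_mul, div_mul_cancel₀ _ hneg.ne] at this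
      linarith
    set δ : ℝ := (c - l p) / (1 + ∑ i, p i) with hδ
    have hδ0 : 0 < δ := div_pos (sub_pos.2 hlp) (by linarith)
    have hδp : δ * ∑ i, p i < c - l p := by
      rw [hδ, div_mul_eq_mul_div, div_lt_iff₀ (by linarith)]
      nlinarith
    choose a ha₁ ha₂ using fun i => exists_rat_btwn (lt_add_of_pos_right (q i) hδ0)
    have hapos : IsPositive a := fun i => by exact_mod_cast (hq0 i).trans_lt (ha₁ i)
    have hap : linForm a p < c := by
      have : linForm a p ≤ ∑ i, (q i * p i + δ * p i) := Finset.sum_le_sum fun i _ => by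
        rw [← add_mul]
        exact mul_le_mul_of_nonneg_right (ha₂ i).le (hp i)
      rw [Finset.sum_add_distrib, ← hl, ← Finset.mul_sum] at this
      linarith
    obtain ⟨c', hc'₁, hc'₂⟩ := exists_rat_btwn hap
    have hc' : (0 : ℝ) < c' := (linForm_nonneg hapos hp).trans_lt hc'₁
    refine ⟨fun i => a i / c', fun i => div_pos (hapos i) (by exact_mod_cast hc'), ?_,
      fun v hv => ?_⟩
    · rwa [linForm_div, div_lt_one hc']
    · rw [linForm_div, one_lt_div hc']
      refine hc'₂.trans ((hlD v hv).trans_le ?_)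
      rw [hl]
      exact Finset.sum_le_sum fun i _ =>
        mul_le_mul_of_nonneg_right (ha₁ i).le (hD.nonneg v hv i)

end Separation

/-! ### Monomials which are normalized with respect to a polyhedron -/

section NormalizedExponents

variable {e r : ℕ}

/-- The exponents `(A, B)` which are allowed in an element of order `n` if its points are to lie
in `D` and if the `B ∈ X` with `|B| ≤ n` are excluded. -/
def normalizedSet (n : ℕ) (D : Set (Fin e → ℝ)) (X : Set (Fin r →₀ ℕ)) :
    Set ((Fin e ⊕ Fin r) →₀ ℕ) :=
  {d | (yDeg d ≤ n → yPart d ∉ X) ∧ (yDeg d < n → slopePoint n d ∈ D)}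

variable {n : ℕ} {D : Set (Fin e → ℝ)} {X : Set (Fin r →₀ ℕ)} {d d' : (Fin e ⊕ Fin r) →₀ ℕ}

theorem uPart_le (h : d' ≤ d) : uPart d' ≤ uPart d := fun i => h (Sum.inl i)

theorem yDeg_le (h : d' ≤ d) : yDeg d' ≤ yDeg d := by
  rw [yDeg_eq_sum, yDeg_eq_sum]
  exact Finset.sum_le_sum fun j _ => h (Sum.inr j)

theorem yPart_eq_of_le (h : d' ≤ d) (hdeg : yDeg d' = yDeg d) : yPart d' = yPart d := by
  rw [yDeg_eq_sum, yDeg_eq_sum] at hdeg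
  ext j
  exact (Finset.sum_eq_sum_iff_of_le fun j _ => h (Sum.inr j)).1 hdeg j (Finset.mem_univ j)

theorem slopePoint_mono (h : d' ≤ d) (hd : yDeg d < n) (i : Fin e) :
    slopePoint n d' i ≤ slopePoint n d i := by
  have h1 : (yDeg d' : ℝ) ≤ yDeg d := Nat.cast_le.2 (yDeg_le h)
  have h2 : (yDeg d : ℝ) < n := Nat.cast_lt.2 hd
  exact div_le_div₀ (uVec_nonneg d i) (Nat.cast_le.2 (uPart_le h i)) (by linarith) (by linarith)

/-- Multiples of allowed monomials still have their points in `D`. -/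
theorem slopePoint_mem_of_mem_upperClosure (hD : IsFSubset D)
    (hd : d ∈ upperClosure (normalizedSet n D X)) (hlt : yDeg d < n) : slopePoint n d ∈ D := by
  obtain ⟨d', hd', hle⟩ := hd
  have := hD.add_mem _ (hd'.2 ((yDeg_le hle).trans_lt hlt)) (slopePoint n d - slopePoint n d')
    fun i => sub_nonneg.2 (slopePoint_mono hle hlt i)
  rwa [add_sub_cancel] at this

/-- At the vertices of `D` the excluded monomials are not divisible by allowed ones: the point of a
proper divisor `U^A' Y^B'` is smaller, so it is the same vertex, and as `A ≠ 0` this forces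
`|B'| = |B|`. -/
theorem yPart_notMem_of_isVertex (hd : d ∈ upperClosure (normalizedSet n D X)) (hlt : yDeg d < n)
    (hv : IsVertex D (slopePoint n d)) : yPart d ∉ X := by
  obtain ⟨d', hd', hle⟩ := hd
  obtain ⟨a, ha, ha1, hav⟩ := hv
  have hlt' := (yDeg_le hle).trans_lt hlt
  have hmem : slopePoint n d ∈ {w ∈ D | linForm a w = 1} := hav ▸ Set.mem_singleton _
  have heq : slopePoint n d' = slopePoint n d := by
    have h1 := hd'.2 hlt'
    have h2 : linForm a (slopePoint n d') ≤ linForm a (slopePoint n d) :=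
      Finset.sum_le_sum fun i _ => mul_le_mul_of_nonneg_left (slopePoint_mono hle hlt i)
        (by exact_mod_cast (ha i).le)
    have h3 : slopePoint n d' ∈ {w ∈ D | linForm a w = 1} :=
      ⟨h1, le_antisymm (h2.trans_eq hmem.2) (ha1 _ h1)⟩
    rw [hav] at h3
    exact h3
  obtain ⟨i, hi⟩ : ∃ i, 0 < uVec d i := by
    by_contra! hcon
    have : linForm a (slopePoint n d) = 0 := Finset.sum_eq_zero fun i _ => by
      rw [slopePoint, le_antisymm (hcon i) (uVec_nonneg d i), zero_div, mul_zero]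
    rw [hmem.2] at this
    exact one_ne_zero this
  have hdeg : yDeg d' = yDeg d := by
    have h1 : (yDeg d' : ℝ) ≤ yDeg d := Nat.cast_le.2 (yDeg_le hle)
    have h2 : (yDeg d : ℝ) < n := Nat.cast_lt.2 hlt
    have h3 : uVec d' i ≤ uVec d i := Nat.cast_le.2 (uPart_le hle i)
    have h4 := congrFun heq i
    rw [slopePoint, slopePoint, div_eq_div_iff (by linarith) (by linarith)] at h4
    have h5 : (yDeg d : ℝ) ≤ yDeg d' := by
      by_contra! hcon
      nlinarith [mul_le_mul_of_nonneg_right h3 (by linarith : (0:ℝ) ≤ n - yDeg d),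
        mul_lt_mul_of_pos_left (by linarith : (n:ℝ) - yDeg d < n - yDeg d') hi]
    exact le_antisymm (yDeg_le hle) (by exact_mod_cast h5)
  rw [← yPart_eq_of_le hle hdeg]
  exact hd'.1 hlt'.le

/-- The same holds for the monomials of degree `n` in `Y`, as the point of a divisor of degree less
than `n` is `0`. -/
theorem yPart_notMem_of_uPart_eq_zero (h0 : (0 : Fin e → ℝ) ∉ D)
    (hd : d ∈ upperClosure (normalizedSet n D X)) (heq : yDeg d = n) (hu : uPart d = 0) :
    yPart d ∉ X := by
  obtain ⟨d', hd', hle⟩ := hd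
  have hdeg : yDeg d' = yDeg d := by
    refine le_antisymm (yDeg_le hle) ?_
    by_contra! hlt
    refine h0 ?_
    have := hd'.2 (heq ▸ hlt)
    have h2 : slopePoint n d' = 0 := funext fun i => by
      have : uPart d' i ≤ 0 := (uPart_le hle i).trans_eq (DFunLike.congr_fun hu i)
      rw [slopePoint, uVec, Nat.le_zero.1 this, Nat.cast_zero, zero_div, Pi.zero_apply]
    rwa [h2] at this
  rw [← yPart_eq_of_le hle hdeg]
  exact hd'.1 (hdeg.trans heq).le

theorem yPart_notMem_of_eq_empty (h0 : D = ∅) (hd : d ∈ upperClosure (normalizedSet n D X))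
    (hdeg : yDeg d ≤ n) : yPart d ∉ X := by
  obtain ⟨d', hd', hle⟩ := hd
  have hn : n ≤ yDeg d' := by
    by_contra! hlt
    have := hd'.2 hlt
    rw [h0] at this
    exact this
  rw [← yPart_eq_of_le hle (le_antisymm (yDeg_le hle) (hdeg.trans hn))]
  exact hd'.1 ((yDeg_le hle).trans hdeg)

end NormalizedExponents

/-! ### Existence of normalized elements -/

section Normalization

open IsLocalRing MvPolynomial

/-- An approximation of `g` modulo `Q` by combinations of the `f j`, with coefficients in given
ideals, up to all powers of the maximal ideal gives an exact one, by Krull's intersection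
theorem. -/
theorem exists_sub_sum_mem {R : Type*} [CommRing R] [IsNoetherianRing R] [IsLocalRing R] {m : ℕ}
    {f : Fin m → R} (I : Fin m → Ideal R) (Q : Ideal R) {g : R}
    (h : ∀ k, ∃ c : Fin m → R, (∀ j, c j ∈ I j) ∧
      g - ∑ j, c j * f j ∈ Q ⊔ maximalIdeal R ^ k) :
    ∃ c : Fin m → R, (∀ j, c j ∈ I j) ∧ g - ∑ j, c j * f j ∈ Q := by
  set 𝔞 : Ideal R :=
    { carrier := {z | ∃ c : Fin m → R, (∀ j, c j ∈ I j) ∧ ∑ j, c j * f j = z}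
      zero_mem' := ⟨0, fun j => zero_mem _, by simp⟩
      add_mem' := by
        rintro _ _ ⟨c, hc, rfl⟩ ⟨c', hc', rfl⟩
        exact ⟨c + c', fun j => add_mem (hc j) (hc' j), by
          simp [add_mul, Finset.sum_add_distrib]⟩
      smul_mem' := by
        rintro b _ ⟨c, hc, rfl⟩
        exact ⟨fun j => b * c j, fun j => Ideal.mul_mem_left _ _ (hc j), by
          simp [Finset.mul_sum, mul_assoc]⟩ } with h𝔞
  have hg : g ∈ 𝔞 ⊔ Q := mem_of_forall_mem_sup_pow _ fun k => by
    obtain ⟨c, hc, hgc⟩ := h k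
    rw [sup_assoc]
    exact Submodule.mem_sup.2 ⟨_, ⟨c, hc, rfl⟩, _, hgc, add_sub_cancel _ _⟩
  obtain ⟨_, ⟨c, hc, rfl⟩, q, hq, hsum⟩ := Submodule.mem_sup.1 hg
  refine ⟨c, hc, ?_⟩
  rwa [← hsum, add_sub_cancel_left]

variable {R : Type*} [CommRing R] [IsLocalRing R] {e r m : ℕ} {u : Fin e → R} {y : Fin r → R}
  {f : Fin m → R} {J : Ideal R} {a : Fin e → ℚ}

/-- The polyhedron of an ideal which has a standard basis is an `F`-subset. -/
theorem IsReferenceDatum.isFSubset_polyhedronIdeal (hf : IsReferenceDatum u y J f a) :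
    IsFSubset (polyhedronIdeal u y J) := by
  refine isFSubset_sInter ⟨_, m, f, ⟨a, hf⟩, rfl⟩ ?_
  rintro _ ⟨m', f', -, rfl⟩
  exact isFSubset_polyhedron

theorem IsReferenceDatum.polyhedronIdeal_subset (hf : IsReferenceDatum u y J f a) :
    polyhedronIdeal u y J ⊆ polyhedron u y f :=
  Set.sInter_subset_of_mem ⟨m, f, ⟨a, hf⟩, rfl⟩

variable [IsNoetherianRing R]

/-- A polynomial expression of `g` with unit coefficients modulo a monomial ideal involves all the
monomials of the expansion of `g` outside of this ideal. -/
theorem coeff_ne_zero_of_sub_eval_mem (h : IsRSP u y) {E : Set ((Fin e ⊕ Fin r) →₀ ℕ)}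
    (hE : IsUpperSet E) {g : R} {P : MvPolynomial (Fin e ⊕ Fin r) R}
    (hP : ∀ d, coeff d P ≠ 0 → IsUnit (coeff d P))
    (hg : g - eval (Sum.elim u y) P ∈ monoIdeal (Sum.elim u y) E) {d : (Fin e ⊕ Fin r) →₀ ℕ}
    (hd : (expansion u y g).coeff d ≠ 0) (hdE : d ∉ E) : coeff d P ≠ 0 := by
  intro h0
  have hexp := isExpansion_expansion h g
  rw [← hexp.eval_eq, ← map_sub] at hg
  set D := expansion u y g - P with hD
  have hdD : d ∈ {d' | coeff d' D ≠ 0 ∧ d' ≤ d} :=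
    ⟨by rw [hD, coeff_sub, h0, sub_zero]; exact hd, le_rfl⟩
  obtain ⟨d', ⟨hd'D, hd'd⟩, hmin⟩ := wellFounded_lt.has_min _ ⟨d, hdD⟩
  have hmem := coeff_mem_of_eval_mem_monoIdeal (isParameterSystem_of_isRSP h) hE hg
    (fun hh => hdE (hE hd'd hh)) fun d'' h1 h2 =>
      (eq_or_lt_of_le h2).resolve_right (hmin d'' ⟨h1, h2.trans hd'd⟩)
  refine (mem_maximalIdeal _).1 hmem ?_
  by_cases hdd : d' = d
  · rw [hdd, hD, coeff_sub, h0, sub_zero]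
    exact hexp.isUnit_coeff d hd
  · have h1 : (expansion u y g).coeff d' = 0 := by
      by_contra hne
      exact hdd (hexp.antichain.eq (mem_support_iff.2 hne) (mem_support_iff.2 hd) hd'd)
    rw [hD, coeff_sub, h1, zero_sub] at hd'D ⊢
    exact (hP d' (neg_ne_zero.1 hd'D)).neg

variable {ω : Fin e ⊕ Fin r → ℕ} {N : ℕ}

/-- Division of all the `f i` by their predecessors up to weight `t`. -/
theorem IsReferenceDatum.exists_truncation (h : IsRSP u y) (hf : IsReferenceDatum u y J f a)
    (hω : IsWeighting ω N)
    (hωa : ∀ d : (Fin e ⊕ Fin r) →₀ ℕ, (Finsupp.weight ω d : ℝ) = N * weight a d) (t : ℕ) :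
    ∃ c : Fin m → Fin m → R, (∀ i j, ¬ j < i → c i j = 0) ∧
      (∀ i j, c i j ∈ wIdeal (Sum.elim u y) ω (N * ord u y (f i) - N * ord u y (f j))) ∧
      ∀ i d, (expansion u y (f i - ∑ j, c i j * f j)).coeff d ≠ 0 →
        N * ord u y (f i) ≤ Finsupp.weight ω d ∧
        (Finsupp.weight ω d < N * ord u y (f i) + t →
          yPart d ∉ exponents (yIdeal e (fun i => initZero u y (f i)) {j | j < i})) := by
  have hI := hf.hasInitialForms h hω hωa
  choose c P hc hcw hP hfP using fun i => hI.exists_division (isParameterSystem_of_isRSP h) hω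
    {j | j < i} (hI.isInit i).mem t
  refine ⟨c, hc, hcw, fun i d hd => ⟨?_, fun hlt => ?_⟩⟩
  · have h1 := Ideal.add_mem _ (wIdeal_antitone (Nat.le_add_right _ t) (hfP i))
      (eval_mem_monoIdeal fun d hd => (hP i d hd).2.1 :
        eval (Sum.elim u y) (P i) ∈ wIdeal (Sum.elim u y) ω (N * ord u y (f i)))
    rw [sub_add_cancel] at h1
    exact (mem_monoIdeal_iff_expansion h (isUpperSet_weight_ge _)).1 h1 d hd
  · exact (hP i d (coeff_ne_zero_of_sub_eval_mem h (isUpperSet_weight_ge _)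
      (fun d hd => (hP i d hd).1) (hfP i) hd (not_le.2 hlt))).2.2.2

/-- The points outside of the polyhedron of `J` disappear from the division of the `f i` by their
predecessors up to a sufficiently large weight. -/
theorem IsReferenceDatum.exists_forall_coeff_eq_zero (h : IsRSP u y)
    (hf : IsReferenceDatum u y J f a) (hω : IsWeighting ω N)
    (hωa : ∀ d : (Fin e ⊕ Fin r) →₀ ℕ, (Finsupp.weight ω d : ℝ) = N * weight a d)
    (i : Fin m) (d : (Fin e ⊕ Fin r) →₀ ℕ) (hlt : yDeg d < ord u y (f i))
    (hd : slopePoint (ord u y (f i)) d ∉ polyhedronIdeal u y J) :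
    ∃ t₀ : ℕ, ∀ t ≥ t₀, ∀ g : Fin m → R, (∀ i, g i ∈ J) →
      (∀ i d, (expansion u y (g i)).coeff d ≠ 0 → N * ord u y (f i) ≤ Finsupp.weight ω d ∧
        (Finsupp.weight ω d < N * ord u y (f i) + t →
          yPart d ∉ exponents (yIdeal e (fun i => initZero u y (f i)) {j | j < i}))) →
      (expansion u y (g i)).coeff d = 0 := by
  obtain ⟨_, ⟨m', f', ⟨a', hf'⟩, rfl⟩, hd'⟩ : ∃ D ∈ {D | ∃ (m : ℕ) (f : Fin m → R),
      IsStandardBasis u y J f ∧ D = polyhedron u y f}, slopePoint (ord u y (f i)) d ∉ D := by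
    by_contra! hcon
    exact hd hcon
  obtain ⟨b, hb, hbd, hbf'⟩ := isFSubset_polyhedron.exists_linForm_lt (slopePoint_nonneg hlt) hd'
  obtain ⟨ω', N', hω', hω'b⟩ := exists_isWeighting (r := r) hb
  have hN : (0 : ℝ) < N := Nat.cast_pos.2 hω.pos_eq
  -- the monomials with `b`-weight at most `ord (f i)` have bounded `ω`-weight
  refine ⟨(∑ l, ω l) * (N' * ∑ i, ord u y (f i)) + 1, fun t ht g hg hgw => ?_⟩
  by_contra hne
  have := hf.lt_weight_of_normalized h hf' hg (fun i d hd => ?_) hb hbf'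
    (fun i d hd _ hle => (hgw i d hd).2 ?_) i d hne hlt
  · exact this.not_ge ((linForm_slopePoint_le_iff hlt).1 hbd.le)
  · rw [← mul_le_mul_iff_right₀ hN, ← hωa]
    exact_mod_cast (hgw i d hd).1
  · have h1 : Finsupp.weight ω' d ≤ N' * ord u y (f i) := by
      rw [← Nat.cast_le (α := ℝ), hω'b, Nat.cast_mul]
      exact mul_le_mul_of_nonneg_left hle (Nat.cast_nonneg _)
    have h2 : d.degree ≤ N' * ∑ i, ord u y (f i) :=
      (degree_le_weight hω'.pos d).trans (h1.trans (Nat.mul_le_mul_left _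
        (Finset.single_le_sum (f := fun i => ord u y (f i)) (fun _ _ => Nat.zero_le _)
          (Finset.mem_univ i))))
    have h3 := (weight_le_mul_degree ω d).trans (Nat.mul_le_mul_left _ h2)
    omega

/-- The subtraction of multiples of its predecessors makes `f i` normalized, and removes its points
outside of the polyhedron of `J`. -/
theorem IsReferenceDatum.exists_normalized (h : IsRSP u y) (hf : IsReferenceDatum u y J f a)
    (hω : IsWeighting ω N)
    (hωa : ∀ d : (Fin e ⊕ Fin r) →₀ ℕ, (Finsupp.weight ω d : ℝ) = N * weight a d) (i : Fin m) :
    ∃ c : Fin m → R, (∀ j, ¬ j < i → c j = 0) ∧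
      (∀ j, c j ∈ wIdeal (Sum.elim u y) ω (N * ord u y (f i) - N * ord u y (f j))) ∧
      ∀ d, (expansion u y (f i - ∑ j, c j * f j)).coeff d ≠ 0 →
        d ∈ upperClosure (normalizedSet (ord u y (f i)) (polyhedronIdeal u y J)
          (exponents (yIdeal e (fun i => initZero u y (f i)) {j | j < i}))) := by
  classical
  set E : Set ((Fin e ⊕ Fin r) →₀ ℕ) := normalizedSet (ord u y (f i)) (polyhedronIdeal u y J)
    (exponents (yIdeal e (fun i => initZero u y (f i)) {j | j < i})) with hE
  set I : Fin m → Ideal R := fun j => if j < i then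
    wIdeal (Sum.elim u y) ω (N * ord u y (f i) - N * ord u y (f j)) else ⊥ with hI
  have key : ∀ k, ∃ c : Fin m → R, (∀ j, c j ∈ I j) ∧ f i - ∑ j, c j * f j ∈
      monoIdeal (Sum.elim u y) (upperClosure E : Set ((Fin e ⊕ Fin r) →₀ ℕ)) ⊔
        maximalIdeal R ^ k := by
    intro k
    -- only the finitely many monomials of degree less than `k` matter modulo `M ^ k`; the weight
    -- `t` of the division is chosen with respect to all of them
    have hfin : {d : (Fin e ⊕ Fin r) →₀ ℕ | d.degree < k}.Finite :=
      Finsupp.finite_of_degree_lt k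
    have ht₀ : ∀ d : (Fin e ⊕ Fin r) →₀ ℕ, ∃ t₀ : ℕ, yDeg d < ord u y (f i) →
        slopePoint (ord u y (f i)) d ∉ polyhedronIdeal u y J →
        ∀ t ≥ t₀, ∀ g : Fin m → R, (∀ i, g i ∈ J) →
        (∀ i d, (expansion u y (g i)).coeff d ≠ 0 → N * ord u y (f i) ≤ Finsupp.weight ω d ∧
          (Finsupp.weight ω d < N * ord u y (f i) + t →
            yPart d ∉ exponents (yIdeal e (fun i => initZero u y (f i)) {j | j < i}))) →
        (expansion u y (g i)).coeff d = 0 := fun d => by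
      by_cases hlt : yDeg d < ord u y (f i)
      · by_cases hd : slopePoint (ord u y (f i)) d ∈ polyhedronIdeal u y J
        · exact ⟨0, fun _ hd' => absurd hd hd'⟩
        · obtain ⟨t₀, ht₀⟩ := hf.exists_forall_coeff_eq_zero h hω hωa i d hlt hd
          exact ⟨t₀, fun _ _ => ht₀⟩
      · exact ⟨0, fun hlt' => absurd hlt' hlt⟩
    choose t₀ ht₀ using ht₀
    obtain ⟨c, hc0, hcw, hc⟩ := hf.exists_truncation h hω hωa
      (∑ d ∈ hfin.toFinset, t₀ d + (∑ l, ω l) * k + 1)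
    set t := ∑ d ∈ hfin.toFinset, t₀ d + (∑ l, ω l) * k + 1 with ht
    have hJ : ∀ i, f i - ∑ j, c i j * f j ∈ J := fun i =>
      Ideal.sub_mem _ (hf.mem i) (Ideal.sum_mem _ fun j _ => Ideal.mul_mem_left _ _ (hf.mem j))
    refine ⟨c i, fun j => ?_, ?_⟩
    · rw [hI]
      dsimp only
      split_ifs with hj
      · exact hcw i j
      · exact (Ideal.mem_bot).2 (hc0 i j hj)
    · have hsup : monoIdeal (Sum.elim u y) ((upperClosure E : Set ((Fin e ⊕ Fin r) →₀ ℕ)) ∪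
          {d | k ≤ d.degree}) ≤ monoIdeal (Sum.elim u y) (upperClosure E) ⊔ maximalIdeal R ^ k := by
        rw [← (isParameterSystem_of_isRSP h).span_eq, span_range_pow_eq_monoIdeal, monoIdeal,
          Set.image_union, Ideal.span_union]
        rfl
      refine hsup ((mem_monoIdeal_iff_expansion h ?_).2 fun d hd => ?_)
      · exact (upperClosure E).upper.union fun d d' hle (hd : k ≤ d.degree) =>
          hd.trans (Finsupp.degree_mono hle)
      · by_cases hk : k ≤ d.degree
        · exact Or.inr hk
        · have hwd : Finsupp.weight ω d < N * ord u y (f i) + t := by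
            have := (weight_le_mul_degree ω d).trans (Nat.mul_le_mul_left _ (not_le.1 hk).le)
            omega
          refine Or.inl (subset_upperClosure ⟨fun _ => (hc i d hd).2 hwd, fun hlt => ?_⟩)
          by_contra hdJ
          refine hd (ht₀ d hlt hdJ t ?_ (fun i => f i - ∑ j, c i j * f j) hJ hc)
          have := Finset.single_le_sum (f := t₀) (fun _ _ => Nat.zero_le _)
            (hfin.mem_toFinset.2 (not_le.1 hk))
          omega
  obtain ⟨c, hcI, hc⟩ := exists_sub_sum_mem I _ key
  have hc0 : ∀ j, ¬ j < i → c j = 0 := fun j hj => by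
    have := hcI j
    simpa only [hI, if_neg hj, Ideal.mem_bot] using this
  refine ⟨c, hc0, fun j => ?_, fun d hd =>
    (mem_monoIdeal_iff_expansion h (upperClosure E).upper).1 hc d hd⟩
  by_cases hj : j < i
  · have := hcI j
    simpa only [hI, if_pos hj] using this
  · rw [hc0 j hj]
    exact zero_mem _

end Normalization

/-! ### Exponents and triangular changes of generators -/

section Triangular

open MvPolynomial

variable {e r m : ℕ}

theorem uCoeff_zero_mul {K : Type*} [CommSemiring K] (P Q : MvPolynomial (Fin e ⊕ Fin r) K) :
    uCoeff 0 (P * Q) = uCoeff 0 P * uCoeff 0 Q := by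
  simp only [uCoeff, map_mul, ← constantCoeff_eq]

variable {K : Type*} [Field K]

/-- Only the part of a polynomial in `Y` matters for its exponent. -/
theorem isExponent_rename_uCoeff {P : MvPolynomial (Fin e ⊕ Fin r) K} {B : Fin r →₀ ℕ} :
    IsExponent P B ↔
      IsExponent (rename Sum.inr (uCoeff 0 P) : MvPolynomial (Fin e ⊕ Fin r) K) B := by
  have : ∀ d : (Fin e ⊕ Fin r) →₀ ℕ, uPart d = 0 → coeff d P =
      coeff d (rename Sum.inr (uCoeff 0 P) : MvPolynomial (Fin e ⊕ Fin r) K) := fun d hd => by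
    rw [← pairExp_parts d, hd, coeff_rename_pairExp, coeff_uCoeff]
  refine Iff.of_eq (congrArg (IsLeast · (toDegLex B)) (Set.ext fun b => exists_congr fun d => ?_))
  constructor
  · rintro ⟨h1, h2, h3⟩
    exact ⟨this d h2 ▸ h1, h2, h3⟩
  · rintro ⟨h1, h2, h3⟩
    exact ⟨(this d h2).symm ▸ h1, h2, h3⟩

/-- Terms divisible by some `U_i` do not contribute to the exponents of an ideal. -/
theorem exponents_span_image_subset {F : Fin m → MvPolynomial (Fin e ⊕ Fin r) K}
    {G : Fin m → MvPolynomial (Fin r) K} (hF : ∀ j, uCoeff 0 (F j) = G j) (s : Set (Fin m)) :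
    exponents (Ideal.span (F '' s)) ⊆ exponents (yIdeal e G s) := by
  rintro B ⟨P, hP, hPB⟩
  refine ⟨_, rename_mem_yIdeal_of_mem ?_, isExponent_rename_uCoeff.1 hPB⟩
  obtain ⟨c, hc, rfl⟩ := mem_span_image_iff.1 hP
  refine mem_span_image_iff.2 ⟨fun j => uCoeff 0 (c j), fun j hj => ?_, ?_⟩
  · simp only [hc j hj, uCoeff, map_zero, coeff_zero]
  · rw [uCoeff_sum]
    exact Finset.sum_congr rfl fun j _ => by rw [uCoeff_zero_mul, hF]

/-- A unitriangular change of generators. -/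
theorem span_image_sub_eq {A : Type*} [CommRing A] {G p : Fin m → A}
    (hp : ∀ i, p i ∈ Ideal.span (G '' {j | j < i})) {s : Set (Fin m)} (hs : IsLowerSet s) :
    Ideal.span ((fun i => G i - p i) '' s) = Ideal.span (G '' s) := by
  have hle : ∀ {H : Fin m → A} {i}, i ∈ s → Ideal.span (H '' {j | j < i}) ≤ Ideal.span (H '' s) :=
    fun hi => Ideal.span_mono (Set.image_mono fun j hj => hs (le_of_lt hj) hi)
  apply le_antisymm
  · rw [Ideal.span_le]
    rintro _ ⟨i, hi, rfl⟩
    exact Ideal.sub_mem _ (Ideal.subset_span ⟨i, hi, rfl⟩) (hle hi (hp i))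
  · rw [Ideal.span_le]
    rintro _ ⟨i, hi, rfl⟩
    induction i using WellFoundedLT.induction with
    | ind i ih =>
      have h1 : p i ∈ Ideal.span ((fun i => G i - p i) '' s) :=
        Ideal.span_le.2 (by
          rintro _ ⟨j, hj, rfl⟩
          exact ih j hj (hs (le_of_lt hj) hi)) (hp i)
      have := Ideal.add_mem _ (Ideal.subset_span (Set.mem_image_of_mem _ hi)) h1
      rwa [sub_add_cancel] at this

theorem yIdeal_eq_of_span_eq {G G' : Fin m → MvPolynomial (Fin r) K} {s : Set (Fin m)}
    (h : Ideal.span (G' '' s) = Ideal.span (G '' s)) : yIdeal e G' s = yIdeal e G s := by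
  have : ∀ {H H' : Fin m → MvPolynomial (Fin r) K}, Ideal.span (H' '' s) = Ideal.span (H '' s) →
      yIdeal e H' s ≤ yIdeal e H s := fun hh => Ideal.span_le.2 (by
    rintro _ ⟨j, hj, rfl⟩
    exact rename_mem_yIdeal_of_mem (hh ▸ Ideal.subset_span ⟨j, hj, rfl⟩))
  exact le_antisymm (this h) (this h.symm)

theorem setOf_exists_lt_eq_image {A : Type*} (F : Fin m → A) (i : Fin m) :
    {x | ∃ j < i, x = F j} = F '' {j | j < i} := by
  ext x
  exact exists_congr fun j => and_congr_right fun _ => eq_comm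

end Triangular

/-! ### Properties of normalized systems -/

section NormalizedSystems

open IsLocalRing MvPolynomial

variable {R : Type*} [CommRing R] [IsLocalRing R] {e r m : ℕ} {u : Fin e → R} {y : Fin r → R}

theorem exponents_span_initZeroUY (f : Fin m → R) (i : Fin m) :
    exponents (Ideal.span {F | ∃ j < i, F = initZeroUY u y (f j)}) =
      exponents (yIdeal e (fun i => initZero u y (f i)) {j | j < i}) := by
  rw [setOf_exists_lt_eq_image (fun j => initZeroUY u y (f j)), yIdeal]
  rfl

/-- A vertex-initial form differs from the `0`-initial form in `⟨U⟩` only, if the vertex is not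
`0`. -/
theorem uCoeff_zero_initVertex {v : Fin e → ℝ} (hv : v ≠ 0) (g : R) :
    uCoeff 0 (initVertex u y v g) = initZero u y g := by
  classical
  ext B
  rw [coeff_uCoeff, initVertex, coeff_add, initZeroUY, coeff_rename_pairExp, coeff_sum,
    add_eq_left]
  refine Finset.sum_eq_zero fun d hd => ?_
  rw [coeff_monomial, if_neg]
  rintro rfl
  refine hv ?_
  rw [← (Finset.mem_filter.1 hd).2.2]
  funext i
  rw [slopePoint, uVec, uPart_pairExp, Finsupp.zero_apply, Nat.cast_zero, zero_div, Pi.zero_apply]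

theorem IsVertex.ne_zero {D : Set (Fin e → ℝ)} {v : Fin e → ℝ} (hv : IsVertex D v) : v ≠ 0 := by
  rintro rfl
  obtain ⟨a, -, -, ha⟩ := hv
  have h1 : (0 : Fin e → ℝ) ∈ {w ∈ D | linForm a w = 1} := ha ▸ Set.mem_singleton _
  have h2 : linForm a (0 : Fin e → ℝ) = 0 := by simp [linForm]
  exact zero_ne_one (h2.symm.trans h1.2)

/-- A system whose expansions involve only monomials which are normalized with respect to its
polyhedron is vertex-normalized. -/
theorem vertexNormalized_of_mem_upperClosure {g : Fin m → R}
    (h0 : (0 : Fin e → ℝ) ∉ polyhedron u y g)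
    (hg : ∀ i d, (expansion u y (g i)).coeff d ≠ 0 →
      d ∈ upperClosure (normalizedSet (ord u y (g i)) (polyhedron u y g)
        (exponents (yIdeal e (fun i => initZero u y (g i)) {j | j < i})))) :
    VertexNormalized u y g where
  zero i d hd _ := by
    rw [exponents_span_initZeroUY] at hd
    rw [coeff_initZeroUY]
    split_ifs with hh
    · by_contra hne
      exact yPart_notMem_of_uPart_eq_zero h0 (hg i d fun hz => hne (by rw [hz, map_zero]))
        hh.2 hh.1 hd
    · rfl
  vertex v hv i d hd _ := by
    rw [setOf_exists_lt_eq_image (fun j => initVertex u y v (g j))] at hd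
    replace hd :=
      exponents_span_image_subset (fun j => uCoeff_zero_initVertex hv.ne_zero (g j)) _ hd
    by_contra hne
    obtain ⟨h1, ⟨h2, h3⟩ | ⟨h2, rfl⟩⟩ := coeff_initVertex hne
    · exact yPart_notMem_of_uPart_eq_zero h0 (hg i d h1) h3 h2 hd
    · exact yPart_notMem_of_isVertex (hg i d h1) h2 hv hd
  empty he i d hd hle := by
    rw [exponents_span_initZeroUY] at hd
    by_contra hne
    exact yPart_notMem_of_eq_empty he (hg i d hne) hle hd

/-- A change of the `0`-initial form by an element of the ideal of the preceding ones is trivial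
between `0`-normalized systems. -/
theorem ZeroNormalized.eq_zero {f g : Fin m → R} (hf : ZeroNormalized u y f)
    (hg : ZeroNormalized u y g) {i : Fin m}
    (hspan : Ideal.span ((fun j => initZero u y (g j)) '' {j | j < i}) =
      Ideal.span ((fun j => initZero u y (f j)) '' {j | j < i}))
    (hmem : initZero u y (f i) - initZero u y (g i) ∈
      Ideal.span ((fun j => initZero u y (f j)) '' {j | j < i})) :
    initZero u y (g i) = initZero u y (f i) := by
  by_contra hne
  obtain ⟨B, hB, hBe⟩ := exists_mem_exponents (e := e) hmem fun hz => hne (sub_eq_zero.1 hz).symm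
  have hcoeff : ∀ {g : Fin m → R}, ZeroNormalized u y g →
      B ∈ exponents (yIdeal e (fun i => initZero u y (g i)) {j | j < i}) →
        coeff B (initZero u y (g i)) = 0 := by
    intro g hg hBe
    by_cases hdeg : B.degree = ord u y (g i)
    · have := hg i (pairExp 0 B)
        (by rw [exponents_span_initZeroUY, yPart_pairExp]; exact hBe)
        (by rw [yDeg, yPart_pairExp, hdeg])
      exact (coeff_rename_pairExp _ _).symm.trans this
    · rw [coeff_initZero, if_neg hdeg]
  rw [coeff_sub, hcoeff hf hBe, hcoeff hg (yIdeal_eq_of_span_eq hspan ▸ hBe), sub_zero] at hB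
  exact hB rfl

variable [IsNoetherianRing R] {ω : Fin e ⊕ Fin r → ℕ} {N : ℕ}

/-- If the initial form of `g` is in `K[Y]`, then it has the same exponent as `g`. -/
theorem isExponent_expansion_iff (h : IsRSP u y) (hω : IsWeighting ω N) {g : R} {n : ℕ}
    {G : MvPolynomial (Fin r) (ResidueField R)} (hG0 : G ≠ 0)
    (hg : IsInit (Sum.elim u y) ω (N * n) g (rename Sum.inr G)) {B : Fin r →₀ ℕ} :
    IsExponent (expansion u y g) B ↔
      IsExponent (rename Sum.inr G : MvPolynomial (Fin e ⊕ Fin r) (ResidueField R)) B := by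
  obtain ⟨h1, h2⟩ := (isInit_iff_coeff h hω.pos).1 hg
  set S : Set (DegLex (Fin r →₀ ℕ)) :=
    {b | ∃ d, (expansion u y g).coeff d ≠ 0 ∧ uPart d = 0 ∧ toDegLex (yPart d) = b} with hS
  set T : Set (DegLex (Fin r →₀ ℕ)) :=
    {b | ∃ d, (rename Sum.inr G : MvPolynomial (Fin e ⊕ Fin r) (ResidueField R)).coeff d ≠ 0 ∧
      uPart d = 0 ∧ toDegLex (yPart d) = b} with hT
  have hTS : T ⊆ S := by
    rintro _ ⟨d, hd, hu, rfl⟩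
    refine ⟨d, fun hz => hd ?_, hu, rfl⟩
    rw [h2, hz, map_zero, ite_self]
  have hTn : T.Nonempty := by
    obtain ⟨B, hB⟩ := exists_coeff_ne_zero hG0
    exact ⟨_, pairExp 0 B, by rwa [coeff_rename_pairExp], uPart_pairExp 0 B, rfl⟩
  -- the exponents in `S` outside of `T` have larger degrees
  have hST : ∀ b ∈ S, b ∈ T ∨ ∀ b' ∈ T, b' < b := by
    rintro _ ⟨d, hd, hu, rfl⟩
    have hw := h1 d hd
    rcases hw.eq_or_lt with heq | hlt
    · refine Or.inl ⟨d, ?_, hu, rfl⟩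
      rw [h2, if_pos heq.symm]
      exact residue_coeff_expansion_ne_zero h hd
    · right
      rintro _ ⟨d', hd', hu', rfl⟩
      rw [h2] at hd'
      have hw' : Finsupp.weight ω d' = N * n := by
        by_contra hne
        rw [if_neg hne] at hd'
        exact hd' rfl
      rw [weight_eq_of_uPart_eq_zero hω hu] at hlt
      rw [weight_eq_of_uPart_eq_zero hω hu'] at hw'
      rw [← hw'] at hlt
      exact Finsupp.DegLex.lt_iff.2 (Or.inl (Nat.lt_of_mul_lt_mul_left hlt))
  change IsLeast S _ ↔ IsLeast T _
  constructor
  · rintro ⟨hB, hlow⟩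
    refine ⟨(hST _ hB).resolve_right fun hh => ?_, fun b hb => hlow (hTS hb)⟩
    obtain ⟨b, hb⟩ := hTn
    exact (hh b hb).not_ge (hlow (hTS hb))
  · rintro ⟨hB, hlow⟩
    refine ⟨hTS hB, fun b hb => ?_⟩
    rcases hST b hb with hb | hb
    · exact hlow hb
    · exact (hb _ hB).le

end NormalizedSystems

/-! ### Normalized standard bases -/

section NormalizedStandardBases

open IsLocalRing MvPolynomial

variable {R : Type*} [CommRing R] [IsLocalRing R] [IsNoetherianRing R] {e r m : ℕ}
  {u : Fin e → R} {y : Fin r → R} {f : Fin m → R} {J : Ideal R} {a : Fin e → ℚ}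
  {ω : Fin e ⊕ Fin r → ℕ} {N : ℕ}

theorem IsReferenceDatum.zero_notMem (h : IsRSP u y) (hf : IsReferenceDatum u y J f a) :
    (0 : Fin e → ℝ) ∉ polyhedron u y f := fun h0 => by
  obtain ⟨c, hc, hcf⟩ := hf.exists_bound h
  have h1 := hcf 0 h0
  have h2 : linForm a (0 : Fin e → ℝ) = 0 := by simp [linForm]
  linarith

/-- The subtraction of multiples of its predecessors changes the initial form of `f i` by an element
of the ideal of the preceding initial forms, if the resulting element has no points outside of the
polyhedron of `f`. -/
theorem IsReferenceDatum.exists_isInit_sub (h : IsRSP u y) (hf : IsReferenceDatum u y J f a)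
    (hω : IsWeighting ω N)
    (hωa : ∀ d : (Fin e ⊕ Fin r) →₀ ℕ, (Finsupp.weight ω d : ℝ) = N * weight a d) {i : Fin m}
    {c : Fin m → R} (hc : ∀ j, ¬ j < i → c j = 0)
    (hcw : ∀ j, c j ∈ wIdeal (Sum.elim u y) ω (N * ord u y (f i) - N * ord u y (f j)))
    (hpoint : ∀ d, (expansion u y (f i - ∑ j, c j * f j)).coeff d ≠ 0 → yDeg d < ord u y (f i) →
      slopePoint (ord u y (f i)) d ∈ polyhedron u y f) :
    ∃ p ∈ Ideal.span ((fun j => initZero u y (f j)) '' {j | j < i}),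
      IsInit (Sum.elim u y) ω (N * ord u y (f i)) (f i - ∑ j, c j * f j)
        (rename Sum.inr (initZero u y (f i) - p)) := by
  have hI := hf.hasInitialForms h hω hωa
  obtain ⟨Q, hQ, hQI⟩ := hI.exists_isInit_sum (s := {j | j < i}) hc hcw
  have hinit := (hI.isInit i).sub hQI
  refine ⟨uCoeff 0 Q, uCoeff_mem_of_mem_yIdeal hQ 0, ?_⟩
  suffices hQ' : rename Sum.inr (initZero u y (f i)) - Q =
      rename Sum.inr (initZero u y (f i) - uCoeff 0 Q) by rwa [← hQ']
  ext d
  by_cases hd : uPart d = 0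
  · rw [← pairExp_parts d, hd, coeff_rename_pairExp, coeff_sub, coeff_sub, coeff_rename_pairExp,
      coeff_uCoeff]
  · have h1 : coeff d (rename Sum.inr (initZero u y (f i) - uCoeff 0 Q)) = 0 := by
      by_contra hne
      exact hd (CharPoly.coeff_rename_ne_zero hne).1
    rw [h1]
    by_contra hne
    have h2 : Finsupp.weight ω d = N * ord u y (f i) := hinit.isWeightedHomogeneous hne
    have h3 : (expansion u y (f i - ∑ j, c j * f j)).coeff d ≠ 0 := fun hz => by
      rw [((isInit_iff_coeff h hω.pos).1 hinit).2, hz, map_zero, ite_self] at hne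
      exact hne rfl
    have h4 : weight a d = ord u y (f i) := by
      have := hωa d
      rw [h2, Nat.cast_mul] at this
      exact (mul_left_cancel₀ (Nat.cast_pos.2 hω.pos_eq).ne' this).symm
    rcases lt_or_ge (yDeg d) (ord u y (f i)) with hlt | hge
    · obtain ⟨b, hb, hbf⟩ := hf.exists_bound h
      have := (lt_linForm_slopePoint_iff (a := a) hlt).1 (hb.trans_le (hbf _ (hpoint d h3 hlt)))
      exact this.ne' h4
    · have h5 := linForm_uVec_pos hf.positive hd
      have h6 : (ord u y (f i) : ℝ) ≤ yDeg d := Nat.cast_le.2 hge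
      rw [weight] at h4
      linarith

/-- A unitriangular change of the initial forms of a standard basis gives a standard basis. -/
theorem IsReferenceDatum.of_isInit_sub (h : IsRSP u y) (hf : IsReferenceDatum u y J f a)
    (hω : IsWeighting ω N)
    (hωa : ∀ d : (Fin e ⊕ Fin r) →₀ ℕ, (Finsupp.weight ω d : ℝ) = N * weight a d) {g : Fin m → R}
    (hgJ : ∀ i, g i ∈ J) {p : Fin m → MvPolynomial (Fin r) (ResidueField R)}
    (hp : ∀ i, p i ∈ Ideal.span ((fun j => initZero u y (f j)) '' {j | j < i}))
    (hord : ∀ i, ord u y (g i) = ord u y (f i))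
    (hzero : ∀ i, initZero u y (g i) = initZero u y (f i) - p i)
    (hinit : ∀ i, IsInit (Sum.elim u y) ω (N * ord u y (f i)) (g i)
      (rename Sum.inr (initZero u y (g i)))) : IsReferenceDatum u y J g a := by
  have hspan : ∀ {s : Set (Fin m)}, IsLowerSet s →
      Ideal.span ((fun j => initZero u y (g j)) '' s) =
        Ideal.span ((fun j => initZero u y (f j)) '' s) := fun hs => by
    simp only [hzero]
    exact span_image_sub_eq hp hs
  have hnot : ∀ i, initZero u y (g i) ∉ Ideal.span {F | ∃ j < i, F = initZero u y (g j)} := by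
    intro i hi
    refine hf.notMem i ?_
    rw [setOf_exists_lt_eq_image (fun j => initZero u y (g j)), hspan (s := {j | j < i})
      (isLowerSet_Iio i), hzero] at hi
    rw [setOf_exists_lt_eq_image (fun j => initZero u y (f j))]
    have := Ideal.add_mem _ hi (hp i)
    rwa [sub_add_cancel] at this
  have hne : ∀ i, initZero u y (g i) ≠ 0 := fun i hz => hnot i (hz ▸ zero_mem _)
  have hne' : ∀ i, (rename Sum.inr (initZero u y (g i)) :
      MvPolynomial (Fin e ⊕ Fin r) (ResidueField R)) ≠ 0 := fun i hz =>
    hne i ((map_eq_zero_iff _ (rename_injective _ Sum.inr_injective)).1 hz)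
  refine ⟨hf.positive, hgJ, fun i hz => ?_, fun i => ?_, ?_, fun i j hij => ?_, hnot⟩
  · exact hne' i ((hinit i).unique (isParameterSystem_of_isRSP h) hω.pos
      (isInit_zero (hz.symm ▸ zero_mem _)))
  · exact initL_eq_of_isInit h hω hωa (hinit i) (hne' i)
  · rw [hf.span_eq, ← Set.image_univ, ← Set.image_univ]
    exact (yIdeal_eq_of_span_eq (hspan isLowerSet_univ)).symm
  · rw [hord, hord]
    exact hf.ord_mono i j hij

/-- Every standard basis is transformed by a unitriangular matrix into a vertex-normalized one which
computes the polyhedron of the ideal. -/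
theorem IsReferenceDatum.exists_vertexNormalized (h : IsRSP u y)
    (hf : IsReferenceDatum u y J f a) : ∃ c : Fin m → Fin m → R, (∀ i j, ¬ j < i → c i j = 0) ∧
      ∃ g : Fin m → R, (∀ i, g i = f i - ∑ j, c i j * f j) ∧
      IsReferenceDatum u y J g a ∧ VertexNormalized u y g ∧
      (ZeroNormalized u y f → IncreasingExponents u y f → IncreasingExponents u y g) ∧
      polyhedron u y g = polyhedronIdeal u y J := by
  obtain ⟨ω, N, hω, hωa⟩ := exists_isWeighting (r := r) hf.positive
  have hD := hf.isFSubset_polyhedronIdeal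
  choose c hc hcw hcE using fun i => hf.exists_normalized h hω hωa i
  refine ⟨c, hc, fun i => f i - ∑ j, c i j * f j, fun i => rfl, ?_⟩
  choose p hp hpI using fun i => hf.exists_isInit_sub h hω hωa (hc i) (hcw i) fun d hd hlt =>
    hf.polyhedronIdeal_subset (slopePoint_mem_of_mem_upperClosure hD (hcE i d hd) hlt)
  set g : Fin m → R := fun i => f i - ∑ j, c i j * f j with hg
  have hne : ∀ i, initZero u y (f i) - p i ≠ 0 := fun i hz => by
    refine hf.notMem i ?_
    rw [setOf_exists_lt_eq_image (fun j => initZero u y (f j)), sub_eq_zero.1 hz]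
    exact hp i
  have hord : ∀ i, ord u y (g i) = ord u y (f i) := fun i =>
    (ord_eq_and_initZero_eq h hω (hne i) (hpI i)).1
  have hzero : ∀ i, initZero u y (g i) = initZero u y (f i) - p i := fun i =>
    (ord_eq_and_initZero_eq h hω (hne i) (hpI i)).2
  have hinit : ∀ i, IsInit (Sum.elim u y) ω (N * ord u y (f i)) (g i)
      (rename Sum.inr (initZero u y (g i))) := fun i => by rw [hzero]; exact hpI i
  have hgJ : ∀ i, g i ∈ J := fun i => Ideal.sub_mem _ (hf.mem i)
    (Ideal.sum_mem _ fun j _ => Ideal.mul_mem_left _ _ (hf.mem j))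
  have hgd : IsReferenceDatum u y J g a := hf.of_isInit_sub h hω hωa hgJ hp hord hzero hinit
  have hpoly : polyhedron u y g = polyhedronIdeal u y J := by
    refine (polyhedron_subset hD fun i d hd hlt => ?_).antisymm hgd.polyhedronIdeal_subset
    rw [hord] at hlt ⊢
    exact slopePoint_mem_of_mem_upperClosure hD (hcE i d hd) hlt
  have hspan : ∀ i, Ideal.span ((fun j => initZero u y (g j)) '' {j | j < i}) =
      Ideal.span ((fun j => initZero u y (f j)) '' {j | j < i}) := fun i => by
    simp only [hzero]
    exact span_image_sub_eq hp (isLowerSet_Iio i)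
  have hvn : VertexNormalized u y g := by
    refine vertexNormalized_of_mem_upperClosure (hgd.zero_notMem h) fun i d hd => ?_
    rw [hpoly, hord, yIdeal_eq_of_span_eq (hspan i)]
    exact hcE i d hd
  refine ⟨hgd, hvn, fun hfn hexp => ?_, hpoly⟩
  have heq : ∀ i, initZero u y (g i) = initZero u y (f i) := fun i =>
    hfn.eq_zero hvn.zero (hspan i) (by rw [hzero, sub_sub_cancel]; exact hp i)
  have hiff : ∀ i B, IsExponent (expansion u y (g i)) B ↔ IsExponent (expansion u y (f i)) B := by
    intro i B
    rw [isExponent_expansion_iff h hω (hgd.initZero_ne_zero i) (hinit i), heq]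
    exact (isExponent_expansion_iff h hω (hf.initZero_ne_zero i)
      ((hf.hasInitialForms h hω hωa).isInit i)).symm
  exact fun i j hij B B' hB hB' => hexp i j hij B B' ((hiff i B).1 hB) ((hiff j B').1 hB')

end NormalizedStandardBases

end CharPoly

end

theorem mainTheorem2 {R : Type uR} [CommRing R] [IsRegularLocalRing R]
    (hR : CharPoly.IsExcellentRing R) (J : Ideal R) (hJ : J ≠ ⊥)
    {e r : ℕ} (u : Fin e → R) (y : Fin r → R) (huy : CharPoly.IsRSP u y)
    (hdir : CharPoly.YieldsDirectrix u y J)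
    {m : ℕ} (f : Fin m → R) (hf : CharPoly.IsStandardBasis u y J f)
    (hfu : ∀ i, f i ∉ Ideal.span (Set.range u)) :
    ∃ (h : Fin m → Fin m → R) (g : Fin m → R),
      (∀ i, g i = f i - ∑ j ∈ Finset.univ.filter (fun j => j < i), h i j * f j) ∧
      CharPoly.IsStandardBasis u y J g ∧
      CharPoly.VertexNormalized u y g ∧
      (CharPoly.ZeroNormalized u y f → CharPoly.IncreasingExponents u y f →
        CharPoly.IncreasingExponents u y g) ∧
      CharPoly.polyhedron u y g = CharPoly.polyhedronIdeal u y J := by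
  obtain ⟨a, ha⟩ := hf
  obtain ⟨c, hc, g, hg, hgd, hvn, hexp, hpoly⟩ := ha.exists_vertexNormalized huy
  refine ⟨c, g, fun i => ?_, ⟨a, hgd⟩, hvn, hexp, hpoly⟩
  rw [hg, Finset.sum_filter_of_ne fun j _ hne => ?_]
  by_contra hj
  exact hne (by rw [hc i j hj, zero_mul])
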